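/- Write $e(x)=e^{2\pi i x}$ and, for an interval $I$, let $|I|$ denote its length. There is an absolute constant $\varepsilon_0>0$ such that the following holds for all $A_5>0$ and $\delta\in(0,\tfrac1{100})$ with $A_5\delta\leqslant\varepsilon_0$. There is a constant $C>0$, depending only on $A_5$ and $\delta$, such that for every real $T>0$, every real $R$ with $T^{-10A_5\delta}\leqslant R\leqslant T^{10A_5\delta}$, every interval $I\subset[0,T]$ of length $|I|>T^{1-A_5\delta}$, all real $\mu,\nu,\beta$ with $$|\mu-1|\leqslant 2T^{-1+A_5\delta},\qquad \beta=\frac1R,\qquad |\nu|\leqslant 2T^{-1+A_5\delta},$$ and every $t_0\in[0,T]$: put $$m_{\mu,\nu}(t)=\frac{\mu t}{\mu+\nu t}$$ (with the value $0$ where $\mu+\nu t=0$), and suppose that either 1. $|\nu|>T^{100A_5\delta}\,|I|^{-2}$, or 2. there are a natural number $r$ with $T^{1000A_5\delta}\leqslant r\leqslant |I|\,T^{-1000A_5\delta}$ and an integer $b$ with $(b,r)=1$ such that $$\Big|\beta-\frac br\Big|\leqslant\frac{T^{1000A_5\delta}}{r|I|}.$$ Then $$\Big|\sum_{pq\in I}e\big(m_{\mu,\nu}(pq-t_0)\,\beta\big)\Big|\leqslant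 C\,|I|\,T^{-15A_5\delta},$$ where the sum runs over all ordered pairs $(p,q)$ of primes with $pq\in I$. -/

import Mathlib

open MeasureTheory

noncomputable section

/-- The additive character `e(x) = exp(2πix)` of the real line. -/
def addChar (x : ℝ) : ℂ :=
  Complex.exp (2 * Real.pi * Complex.I * x)

/-- The fractional linear map `m_{μ,ν}(t) = μt / (μ + νt)`.  At its pole (at most one real `t` when
`μ ≠ 0`) it takes the value `0`. -/
def fracLin (μ ν t : ℝ) : ℝ :=
  μ * t / (μ + ν * t)

/-- The ordered pairs `(p, q)` of primes whose product lies in `I`. -/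
def primePairs (I : Set ℝ) : Set (ℕ × ℕ) :=
  {x | x.1.Prime ∧ x.2.Prime ∧ (x.1 : ℝ) * (x.2 : ℝ) ∈ I}

/-- For a bounded `I` the set of pairs is finite, so the sum below is an honest finite sum. -/
theorem primePairs_finite {I : Set ℝ} {T : ℝ} (hI : I ⊆ Set.Icc 0 T) : (primePairs I).Finite := by
  refine Set.Finite.subset ((Finset.Iic ⌊T⌋₊ ×ˢ Finset.Iic ⌊T⌋₊ : Finset (ℕ × ℕ)).finite_toSet) ?_
  rintro ⟨p, q⟩ ⟨hp, hq, h⟩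
  have h2 : p * q ≤ ⌊T⌋₊ := Nat.le_floor (by push_cast; exact (hI h).2)
  simp only [Finset.coe_product, Set.mem_prod, Finset.coe_Iic, Set.mem_Iic]
  exact ⟨(Nat.le_mul_of_pos_right p hq.pos).trans h2, (Nat.le_mul_of_pos_left q hp.pos).trans h2⟩

/-- The exponential sum `∑_{pq ∈ I} e(m_{μ,ν}(pq - t₀) β)` over ordered pairs of primes. -/
def semiprimeSum (I : Set ℝ) (μ ν β t₀ : ℝ) : ℂ :=
  ∑ᶠ x ∈ primePairs I, addChar (fracLin μ ν ((x.1 : ℝ) * (x.2 : ℝ) - t₀) * β)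

end

/-! Put `L = T ^ (A₅ * δ)`. As `|I| > T / L`, it is enough to bound the sum by `T / L ^ 16`. Fixed
powers of `L` may therefore be lost freely, provided a larger power is saved. Dividing numerator and
denominator by `μ` replaces the phase by `f(y) = β(y - t₀) / (1 + ν'(y - t₀))` with `ν' = ν / μ`,
and `β` lies between `L ^ (-10)` and `L ^ 10`.

A power saving for sums over primes comes from bilinear structure alone. Cutting the primes at `U ≈
L ^ 270` splits the products `pq` into three kinds. If both factors exceed `U`, the sum is already a
bilinear form. If one factor is at most `U`, Vaughan's identity is applied to the other. If both are
small, the sum is trivial. What remains are type I sums over multiples of `k ≤ U ^ 3` and type II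
forms whose two variables exceed `U` (`norm_arithSum_primeInd_mul_primeInd_le`). In a type II form
Cauchy–Schwarz removes the coefficients (`norm_bilinearSum_le`) and leaves sums over `m` of `e(f(p m
n₁) - f(p m n₂))`.

If `|ν|` is large, these smooth sums have curvature and van der Corput's second derivative test
applies. Type I needs `f''` bounded above and below. Type II needs the same for `2f'' + y f'''`,
because `y` times this is the derivative of `y² f''(y)`, which governs the curvature of the
correlation (`SmoothPhase.norm_sum_correlation_le`). For the fractional linear phase both are
comparable to `βν` when `|ν'| T ≤ 1/8`. Otherwise they degenerate only near the pole and near one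
zero, and those neighbourhoods are discarded trivially
(`SieveScales.norm_semiprimeSumOn_mobius_le_of_steep`).

If `|ν|` is small, hypothesis 2 must hold. The phase then differs from a linear one by a function
whose exponential has total variation `O(L ^ 112)`, and summation by parts removes it
(`SieveScales.norm_semiprimeSumOn_mobius_le_of_small`). For the linear phase `β n` the approximation
`b / r` spaces the multiples of `β` modulo 1, and this saves `L ^ 132` up to logarithmic factors
(`norm_arithSum_primeInd_linear_le`).

Logarithms and divisor counts are bounded by `ℓ = T ^ (A₅ * δ / 10)`, so `ℓ ^ 10 = L`. This needs
`T` large; bounded `T` goes into the constant. -/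

/-! ### The additive character. -/

theorem norm_addChar (x : ℝ) : ‖addChar x‖ = 1 := by
  have h : (2 * Real.pi * Complex.I * x : ℂ) = ((2 * Real.pi * x : ℝ) : ℂ) * Complex.I := by
    push_cast; ring
  rw [addChar, h, Complex.norm_exp_ofReal_mul_I]

theorem addChar_add (x y : ℝ) : addChar (x + y) = addChar x * addChar y := by
  rw [addChar, addChar, addChar, ← Complex.exp_add]
  congr 1; push_cast; ring

theorem addChar_intCast (k : ℤ) : addChar k = 1 := by
  rw [addChar, Complex.exp_eq_one_iff]
  exact ⟨k, by push_cast; ring⟩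

theorem addChar_add_intCast (x : ℝ) (k : ℤ) : addChar (x + k) = addChar x := by
  rw [addChar_add, addChar_intCast, mul_one]

theorem addChar_neg (x : ℝ) : addChar (-x) = (starRingEnd ℂ) (addChar x) := by
  rw [addChar, addChar, ← Complex.exp_conj]
  congr 1
  simp only [map_mul, Complex.conj_ofReal, Complex.conj_I, map_ofNat]
  push_cast; ring

theorem addChar_eq_cos_add_sin (x : ℝ) :
    addChar x = Real.cos (2 * Real.pi * x) + Real.sin (2 * Real.pi * x) * Complex.I := by
  have h : (2 * Real.pi * Complex.I * x : ℂ) = ((2 * Real.pi * x : ℝ) : ℂ) * Complex.I := by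
    push_cast; ring
  rw [addChar, h, Complex.exp_mul_I, Complex.ofReal_cos, Complex.ofReal_sin]

/-! ### Summation by parts against weights of bounded variation. -/

/-- Summation by parts on an interval of integers. -/
theorem sum_mul_eq_by_parts {R : Type*} [CommRing R] (c w : ℕ → R) {a b : ℕ} (h : a < b) :
    ∑ n ∈ Finset.Ioc a b, c n * w n = (∑ n ∈ Finset.Ioc a b, c n) * w b -
      ∑ n ∈ Finset.Ico (a + 1) b, (∑ k ∈ Finset.Ioc a n, c k) * (w (n + 1) - w n) := by
  induction b, h using Nat.le_induction with
  | base => simp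
  | succ b hb ih =>
    have hb' : a < b := hb
    rw [Finset.sum_Ioc_succ_top (by omega), ih, Finset.sum_Ioc_succ_top (by omega),
      Finset.sum_Ico_succ_top (by omega)]
    ring

theorem norm_sum_mul_le_of_partial {c w : ℕ → ℂ} {a b : ℕ} {S : ℝ} (h : a < b)
    (hS : ∀ b', a ≤ b' → b' ≤ b → ‖∑ n ∈ Finset.Ioc a b', c n‖ ≤ S) :
    ‖∑ n ∈ Finset.Ioc a b, c n * w n‖ ≤
      S * (‖w b‖ + ∑ n ∈ Finset.Ico (a + 1) b, ‖w (n + 1) - w n‖) := by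
  rw [sum_mul_eq_by_parts c w h, mul_add, Finset.mul_sum]
  refine (norm_sub_le _ _).trans (add_le_add ?_ ?_)
  · rw [norm_mul]
    exact mul_le_mul_of_nonneg_right (hS b h.le le_rfl) (norm_nonneg _)
  · refine (norm_sum_le _ _).trans (Finset.sum_le_sum fun n hn => ?_)
    rw [Finset.mem_Ico] at hn
    rw [norm_mul]
    exact mul_le_mul_of_nonneg_right (hS n (by omega) (by omega)) (norm_nonneg _)

/-- For decreasing nonnegative weights the last value plus the total variation telescopes to the
first value. For increasing weights it only telescopes to at most twice the last value, hence the
factor 2 in the companion bound. -/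
theorem norm_sum_mul_le_of_antitone {c : ℕ → ℂ} {w : ℕ → ℝ} {a b : ℕ} {S W : ℝ} (hS0 : 0 ≤ S)
    (hS : ∀ b', a ≤ b' → b' ≤ b → ‖∑ n ∈ Finset.Ioc a b', c n‖ ≤ S) (hW : 0 ≤ W)
    (hw : ∀ n, a < n → n < b → w (n + 1) ≤ w n) (hw0 : ∀ n, a < n → n ≤ b → 0 ≤ w n ∧ w n ≤ W) :
    ‖∑ n ∈ Finset.Ioc a b, c n * (w n : ℂ)‖ ≤ S * W := by
  rcases le_or_gt b a with h | h
  · rw [Finset.Ioc_eq_empty (by omega), Finset.sum_empty, norm_zero]; positivity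
  refine (norm_sum_mul_le_of_partial h hS).trans (mul_le_mul_of_nonneg_left ?_ hS0)
  have h1 : ∀ n ∈ Finset.Ico (a + 1) b, ‖(w (n + 1) : ℂ) - w n‖ = (- w (n + 1)) - (- w n) := by
    intro n hn
    rw [Finset.mem_Ico] at hn
    rw [← Complex.ofReal_sub, Complex.norm_real, Real.norm_eq_abs,
      abs_of_nonpos (by linarith [hw n (by omega) (by omega)])]
    ring
  rw [Finset.sum_congr rfl h1, Finset.sum_Ico_sub (fun n => - w n) (by omega), Complex.norm_real,
    Real.norm_eq_abs, abs_of_nonneg (hw0 b h le_rfl).1]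
  linarith [(hw0 (a + 1) (by omega) (by omega)).2]

theorem norm_sum_mul_le_of_monotone {c : ℕ → ℂ} {w : ℕ → ℝ} {a b : ℕ} {S W : ℝ} (hS0 : 0 ≤ S)
    (hS : ∀ b', a ≤ b' → b' ≤ b → ‖∑ n ∈ Finset.Ioc a b', c n‖ ≤ S) (hW : 0 ≤ W)
    (hw : ∀ n, a < n → n < b → w n ≤ w (n + 1)) (hw0 : ∀ n, a < n → n ≤ b → 0 ≤ w n ∧ w n ≤ W) :
    ‖∑ n ∈ Finset.Ioc a b, c n * (w n : ℂ)‖ ≤ 2 * S * W := by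
  rcases le_or_gt b a with h | h
  · rw [Finset.Ioc_eq_empty (by omega), Finset.sum_empty, norm_zero]; positivity
  have := norm_sum_mul_le_of_partial (w := fun n => (w n : ℂ)) h hS
  refine this.trans ?_
  rw [show 2 * S * W = S * (2 * W) by ring]
  refine mul_le_mul_of_nonneg_left ?_ hS0
  have h1 : ∀ n ∈ Finset.Ico (a + 1) b, ‖(w (n + 1) : ℂ) - w n‖ = w (n + 1) - w n := by
    intro n hn
    rw [Finset.mem_Ico] at hn
    rw [← Complex.ofReal_sub, Complex.norm_real, Real.norm_eq_abs,
      abs_of_nonneg (by linarith [hw n (by omega) (by omega)])]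
  rw [Finset.sum_congr rfl h1, Finset.sum_Ico_sub w (by omega), Complex.norm_real,
    Real.norm_eq_abs, abs_of_nonneg (hw0 b h le_rfl).1]
  linarith [(hw0 (a + 1) (by omega) (by omega)).1, (hw0 b h le_rfl).2]

/-! ### Kusmin–Landau and van der Corput's second derivative test. -/

theorem norm_sum_addChar_le_card (u : ℕ → ℝ) (s : Finset ℕ) :
    ‖∑ n ∈ s, addChar (u n)‖ ≤ s.card := by
  refine (norm_sum_le _ _).trans ?_
  simp [norm_addChar]

theorem two_mul_le_sin_pi {δ θ : ℝ} (hδ : 0 ≤ δ) (h1 : δ ≤ θ) (h2 : θ ≤ 1 - δ) :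
    2 * δ ≤ Real.sin (Real.pi * θ) := by
  have hpi := Real.pi_pos
  rcases le_total θ (1 / 2) with h | h
  · have := Real.mul_le_sin (x := Real.pi * θ) (by nlinarith) (by nlinarith)
    have e : 2 / Real.pi * (Real.pi * θ) = 2 * θ := by field_simp
    linarith
  · have := Real.mul_le_sin (x := Real.pi * (1 - θ)) (by nlinarith) (by nlinarith)
    have e : 2 / Real.pi * (Real.pi * (1 - θ)) = 2 * (1 - θ) := by field_simp
    rw [show Real.pi * (1 - θ) = Real.pi - Real.pi * θ by ring, Real.sin_pi_sub] at this
    rw [show Real.pi - Real.pi * θ = Real.pi * (1 - θ) by ring] at this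
    linarith

/-- The real part is constant and the imaginary part is a cotangent. Along a monotone sequence of
`θ` inside one period the variation of this inverse therefore telescopes, which is the core of
Kusmin–Landau. -/
theorem inv_addChar_sub_one {θ : ℝ} (h : Real.sin (Real.pi * θ) ≠ 0) :
    (addChar θ - 1)⁻¹ = -(1 / 2) -
      ((Real.cos (Real.pi * θ) / Real.sin (Real.pi * θ) : ℝ) : ℂ) / 2 * Complex.I := by
  have h' : (Real.sin (Real.pi * θ) : ℂ) ≠ 0 := by exact_mod_cast h
  refine inv_eq_of_mul_eq_one_right ?_
  rw [addChar_eq_cos_add_sin, show 2 * Real.pi * θ = 2 * (Real.pi * θ) by ring, Real.cos_two_mul,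
    Real.sin_two_mul]
  have hcs : (Real.cos (Real.pi * θ) : ℂ) ^ 2 = 1 - (Real.sin (Real.pi * θ) : ℂ) ^ 2 := by
    have := Real.cos_sq' (Real.pi * θ)
    exact_mod_cast this
  push_cast [-Complex.ofReal_sin, -Complex.ofReal_cos] at *
  set s : ℂ := (Real.sin (Real.pi * θ) : ℂ)
  set k : ℂ := (Real.cos (Real.pi * θ) : ℂ)
  field_simp
  have hI : Complex.I ^ 2 = -1 := Complex.I_sq
  linear_combination (-2 * k * Complex.I) * hcs - 2 * k ^ 2 * s * hI

/-- The Kusmin–Landau inequality. -/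
theorem norm_sum_addChar_le_of_monotone_diff {u : ℕ → ℝ} {a b : ℕ} {δ : ℝ} {k : ℤ} (hδ : 0 < δ)
    (hmono : ∀ n, a < n → n < b → u (n + 1) - u n ≤ u (n + 2) - u (n + 1))
    (hk : ∀ n, a < n → n ≤ b → k + δ ≤ u (n + 1) - u n ∧ u (n + 1) - u n ≤ k + 1 - δ) :
    ‖∑ n ∈ Finset.Ioc a b, addChar (u n)‖ ≤ 2 / δ := by
  rcases le_or_gt b a with h | h
  · rw [Finset.Ioc_eq_empty (by omega), Finset.sum_empty, norm_zero]; positivity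
  set θ : ℕ → ℝ := fun n => u (n + 1) - u n - k with hθ
  set s : ℕ → ℝ := fun n => Real.sin (Real.pi * θ n) with hs
  set w : ℕ → ℂ := fun n => (addChar (θ n) - 1)⁻¹ with hw
  set g : ℕ → ℝ := fun n => Real.cos (Real.pi * θ n) / s n with hg
  have hsin : ∀ n, a < n → n ≤ b → 2 * δ ≤ s n := fun n h1 h2 =>
    two_mul_le_sin_pi hδ.le (by have := (hk n h1 h2).1; simp only [hθ]; linarith)
      (by have := (hk n h1 h2).2; simp only [hθ]; linarith)
  have hwg : ∀ n, a < n → n ≤ b → w n = -(1 / 2) - (g n : ℂ) / 2 * Complex.I := fun n h1 h2 =>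
    inv_addChar_sub_one (by have := hsin n h1 h2; simp only [hs] at this; linarith)
  have hgb : ∀ n, a < n → n ≤ b → |g n| ≤ 1 / (2 * δ) := by
    intro n h1 h2
    have := hsin n h1 h2
    rw [hg, abs_div, abs_of_pos (by linarith : 0 < s n)]
    exact div_le_div₀ zero_le_one (Real.abs_cos_le_one _) (by linarith) this
  -- Each term is a difference of consecutive terms times the weight `w n`. The differences have
  -- partial sums of size at most 2, so only the variation of `w` matters.
  have hterm : ∀ n ∈ Finset.Ioc a b,
      addChar (u n) = (addChar (u (n + 1)) - addChar (u n)) * w n := by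
    intro n hn
    rw [Finset.mem_Ioc] at hn
    have hne : addChar (θ n) - 1 ≠ 0 := by
      intro h0
      have h1 := hwg n hn.1 hn.2
      simp only [hw, h0, inv_zero] at h1
      have := congrArg Complex.re h1
      simp at this
    have h1 : addChar (u (n + 1)) = addChar (u n) * addChar (θ n) := by
      rw [← addChar_add, ← addChar_add_intCast (u n + θ n) k]
      congr 1; simp only [hθ]; ring
    rw [h1, hw]
    field_simp
  rw [Finset.sum_congr rfl hterm]
  have hpart : ∀ b', a ≤ b' → b' ≤ b →
      ‖∑ n ∈ Finset.Ioc a b', (addChar (u (n + 1)) - addChar (u n))‖ ≤ 2 := by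
    intro b' h1 _
    have : Finset.Ioc a b' = Finset.Ico (a + 1) (b' + 1) := by ext; simp
    rw [this, Finset.sum_Ico_sub (fun n => addChar (u n)) (by omega)]
    refine (norm_sub_le _ _).trans ?_
    rw [norm_addChar, norm_addChar]; norm_num
  refine (norm_sum_mul_le_of_partial h hpart).trans ?_
  have hdiff : ∀ n ∈ Finset.Ico (a + 1) b, ‖w (n + 1) - w n‖ = (-(g (n + 1)) / 2) - (-(g n) / 2) := by
    intro n hn
    rw [Finset.mem_Ico] at hn
    rw [hwg n (by omega) (by omega), hwg (n + 1) (by omega) (by omega)]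
    have h0 : g (n + 1) ≤ g n := by
      have p1 := hsin n (by omega) (by omega)
      have p2 := hsin (n + 1) (by omega) (by omega)
      simp only [hg]
      rw [div_le_div_iff₀ (by linarith) (by linarith)]
      have hm := hmono n (by omega) (by omega)
      have k1 := hk n (by omega) (by omega)
      have k2 := hk (n + 1) (by omega) (by omega)
      -- That the cotangent decreases amounts to nonnegativity of the sine of the difference of the
      -- two angles.
      have := Real.sin_nonneg_of_nonneg_of_le_pi (x := Real.pi * (θ (n + 1) - θ n))
        (mul_nonneg Real.pi_pos.le (by simp only [hθ]; linarith))
        (by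
          have : θ (n + 1) - θ n ≤ 1 := by simp only [hθ]; linarith
          nlinarith [Real.pi_pos])
      rw [mul_sub, Real.sin_sub] at this
      simp only [hs]
      linarith
    have : -(1 / 2) - (g (n + 1) : ℂ) / 2 * Complex.I - (-(1 / 2) - (g n : ℂ) / 2 * Complex.I) =
        (((g n - g (n + 1)) / 2 : ℝ) : ℂ) * Complex.I := by push_cast; ring
    rw [this, norm_mul, Complex.norm_I, mul_one, Complex.norm_real, Real.norm_eq_abs,
      abs_of_nonneg (by linarith)]
    ring
  rw [Finset.sum_congr rfl hdiff, Finset.sum_Ico_sub (fun n => -(g n) / 2) (by omega)]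
  have hwb : ‖w b‖ ≤ 1 / (2 * δ) := by
    -- The interval `[k + δ, k + 1 - δ]` is nonempty, so `δ ≤ 1/2`; this absorbs the constant real
    -- part `1/2` of `w b`.
    have hδ2 : 1 / 2 ≤ 1 / (4 * δ) := by
      have := hk b (by omega) le_rfl
      exact div_le_div₀ zero_le_one le_rfl (by positivity) (by linarith)
    rw [hwg b (by omega) le_rfl]
    refine (norm_sub_le _ _).trans ?_
    rw [norm_mul, Complex.norm_I, mul_one, norm_div, Complex.norm_real, Real.norm_eq_abs]
    have := hgb b (by omega) le_rfl
    have e : 1 / (2 * δ) = 1 / (4 * δ) + 1 / (4 * δ) := by field_simp; norm_num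
    have e' : 1 / (2 * δ) / 2 = 1 / (4 * δ) := by field_simp; norm_num
    norm_num
    norm_num at e e' hδ2
    norm_num at this
    linarith
  have h1 := abs_le.1 (hgb b (by omega) (by omega))
  have h2 := abs_le.1 (hgb (a + 1) (by omega) (by omega))
  have e2 : 1 / (2 * δ) = 1 / δ / 2 := by field_simp
  have e3 : 2 / δ = 2 * (1 / δ) := by field_simp
  have : 0 < 1 / δ := by positivity
  rw [e3]
  rw [e2] at h1 h2 hwb
  linarith [h1.1, h1.2, h2.1, h2.2]

/-- The least and the greatest element of the set are at most `(y - x) / l` apart. -/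
theorem card_le_of_separated {θ : ℕ → ℝ} {a b : ℕ} {l x y : ℝ} (hl : 0 < l) (hxy : x ≤ y)
    (hθ : ∀ n m, a < n → n ≤ m → m ≤ b → l * (m - n) ≤ θ m - θ n) :
    ((((Finset.Ioc a b).filter fun n => x ≤ θ n ∧ θ n ≤ y).card : ℕ) : ℝ) ≤ (y - x) / l + 1 := by
  set s := (Finset.Ioc a b).filter fun n => x ≤ θ n ∧ θ n ≤ y with hs
  rcases s.eq_empty_or_nonempty with h | h
  · rw [h]; simp only [Finset.card_empty, Nat.cast_zero]
    have : 0 ≤ (y - x) / l := div_nonneg (by linarith) hl.le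
    linarith
  have hmin := s.min'_mem h
  have hmax := s.max'_mem h
  have hle : s.min' h ≤ s.max' h := s.min'_le _ hmax
  have hsub : s ⊆ Finset.Icc (s.min' h) (s.max' h) := fun n hn =>
    Finset.mem_Icc.2 ⟨s.min'_le _ hn, s.le_max' _ hn⟩
  have hcard := Finset.card_le_card hsub
  rw [Nat.card_Icc] at hcard
  generalize s.min' h = m at *
  generalize s.max' h = M at *
  simp only [hs, Finset.mem_filter, Finset.mem_Ioc] at hmin hmax
  have := hθ m M hmin.1.1 hle hmax.1.2
  have h2 : ((M : ℝ) - m) ≤ (y - x) / l := by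
    rw [le_div_iff₀ hl]; linarith [hmin.2.1, hmax.2.2]
  have h3 : (s.card : ℝ) ≤ ((M + 1 - m : ℕ) : ℝ) := by exact_mod_cast hcard
  rw [Nat.cast_sub (by omega)] at h3
  push_cast at h3
  linarith

/-- Van der Corput's second derivative test, in terms of second differences. -/
theorem norm_sum_addChar_le_of_second_diff {u : ℕ → ℝ} {a b : ℕ} {l l' : ℝ} (hl : 0 < l)
    (hll : l ≤ l') (hab : a ≤ b)
    (hu : ∀ n, a < n → n + 2 ≤ b →
      l ≤ u (n + 2) - 2 * u (n + 1) + u n ∧ u (n + 2) - 2 * u (n + 1) + u n ≤ l') :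
    ‖∑ n ∈ Finset.Ioc a b, addChar (u n)‖ ≤ 6 * (l' * (b - a) + 2) / √l + 1 := by
  have hsl : 0 < √l := Real.sqrt_pos.2 hl
  have hsq : √l * √l = l := Real.mul_self_sqrt hl.le
  have hl' : 0 < l' := hl.trans_le hll
  have hba : (0 : ℝ) ≤ b - a := by
    have : (a : ℝ) ≤ b := by exact_mod_cast hab
    linarith
  rcases hab.eq_or_lt with rfl | hab'
  · simp only [Finset.Ioc_self, Finset.sum_empty, norm_zero, sub_self, mul_zero, zero_add]
    positivity
  -- Kusmin–Landau on `(a, c]` involves `u (c + 1)`, so the last term is split off; it accounts for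
  -- the final `+ 1`.
  obtain ⟨c, rfl⟩ : ∃ c, b = c + 1 := ⟨b - 1, by omega⟩
  rcases lt_or_ge 1 l with h1 | h1
  · refine (norm_sum_addChar_le_card _ _).trans ?_
    rw [Nat.card_Ioc, Nat.cast_sub hab]
    have : (((c + 1 : ℕ) : ℝ) - a) ≤ 6 * (l' * ((c + 1 : ℕ) - a) + 2) / √l := by
      rw [le_div_iff₀ hsl]
      have h2 : 1 ≤ √l := Real.one_le_sqrt.2 h1.le
      have : √l ≤ l' := by nlinarith
      nlinarith
    linarith
  rw [Finset.sum_Ioc_succ_top (by omega)]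
  refine (norm_add_le _ _).trans ?_
  rw [norm_addChar]
  refine add_le_add ?_ le_rfl
  set θ : ℕ → ℝ := fun n => u (n + 1) - u n with hθ
  have hstep : ∀ n, a < n → n + 1 ≤ c → l ≤ θ (n + 1) - θ n ∧ θ (n + 1) - θ n ≤ l' := by
    intro n h1 h2
    have := hu n h1 (by omega)
    simp only [hθ]
    constructor <;> linarith [this.1, this.2]
  have hlow : ∀ n m, a < n → n ≤ m → m ≤ c → l * (m - n) ≤ θ m - θ n := by
    intro n m h1 h2
    induction m, h2 using Nat.le_induction with
    | base => intro _; simp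
    | succ m hm ih =>
      intro h3
      have := (hstep m (by omega) h3).1
      push_cast
      linarith [ih (by omega)]
  have hup : ∀ n m, a < n → n ≤ m → m ≤ c → θ m - θ n ≤ l' * (m - n) := by
    intro n m h1 h2
    induction m, h2 using Nat.le_induction with
    | base => intro _; simp
    | succ m hm ih =>
      intro h3
      have := (hstep m (by omega) h3).2
      push_cast
      linarith [ih (by omega)]
  have hmono : ∀ n m, a < n → n ≤ m → m ≤ c → θ n ≤ θ m := by
    intro n m h1 h2 h3
    have h4 : (n : ℝ) ≤ m := by exact_mod_cast h2
    have := hlow n m h1 h2 h3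
    nlinarith
  rcases le_or_gt c a with hca | hca
  · rw [Finset.Ioc_eq_empty (by omega), Finset.sum_empty, norm_zero]
    have := mul_nonneg hl'.le hba
    positivity
  -- This `δ` balances the two costs: at most `2δ / l + 1` indices have `θ` within `δ` of a given
  -- integer, and Kusmin–Landau gives `2 / δ` on the rest of the period.
  set δ : ℝ := √l / 2 with hδ
  have hδ0 : 0 < δ := by positivity
  -- The shift by `δ` makes each fibre the set where `θ` lies in `[k - δ, k + 1 - δ)`: one window
  -- around the integer `k`, then one Kusmin–Landau range. There are at most `l' (b - a) + 2`
  -- fibres.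
  set κ : ℕ → ℤ := fun n => ⌊θ n + δ⌋ with hκ
  have hmaps : ∀ n ∈ Finset.Ioc a c, κ n ∈ Finset.Icc (κ (a + 1)) (κ c) := by
    intro n hn
    rw [Finset.mem_Ioc] at hn
    rw [Finset.mem_Icc]
    refine ⟨Int.floor_le_floor ?_, Int.floor_le_floor ?_⟩
    · linarith [hmono (a + 1) n (by omega) (by omega) hn.2]
    · linarith [hmono n c hn.1 hn.2 le_rfl]
  rw [← Finset.sum_fiberwise_of_maps_to hmaps]
  have hfib : ∀ k ∈ Finset.Icc (κ (a + 1)) (κ c),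
      ‖∑ n ∈ Finset.Ioc a c with κ n = k, addChar (u n)‖ ≤ 6 / √l := by
    intro k _
    rw [← Finset.sum_filter_add_sum_filter_not _ (fun n => θ n ≤ k + δ)]
    refine (norm_add_le _ _).trans ?_
    have hA : ‖∑ n ∈ ((Finset.Ioc a c).filter fun n => κ n = k).filter (fun n => θ n ≤ k + δ),
        addChar (u n)‖ ≤ 1 / √l + 1 := by
      refine (norm_sum_addChar_le_card _ _).trans ?_
      have h2 := card_le_of_separated (x := k - δ) (y := k + δ) hl (by linarith) hlow
      have h3 : (k + δ - (k - δ)) / l = 1 / √l := by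
        rw [div_eq_div_iff hl.ne' hsl.ne', hδ]; linarith
      rw [h3] at h2
      refine le_trans ?_ h2
      rw [Nat.cast_le]
      refine Finset.card_le_card fun n hn => ?_
      simp only [Finset.mem_filter] at hn ⊢
      refine ⟨hn.1.1, ?_, hn.2⟩
      have := Int.floor_le (θ n + δ)
      rw [show ⌊θ n + δ⌋ = k from hn.1.2] at this
      linarith
    have hB : ‖∑ n ∈ ((Finset.Ioc a c).filter fun n => κ n = k).filter (fun n => ¬ θ n ≤ k + δ),
        addChar (u n)‖ ≤ 4 / √l := by
      set s := ((Finset.Ioc a c).filter fun n => κ n = k).filter (fun n => ¬ θ n ≤ k + δ) with hs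
      have hmem : ∀ n, n ∈ s ↔ (a < n ∧ n ≤ c) ∧ (k + δ < θ n ∧ θ n < k + 1 - δ) := by
        intro n
        simp only [hs, Finset.mem_filter, Finset.mem_Ioc, not_le, hκ, Int.floor_eq_iff]
        constructor
        · rintro ⟨⟨h1, h2, h3⟩, h4⟩; exact ⟨h1, h4, by linarith⟩
        · rintro ⟨h1, h2, h3⟩; exact ⟨⟨h1, by linarith, by linarith⟩, h2⟩
      rcases s.eq_empty_or_nonempty with h | h
      · rw [h, Finset.sum_empty, norm_zero]; positivity
      have hmin := (hmem _).1 (s.min'_mem h)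
      have hmax := (hmem _).1 (s.max'_mem h)
      have hseq : s = Finset.Ioc (s.min' h - 1) (s.max' h) := by
        ext n
        rw [Finset.mem_Ioc]
        constructor
        · intro hn
          have h1 := s.min'_le n hn
          have h2 := s.le_max' n hn
          have h3 := ((hmem n).1 hn).1.1
          omega
        · rintro ⟨h1, h2⟩
          have h3 : s.min' h ≤ n := by omega
          have h4 := hmono _ n hmin.1.1 h3 (by omega)
          have h5 := hmono n _ (by omega) h2 hmax.1.2
          exact (hmem n).2 ⟨⟨by omega, by omega⟩, by linarith [hmin.2.1], by linarith [hmax.2.2]⟩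
      have h4 : 4 / √l = 2 / δ := by rw [hδ]; field_simp; norm_num
      rw [hseq, h4]
      have hin : ∀ n, s.min' h - 1 < n → n ≤ s.max' h → n ∈ s := fun n h1 h2 => by
        rw [hseq]; exact Finset.mem_Ioc.2 ⟨h1, h2⟩
      refine norm_sum_addChar_le_of_monotone_diff (k := k) hδ0 (fun n h1 h2 => ?_)
        (fun n h1 h2 => ?_)
      · have h5 := ((hmem n).1 (hin n h1 h2.le)).1.1
        have h6 := ((hmem (n + 1)).1 (hin (n + 1) (by omega) (by omega))).1.2
        exact hmono n (n + 1) h5 (by omega) h6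
      · have h5 := (hmem n).1 (hin n h1 h2)
        exact ⟨h5.2.1.le, h5.2.2.le⟩
    have h6 : 1 ≤ 1 / √l := by
      rw [le_div_iff₀ hsl, one_mul]
      exact Real.sqrt_le_one.2 h1
    have e1 : 4 / √l = 4 * (1 / √l) := by field_simp
    have e2 : 6 / √l = 6 * (1 / √l) := by field_simp
    rw [e1] at hB
    rw [e2]
    linarith
  refine (norm_sum_le _ _).trans ((Finset.sum_le_sum hfib).trans ?_)
  rw [Finset.sum_const, nsmul_eq_mul, Int.card_Icc]
  have hk : κ (a + 1) ≤ κ c := (Finset.mem_Icc.1 (hmaps c (Finset.mem_Ioc.2 ⟨hca, le_rfl⟩))).1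
  have hcast : (((κ c + 1 - κ (a + 1)).toNat : ℕ) : ℝ) = (κ c : ℝ) + 1 - κ (a + 1) := by
    have : (((κ c + 1 - κ (a + 1)).toNat : ℤ)) = κ c + 1 - κ (a + 1) := Int.toNat_of_nonneg (by omega)
    exact_mod_cast this
  rw [hcast]
  have h1' := Int.floor_le (θ c + δ)
  have h2' := Int.lt_floor_add_one (θ (a + 1) + δ)
  have h3 := hup (a + 1) c (by omega) (by omega) le_rfl
  have h4 : (κ c : ℝ) + 1 - κ (a + 1) ≤ l' * (((c + 1 : ℕ) : ℝ) - a) + 2 := by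
    simp only [hκ]
    push_cast at h3 ⊢
    nlinarith
  calc ((κ c : ℝ) + 1 - κ (a + 1)) * (6 / √l) ≤ (l' * (((c + 1 : ℕ) : ℝ) - a) + 2) * (6 / √l) :=
        mul_le_mul_of_nonneg_right h4 (by positivity)
    _ = _ := by ring

/-- Two applications of the mean value theorem turn the second difference into a value of `g''`. -/
theorem second_diff_mem_of_deriv {g g' g'' : ℝ → ℝ} {x l l' : ℝ}
    (h1 : ∀ y ∈ Set.Icc x (x + 2), HasDerivAt g (g' y) y)
    (h2 : ∀ y ∈ Set.Icc x (x + 2), HasDerivAt g' (g'' y) y)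
    (h3 : ∀ y ∈ Set.Icc x (x + 2), l ≤ g'' y ∧ g'' y ≤ l') :
    l ≤ g (x + 2) - 2 * g (x + 1) + g x ∧ g (x + 2) - 2 * g (x + 1) + g x ≤ l' := by
  have hF : ∀ y ∈ Set.Icc x (x + 1),
      HasDerivAt (fun z => g (z + 1) - g z) (g' (y + 1) - g' y) y := by
    intro y hy
    exact ((h1 (y + 1) ⟨by linarith [hy.1], by linarith [hy.2]⟩).comp_add_const y 1).sub
      (h1 y ⟨hy.1, by linarith [hy.2]⟩)
  obtain ⟨ξ, hξ, e1⟩ := exists_hasDerivAt_eq_slope (fun z => g (z + 1) - g z)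
    (fun y => g' (y + 1) - g' y) (show x < x + 1 by linarith)
    (fun y hy => (hF y hy).continuousAt.continuousWithinAt)
    (fun y hy => hF y ⟨hy.1.le, hy.2.le⟩)
  obtain ⟨ζ, hζ, e2⟩ := exists_hasDerivAt_eq_slope g' g'' (show ξ < ξ + 1 by linarith)
    (fun y hy => (h2 y ⟨by linarith [hy.1, hξ.1], by linarith [hy.2, hξ.2]⟩).continuousAt.continuousWithinAt)
    (fun y hy => h2 y ⟨by linarith [hy.1, hξ.1], by linarith [hy.2, hξ.2]⟩)
  have h4 := h3 ζ ⟨by linarith [hζ.1, hξ.1], by linarith [hζ.2, hξ.2]⟩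
  have e : g (x + 2) - 2 * g (x + 1) + g x = g'' ζ := by
    rw [e2, add_sub_cancel_left, div_one]
    simp only [add_sub_cancel_left, div_one] at e1
    rw [e1, show x + 1 + 1 = x + 2 by ring]; ring
  rw [e]; exact h4

/-! ### Bilinear forms: Cauchy–Schwarz and dyadic decomposition. -/

/-- The bilinear form `∑_{m ∈ S} ∑_{n ∈ R} α m β n w(mn)` restricted to `A < mn ≤ B`. -/
def bilinearSum (S R : Finset ℕ) (A B : ℕ) (α β w : ℕ → ℂ) : ℂ :=
  ∑ m ∈ S, ∑ n ∈ R, if A < m * n ∧ m * n ≤ B then α m * β n * w (m * n) else 0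

theorem bilinearSum_comm (S R : Finset ℕ) (A B : ℕ) (α β w : ℕ → ℂ) :
    bilinearSum S R A B α β w = bilinearSum R S A B β α w := by
  rw [bilinearSum, bilinearSum, Finset.sum_comm]
  refine Finset.sum_congr rfl fun m _ => Finset.sum_congr rfl fun n _ => ?_
  rw [mul_comm n m, mul_comm (α n)]

/-- Cauchy–Schwarz over the `M` values of `m` drops `α`; opening the square and moving the sum over
`m` inside drops `β`. -/
theorem norm_bilinearSum_sq_le {M : ℕ} {R : Finset ℕ} {A B : ℕ} {α β w : ℕ → ℂ}
    (hα : ∀ n, ‖α n‖ ≤ 1) (hβ : ∀ n, ‖β n‖ ≤ 1) :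
    ‖bilinearSum (Finset.Ioc M (2 * M)) R A B α β w‖ ^ 2 ≤
      M * ∑ n₁ ∈ R, ∑ n₂ ∈ R, ‖∑ m ∈ Finset.Ioc M (2 * M),
        (if A < m * n₁ ∧ m * n₁ ≤ B then w (m * n₁) else 0) *
          (starRingEnd ℂ) (if A < m * n₂ ∧ m * n₂ ≤ B then w (m * n₂) else 0)‖ := by
  set c : ℕ → ℕ → ℂ := fun m n => if A < m * n ∧ m * n ≤ B then w (m * n) else 0 with hc
  set S := Finset.Ioc M (2 * M) with hS
  have h1 : ‖bilinearSum S R A B α β w‖ ≤ ∑ m ∈ S, ‖∑ n ∈ R, β n * c m n‖ := by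
    refine (norm_sum_le _ _).trans (Finset.sum_le_sum fun m _ => ?_)
    have : (∑ n ∈ R, if A < m * n ∧ m * n ≤ B then α m * β n * w (m * n) else 0) =
        α m * ∑ n ∈ R, β n * c m n := by
      rw [Finset.mul_sum]
      refine Finset.sum_congr rfl fun n _ => ?_
      simp only [hc]
      split_ifs <;> ring
    rw [this, norm_mul]
    exact mul_le_of_le_one_left (norm_nonneg _) (hα m)
  have h2 : (∑ m ∈ S, ‖∑ n ∈ R, β n * c m n‖) ^ 2 ≤
      M * ∑ m ∈ S, ‖∑ n ∈ R, β n * c m n‖ ^ 2 := by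
    refine sq_sum_le_card_mul_sum_sq.trans (le_of_eq ?_)
    congr 2
    rw [hS, Nat.card_Ioc]; omega
  have h3 : ((∑ m ∈ S, ‖∑ n ∈ R, β n * c m n‖ ^ 2 : ℝ) : ℂ) =
      ∑ n₁ ∈ R, ∑ n₂ ∈ R, β n₁ * (starRingEnd ℂ) (β n₂) *
        ∑ m ∈ S, c m n₁ * (starRingEnd ℂ) (c m n₂) := by
    push_cast
    simp_rw [← Complex.mul_conj', map_sum, Finset.sum_mul_sum, Finset.mul_sum]
    rw [Finset.sum_comm]
    refine Finset.sum_congr rfl fun n₁ _ => ?_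
    rw [Finset.sum_comm]
    refine Finset.sum_congr rfl fun n₂ _ => Finset.sum_congr rfl fun m _ => ?_
    rw [map_mul]; ring
  have h4 : ∑ m ∈ S, ‖∑ n ∈ R, β n * c m n‖ ^ 2 ≤ ∑ n₁ ∈ R, ∑ n₂ ∈ R,
      ‖∑ m ∈ S, c m n₁ * (starRingEnd ℂ) (c m n₂)‖ := by
    have h5 : (∑ m ∈ S, ‖∑ n ∈ R, β n * c m n‖ ^ 2 : ℝ) =
        ‖((∑ m ∈ S, ‖∑ n ∈ R, β n * c m n‖ ^ 2 : ℝ) : ℂ)‖ := by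
      rw [Complex.norm_real, Real.norm_of_nonneg (Finset.sum_nonneg fun _ _ => sq_nonneg _)]
    rw [h5, h3]
    refine (norm_sum_le _ _).trans (Finset.sum_le_sum fun n₁ _ => (norm_sum_le _ _).trans
      (Finset.sum_le_sum fun n₂ _ => ?_))
    rw [norm_mul, norm_mul, RCLike.norm_conj]
    exact mul_le_of_le_one_left (norm_nonneg _) (mul_le_one₀ (hβ _) (norm_nonneg _) (hβ _))
  calc _ ≤ (∑ m ∈ S, ‖∑ n ∈ R, β n * c m n‖) ^ 2 := by gcongr
    _ ≤ _ := h2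
    _ ≤ _ := by gcongr

/-- For fixed `n₁` the diagonal term costs `M`, and each difference `D < H` occurs at most once on
either side of `n₁`. Correlations are only needed over intervals of `m`, since the cutoffs for `n₁`
and `n₂` intersect in an interval. -/
theorem norm_bilinearSum_le_of_short {M N H : ℕ} {R : Finset ℕ} {A B : ℕ} {α β w : ℕ → ℂ}
    {κ : ℕ → ℝ} (hα : ∀ n, ‖α n‖ ≤ 1) (hβ : ∀ n, ‖β n‖ ≤ 1) (hw : ∀ n, ‖w n‖ ≤ 1)
    (hR : R ⊆ Finset.Ioc N (2 * N)) (hRH : ∀ n₁ ∈ R, ∀ n₂ ∈ R, n₁ - n₂ < H) (hRc : R.card ≤ H)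
    (hκ0 : ∀ D, 0 ≤ κ D)
    (hκ : ∀ n₁ ∈ Finset.Ioc N (2 * N), ∀ n₂ ∈ Finset.Ioc N (2 * N), n₂ < n₁ → n₁ - n₂ < H →
      ∀ a b, M ≤ a → a ≤ b → b ≤ 2 * M → (∀ m, a < m → m ≤ b → A < m * n₂ ∧ m * n₁ ≤ B) →
      ‖∑ m ∈ Finset.Ioc a b, w (m * n₁) * (starRingEnd ℂ) (w (m * n₂))‖ ≤ κ (n₁ - n₂)) :
    ‖bilinearSum (Finset.Ioc M (2 * M)) R A B α β w‖ ≤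
      √(M * (H * (M + 2 * ∑ D ∈ Finset.Ico 1 H, κ D))) := by
  refine Real.le_sqrt_of_sq_le ((norm_bilinearSum_sq_le hα hβ).trans
    (mul_le_mul_of_nonneg_left ?_ (Nat.cast_nonneg _)))
  set c : ℕ → ℕ → ℂ := fun m n => if A < m * n ∧ m * n ≤ B then w (m * n) else 0 with hc
  set S := Finset.Ioc M (2 * M) with hS
  set K : ℕ → ℕ → ℝ := fun n₁ n₂ => ‖∑ m ∈ S, c m n₁ * (starRingEnd ℂ) (c m n₂)‖ with hK
  have hdiag : ∀ n, K n n ≤ M := by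
    intro n
    refine (norm_sum_le _ _).trans ?_
    have : ∀ m ∈ S, ‖c m n * (starRingEnd ℂ) (c m n)‖ ≤ 1 := by
      intro m _
      have : ‖c m n‖ ≤ 1 := by
        simp only [hc]; split_ifs
        · exact hw _
        · simp
      rw [norm_mul, RCLike.norm_conj]
      exact mul_le_one₀ this (norm_nonneg _) this
    refine (Finset.sum_le_sum this).trans ?_
    rw [hS, Finset.sum_const, Nat.card_Ioc, nsmul_eq_mul, mul_one, Nat.cast_le]; omega
  have hoff : ∀ n₁ ∈ R, ∀ n₂ ∈ R, n₂ < n₁ → K n₁ n₂ ≤ κ (n₁ - n₂) := by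
    intro n₁ h1 n₂ h2 hlt
    have p2 : 0 < n₂ := by have := Finset.mem_Ioc.1 (hR h2); omega
    have p1 : 0 < n₁ := by omega
    -- With `n₂ < n₁` only the lower cutoff for `n₂` and the upper cutoff for `n₁` are binding.
    have hsum : ∑ m ∈ S, c m n₁ * (starRingEnd ℂ) (c m n₂) =
        ∑ m ∈ Finset.Ioc (max M (A / n₂)) (min (2 * M) (B / n₁)),
          w (m * n₁) * (starRingEnd ℂ) (w (m * n₂)) := by
      rw [← Finset.sum_filter_of_ne (p := fun m => A < m * n₂ ∧ m * n₁ ≤ B)]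
      · have : S.filter (fun m => A < m * n₂ ∧ m * n₁ ≤ B) =
            Finset.Ioc (max M (A / n₂)) (min (2 * M) (B / n₁)) := by
          ext m
          simp only [hS, Finset.mem_filter, Finset.mem_Ioc, max_lt_iff, le_min_iff,
            Nat.div_lt_iff_lt_mul p2, Nat.le_div_iff_mul_le p1]
          tauto
        rw [this]
        refine Finset.sum_congr rfl fun m hm => ?_
        rw [← this] at hm
        have h3 := (Finset.mem_filter.1 hm).2
        have h4 : m * n₂ ≤ m * n₁ := Nat.mul_le_mul_left m hlt.le
        simp only [hc]
        rw [if_pos ⟨by omega, h3.2⟩, if_pos ⟨h3.1, by omega⟩]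
      · intro m _ hne
        by_contra hcon
        refine hne ?_
        simp only [hc]
        by_cases q1 : A < m * n₂ ∧ m * n₂ ≤ B
        · have : ¬ (A < m * n₁ ∧ m * n₁ ≤ B) := fun q => hcon ⟨q1.1, q.2⟩
          rw [if_neg this, zero_mul]
        · rw [if_neg q1, map_zero, mul_zero]
    simp only [hK]
    rw [hsum]
    rcases le_or_gt (max M (A / n₂)) (min (2 * M) (B / n₁)) with hle | hgt
    · refine hκ n₁ (hR h1) n₂ (hR h2) hlt (hRH _ h1 _ h2) _ _ (le_max_left _ _) hle
        (min_le_left _ _) fun m hm1 hm2 => ?_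
      exact ⟨(Nat.div_lt_iff_lt_mul p2).1 ((le_max_right _ _).trans_lt hm1),
        (Nat.le_div_iff_mul_le p1).1 (hm2.trans (min_le_right _ _))⟩
    · rw [Finset.Ioc_eq_empty (by omega), Finset.sum_empty, norm_zero]
      exact hκ0 _
  have hsymm : ∀ n₁ n₂, K n₁ n₂ = K n₂ n₁ := by
    intro n₁ n₂
    simp only [hK]
    rw [← RCLike.norm_conj, map_sum]
    congr 1
    refine Finset.sum_congr rfl fun m _ => ?_
    rw [map_mul, RingHomCompTriple.comp_apply, RingHom.id_apply, mul_comm]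
  have hinner : ∀ n₁ ∈ R, ∑ n₂ ∈ R, K n₁ n₂ ≤ M + 2 * ∑ D ∈ Finset.Ico 1 H, κ D := by
    intro n₁ h1
    have hsplit : ∑ n₂ ∈ R, K n₁ n₂ = (∑ n₂ ∈ R with n₂ < n₁, K n₁ n₂) +
        ((∑ n₂ ∈ R with n₁ < n₂, K n₁ n₂) + K n₁ n₁) := by
      rw [← Finset.sum_filter_add_sum_filter_not R (fun n => n < n₁),
        ← Finset.sum_filter_add_sum_filter_not (R.filter fun n => ¬ n < n₁) (fun n => n₁ < n),
        Finset.filter_filter, Finset.filter_filter]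
      congr 2
      · refine Finset.sum_congr ?_ fun _ _ => rfl
        ext n; simp only [Finset.mem_filter]; constructor <;> rintro ⟨h, h'⟩ <;>
          refine ⟨h, ?_⟩ <;> omega
      · have : R.filter (fun n => ¬ n < n₁ ∧ ¬ n₁ < n) = {n₁} := by
          ext n; simp only [Finset.mem_filter, Finset.mem_singleton]
          constructor
          · rintro ⟨_, h⟩; omega
          · rintro rfl; exact ⟨h1, by omega⟩
        rw [this, Finset.sum_singleton]
    have hb1 : ∑ n₂ ∈ R with n₂ < n₁, K n₁ n₂ ≤ ∑ D ∈ Finset.Ico 1 H, κ D := by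
      refine (Finset.sum_le_sum (g := fun n₂ => κ (n₁ - n₂)) fun n₂ h2 => ?_).trans ?_
      · rw [Finset.mem_filter] at h2
        exact hoff n₁ h1 n₂ h2.1 h2.2
      · rw [← Finset.sum_image (f := κ) (g := fun n₂ => n₁ - n₂)]
        · refine Finset.sum_le_sum_of_subset_of_nonneg (fun D hD => ?_) fun D _ _ => hκ0 D
          obtain ⟨n₂, h2, rfl⟩ := Finset.mem_image.1 hD
          rw [Finset.mem_filter] at h2
          exact Finset.mem_Ico.2 ⟨by omega, hRH _ h1 _ h2.1⟩
        · intro x hx y hy hxy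
          simp only [Finset.coe_filter, Set.mem_ofPred_eq] at hx hy hxy
          omega
    have hb2 : ∑ n₂ ∈ R with n₁ < n₂, K n₁ n₂ ≤ ∑ D ∈ Finset.Ico 1 H, κ D := by
      refine (Finset.sum_le_sum (g := fun n₂ => κ (n₂ - n₁)) fun n₂ h2 => ?_).trans ?_
      · rw [Finset.mem_filter] at h2
        rw [hsymm]
        exact hoff n₂ h2.1 n₁ h1 h2.2
      · rw [← Finset.sum_image (f := κ) (g := fun n₂ => n₂ - n₁)]
        · refine Finset.sum_le_sum_of_subset_of_nonneg (fun D hD => ?_) fun D _ _ => hκ0 D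
          obtain ⟨n₂, h2, rfl⟩ := Finset.mem_image.1 hD
          rw [Finset.mem_filter] at h2
          exact Finset.mem_Ico.2 ⟨by omega, hRH _ h2.1 _ h1⟩
        · intro x hx y hy hxy
          simp only [Finset.coe_filter, Set.mem_ofPred_eq] at hx hy hxy
          omega
    rw [hsplit]
    linarith [hdiag n₁]
  refine (Finset.sum_le_sum hinner).trans ?_
  rw [Finset.sum_const, nsmul_eq_mul]
  refine mul_le_mul_of_nonneg_right (by exact_mod_cast hRc) ?_
  have := Finset.sum_nonneg fun D (_ : D ∈ Finset.Ico 1 H) => hκ0 D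
  positivity

/-- Cutting `(N, 2N]` into at most `N / H + 1` blocks of length `H` keeps the differences `n₁ - n₂`
below `H`. The free parameter `H` later balances the diagonal against the size of the second
derivative. -/
theorem norm_bilinearSum_le {M N H : ℕ} {A B : ℕ} {α β w : ℕ → ℂ} {κ : ℕ → ℝ} (hH : 0 < H)
    (hα : ∀ n, ‖α n‖ ≤ 1) (hβ : ∀ n, ‖β n‖ ≤ 1) (hw : ∀ n, ‖w n‖ ≤ 1) (hκ0 : ∀ D, 0 ≤ κ D)
    (hκ : ∀ n₁ ∈ Finset.Ioc N (2 * N), ∀ n₂ ∈ Finset.Ioc N (2 * N), n₂ < n₁ → n₁ - n₂ < H →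
      ∀ a b, M ≤ a → a ≤ b → b ≤ 2 * M → (∀ m, a < m → m ≤ b → A < m * n₂ ∧ m * n₁ ≤ B) →
      ‖∑ m ∈ Finset.Ioc a b, w (m * n₁) * (starRingEnd ℂ) (w (m * n₂))‖ ≤ κ (n₁ - n₂)) :
    ‖bilinearSum (Finset.Ioc M (2 * M)) (Finset.Ioc N (2 * N)) A B α β w‖ ≤
      (N / H + 1) * √(M * (H * (M + 2 * ∑ D ∈ Finset.Ico 1 H, κ D))) := by
  set R := Finset.Ioc N (2 * N) with hR
  set j : ℕ → ℕ := fun n => (n - N - 1) / H with hj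
  have hmaps : ∀ n ∈ R, j n ∈ Finset.range (N / H + 1) := by
    intro n hn
    rw [hR, Finset.mem_Ioc] at hn
    exact Finset.mem_range.2 (Nat.lt_succ_of_le (Nat.div_le_div_right (by omega)))
  have hsum : bilinearSum (Finset.Ioc M (2 * M)) R A B α β w = ∑ i ∈ Finset.range (N / H + 1),
      bilinearSum (Finset.Ioc M (2 * M)) (R.filter fun n => j n = i) A B α β w := by
    simp only [bilinearSum]
    refine Eq.trans ?_ Finset.sum_comm
    refine Finset.sum_congr rfl fun m _ => ?_
    rw [Finset.sum_fiberwise_of_maps_to hmaps]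
  have hblock : ∀ i ∈ Finset.range (N / H + 1),
      ‖bilinearSum (Finset.Ioc M (2 * M)) (R.filter fun n => j n = i) A B α β w‖ ≤
        √(M * (H * (M + 2 * ∑ D ∈ Finset.Ico 1 H, κ D))) := by
    intro i _
    have hsub : R.filter (fun n => j n = i) ⊆ Finset.Ioc (N + i * H) (N + i * H + H) := by
      intro n hn
      rw [Finset.mem_filter, hR, Finset.mem_Ioc] at hn
      have h1 : (n - N - 1) / H = i := hn.2
      have h2 := Nat.div_add_mod (n - N - 1) H
      have h3 := Nat.mod_lt (n - N - 1) hH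
      rw [h1, mul_comm] at h2
      rw [Finset.mem_Ioc]
      omega
    refine norm_bilinearSum_le_of_short hα hβ hw (Finset.filter_subset _ _) (fun n₁ h1 n₂ h2 => ?_)
      ?_ hκ0 hκ
    · have := Finset.mem_Ioc.1 (hsub h1)
      have := Finset.mem_Ioc.1 (hsub h2)
      omega
    · refine (Finset.card_le_card hsub).trans ?_
      rw [Nat.card_Ioc]; omega
  rw [hsum]
  refine (norm_sum_le _ _).trans ((Finset.sum_le_sum hblock).trans ?_)
  rw [Finset.sum_const, Finset.card_range, nsmul_eq_mul]
  refine mul_le_mul_of_nonneg_right ?_ (Real.sqrt_nonneg _)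
  push_cast
  have := @Nat.cast_div_le ℝ _ _ _ N H
  linarith

theorem sum_Ioc_dyadic {R : Type*} [AddCommMonoid R] (f : ℕ → R) (U J : ℕ) :
    ∑ m ∈ Finset.Ioc U (U * 2 ^ J), f m =
      ∑ i ∈ Finset.range J, ∑ m ∈ Finset.Ioc (U * 2 ^ i) (2 * (U * 2 ^ i)), f m := by
  induction J with
  | zero => simp
  | succ J ih =>
    rw [Finset.sum_range_succ, ← ih, show 2 * (U * 2 ^ J) = U * 2 ^ (J + 1) by ring]
    exact (Finset.sum_Ioc_consecutive f (Nat.le_mul_of_pos_right U (by positivity))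
      (Nat.mul_le_mul_left U (Nat.pow_le_pow_right (by norm_num) (by omega)))).symm

theorem norm_bilinearSum_le_of_dyadic {U J A B : ℕ} {α β w : ℕ → ℂ} {E : ℝ}
    (h : ∀ M N, U ≤ M → U ≤ N →
      ‖bilinearSum (Finset.Ioc M (2 * M)) (Finset.Ioc N (2 * N)) A B α β w‖ ≤ E) :
    ‖bilinearSum (Finset.Ioc U (U * 2 ^ J)) (Finset.Ioc U (U * 2 ^ J)) A B α β w‖ ≤ J ^ 2 * E := by
  have hU : ∀ i, U ≤ U * 2 ^ i := fun i => Nat.le_mul_of_pos_right U (by positivity)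
  have : bilinearSum (Finset.Ioc U (U * 2 ^ J)) (Finset.Ioc U (U * 2 ^ J)) A B α β w =
      ∑ i ∈ Finset.range J, ∑ j ∈ Finset.range J,
        bilinearSum (Finset.Ioc (U * 2 ^ i) (2 * (U * 2 ^ i)))
          (Finset.Ioc (U * 2 ^ j) (2 * (U * 2 ^ j))) A B α β w := by
    simp only [bilinearSum, sum_Ioc_dyadic]
    refine Finset.sum_congr rfl fun i _ => ?_
    rw [Finset.sum_comm]
  rw [this]
  refine (norm_sum_le _ _).trans ((Finset.sum_le_sum fun i _ => (norm_sum_le _ _).trans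
    (Finset.sum_le_sum fun j _ => h _ _ (hU i) (hU j))).trans (le_of_eq ?_))
  simp only [Finset.sum_const, Finset.card_range, nsmul_eq_mul]
  ring

/-! ### Vaughan's identity and sums over primes. -/

section

open scoped ArithmeticFunction.Moebius ArithmeticFunction.vonMangoldt ArithmeticFunction.zeta

/-- The sum `∑_{A < n ≤ B} F(n) w(n)`. -/
def arithSum (F : ArithmeticFunction ℝ) (A B : ℕ) (w : ℕ → ℂ) : ℂ :=
  ∑ n ∈ Finset.Ioc A B, (F n : ℂ) * w n

theorem arithSum_add (F G : ArithmeticFunction ℝ) (A B : ℕ) (w : ℕ → ℂ) :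
    arithSum (F + G) A B w = arithSum F A B w + arithSum G A B w := by
  simp only [arithSum, ArithmeticFunction.add_apply, Complex.ofReal_add, add_mul,
    Finset.sum_add_distrib]

theorem arithSum_sub (F G : ArithmeticFunction ℝ) (A B : ℕ) (w : ℕ → ℂ) :
    arithSum (F - G) A B w = arithSum F A B w - arithSum G A B w := by
  rw [eq_sub_iff_add_eq, ← arithSum_add, sub_add_cancel]

theorem arithSum_mul (F G : ArithmeticFunction ℝ) (A B : ℕ) (w : ℕ → ℂ) :
    arithSum (F * G) A B w =
      bilinearSum (Finset.Ioc 0 B) (Finset.Ioc 0 B) A B (fun n => F n) (fun n => G n) w := by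
  rw [bilinearSum, ← Finset.sum_product', ← Finset.sum_filter,
    ← Finset.sum_fiberwise_of_maps_to (t := Finset.Ioc A B) (g := fun x : ℕ × ℕ => x.1 * x.2)
      (fun x hx => Finset.mem_Ioc.2 (Finset.mem_filter.1 hx).2), arithSum]
  refine Finset.sum_congr rfl fun n hn => ?_
  rw [Finset.mem_Ioc] at hn
  rw [ArithmeticFunction.mul_apply,
    Nat.divisorsAntidiagonal_eq_prod_filter_of_le (N := B) (by omega) hn.2, Complex.ofReal_sum,
    Finset.sum_mul, Finset.filter_filter]
  refine Finset.sum_congr ?_ fun x hx => ?_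
  · ext x
    simp only [Finset.mem_filter]
    constructor
    · rintro ⟨h1, rfl⟩; exact ⟨h1, hn, rfl⟩
    · rintro ⟨h1, _, h2⟩; exact ⟨h1, h2⟩
  · rw [← (Finset.mem_filter.1 hx).2.2]; push_cast; ring

theorem bilinearSum_Ioc_zero (A B : ℕ) (α β w : ℕ → ℂ) :
    bilinearSum (Finset.Ioc 0 B) (Finset.Ioc 0 B) A B α β w =
      ∑ d ∈ Finset.Ioc 0 B, α d * ∑ m ∈ Finset.Ioc (A / d) (B / d), β m * w (d * m) := by
  refine Finset.sum_congr rfl fun d hd => ?_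
  rw [Finset.mem_Ioc] at hd
  have : (Finset.Ioc 0 B).filter (fun m => A < d * m ∧ d * m ≤ B) =
      Finset.Ioc (A / d) (B / d) := by
    ext m
    simp only [Finset.mem_filter, Finset.mem_Ioc, Nat.div_lt_iff_lt_mul hd.1,
      Nat.le_div_iff_mul_le hd.1, mul_comm d m]
    constructor
    · rintro ⟨_, h⟩; exact h
    · rintro ⟨h1, h2⟩
      refine ⟨⟨Nat.pos_of_ne_zero fun h => by simp [h] at h1, ?_⟩, h1, h2⟩
      exact (Nat.le_mul_of_pos_right m hd.1).trans h2
  rw [← Finset.sum_filter, this, Finset.mul_sum]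
  exact Finset.sum_congr rfl fun m _ => by ring

/-- The type I estimate: `F` is supported on `d ≤ U`, and the inner sum over the cofactor is bounded
for each `d`. -/
theorem norm_arithSum_mul_le (F G : ArithmeticFunction ℝ) {A B U : ℕ} {w : ℕ → ℂ} {c b : ℕ → ℝ}
    (hc : ∀ d, 0 < d → d ≤ B → |F d| ≤ c d) (hF : ∀ d, U < d → F d = 0)
    (hc0 : ∀ d, 0 < d → d ≤ U → 0 ≤ c d) (hb0 : ∀ d, 0 < d → d ≤ U → 0 ≤ b d)
    (hb : ∀ d, 0 < d → d ≤ U →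
      ‖∑ m ∈ Finset.Ioc (A / d) (B / d), (G m : ℂ) * w (d * m)‖ ≤ b d) :
    ‖arithSum (F * G) A B w‖ ≤ ∑ d ∈ Finset.Ioc 0 U, c d * b d := by
  rw [arithSum_mul, bilinearSum_Ioc_zero]
  refine (norm_sum_le _ _).trans ?_
  have h1 : ∑ d ∈ Finset.Ioc 0 B,
      ‖(F d : ℂ) * ∑ m ∈ Finset.Ioc (A / d) (B / d), (G m : ℂ) * w (d * m)‖ =
      ∑ d ∈ (Finset.Ioc 0 B).filter (fun d => d ≤ U),
      ‖(F d : ℂ) * ∑ m ∈ Finset.Ioc (A / d) (B / d), (G m : ℂ) * w (d * m)‖ := by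
    refine (Finset.sum_filter_of_ne fun d _ hne => ?_).symm
    by_contra hcon
    exact hne (by rw [hF d (by omega), Complex.ofReal_zero, zero_mul, norm_zero])
  rw [h1]
  refine (Finset.sum_le_sum (g := fun d => c d * b d) fun d hd => ?_).trans
    (Finset.sum_le_sum_of_subset_of_nonneg (fun d hd => ?_) fun d hd _ => ?_)
  · rw [Finset.mem_filter, Finset.mem_Ioc] at hd
    rw [norm_mul, Complex.norm_real, Real.norm_eq_abs]
    exact mul_le_mul (hc d hd.1.1 hd.1.2) (hb d hd.1.1 hd.2) (norm_nonneg _)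
      (hc0 d hd.1.1 hd.2)
  · rw [Finset.mem_filter, Finset.mem_Ioc] at hd
    exact Finset.mem_Ioc.2 ⟨hd.1.1, hd.2⟩
  · rw [Finset.mem_Ioc] at hd
    exact mul_nonneg (hc0 d hd.1 hd.2) (hb0 d hd.1 hd.2)

/-- The type II estimate: both factors are supported beyond `U`. Dividing them by `K₁`, `K₂` and
cutting at `B` gives coefficients of modulus at most 1, and dyadic pieces cost `J ^ 2`. -/
theorem norm_arithSum_mul_le_of_bilinear (F G : ArithmeticFunction ℝ) {A B U J : ℕ} {w : ℕ → ℂ}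
    {E K₁ K₂ : ℝ} (hK₁ : 0 < K₁) (hK₂ : 0 < K₂) (hF : ∀ d, d ≤ U → F d = 0)
    (hG : ∀ d, d ≤ U → G d = 0) (hFK : ∀ d, 0 < d → d ≤ B → |F d| ≤ K₁)
    (hGK : ∀ d, 0 < d → d ≤ B → |G d| ≤ K₂) (hJ : B ≤ U * 2 ^ J)
    (h : ∀ M N, U ≤ M → U ≤ N → ∀ α β : ℕ → ℂ, (∀ n, ‖α n‖ ≤ 1) → (∀ n, ‖β n‖ ≤ 1) →
      ‖bilinearSum (Finset.Ioc M (2 * M)) (Finset.Ioc N (2 * N)) A B α β w‖ ≤ E) :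
    ‖arithSum (F * G) A B w‖ ≤ K₁ * K₂ * (J ^ 2 * E) := by
  have key : ∀ (H : ArithmeticFunction ℝ) (K : ℝ), 0 < K → (∀ d, 0 < d → d ≤ B → |H d| ≤ K) →
      ∀ n, ‖if 0 < n ∧ n ≤ B then (H n : ℂ) / K else 0‖ ≤ 1 := by
    intro H K hK hb n
    split_ifs with hn
    · rw [norm_div, Complex.norm_real, Complex.norm_real, Real.norm_eq_abs, Real.norm_eq_abs,
        abs_of_pos hK]
      exact div_le_one_of_le₀ (hb n hn.1 hn.2) hK.le
    · simp
  set α : ℕ → ℂ := fun n => if 0 < n ∧ n ≤ B then (F n : ℂ) / K₁ else 0 with hα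
  set β : ℕ → ℂ := fun n => if 0 < n ∧ n ≤ B then (G n : ℂ) / K₂ else 0 with hβ
  have hsum : ∀ f : ℕ → ℂ, (∀ n, n ≤ U ∨ B < n → f n = 0) →
      ∑ n ∈ Finset.Ioc 0 B, f n = ∑ n ∈ Finset.Ioc U (U * 2 ^ J), f n := by
    intro f hf
    have e1 : ∑ n ∈ Finset.Ioc U B, f n = ∑ n ∈ Finset.Ioc 0 B, f n :=
      Finset.sum_subset (Finset.Ioc_subset_Ioc_left (Nat.zero_le _)) fun n h1 h2 =>
        hf n (by simp only [Finset.mem_Ioc] at h1 h2; omega)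
    have e2 : ∑ n ∈ Finset.Ioc U B, f n = ∑ n ∈ Finset.Ioc U (U * 2 ^ J), f n :=
      Finset.sum_subset (Finset.Ioc_subset_Ioc_right hJ) fun n h1 h2 =>
        hf n (by simp only [Finset.mem_Ioc] at h1 h2; omega)
    rw [← e1, e2]
  have hα0 : ∀ n, n ≤ U ∨ B < n → α n = 0 := by
    rintro n (hn | hn)
    · simp only [hα, hF n hn]; simp
    · simp only [hα]; rw [if_neg (by omega)]
  have hβ0 : ∀ n, n ≤ U ∨ B < n → β n = 0 := by
    rintro n (hn | hn)
    · simp only [hβ, hG n hn]; simp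
    · simp only [hβ]; rw [if_neg (by omega)]
  have heq : arithSum (F * G) A B w = (K₁ * K₂ : ℂ) *
      bilinearSum (Finset.Ioc U (U * 2 ^ J)) (Finset.Ioc U (U * 2 ^ J)) A B α β w := by
    have e1 : arithSum (F * G) A B w =
        (K₁ * K₂ : ℂ) * bilinearSum (Finset.Ioc 0 B) (Finset.Ioc 0 B) A B α β w := by
      rw [arithSum_mul, bilinearSum, bilinearSum, Finset.mul_sum]
      refine Finset.sum_congr rfl fun m hm => ?_
      rw [Finset.mul_sum]
      refine Finset.sum_congr rfl fun n hn => ?_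
      rw [Finset.mem_Ioc] at hm hn
      simp only [hα, hβ]
      rw [if_pos hm, if_pos hn]
      have : (K₁ : ℂ) ≠ 0 := by exact_mod_cast hK₁.ne'
      have : (K₂ : ℂ) ≠ 0 := by exact_mod_cast hK₂.ne'
      split_ifs
      · field_simp
      · simp
    rw [e1]
    congr 1
    simp only [bilinearSum]
    rw [hsum]
    · refine Finset.sum_congr rfl fun m _ => hsum _ fun n hn => ?_
      rw [hβ0 n hn]; simp
    · intro m hm
      refine Finset.sum_eq_zero fun n _ => ?_
      rw [hα0 m hm]; simp
  rw [heq, norm_mul, norm_mul, Complex.norm_real, Complex.norm_real, Real.norm_eq_abs,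
    Real.norm_eq_abs, abs_of_pos hK₁, abs_of_pos hK₂]
  refine mul_le_mul_of_nonneg_left ?_ (by positivity)
  exact norm_bilinearSum_le_of_dyadic fun M N hM hN =>
    h M N hM hN α β (key F K₁ hK₁ hFK) (key G K₂ hK₂ hGK)

/-- The truncation of an arithmetic function to `n ≤ U`. -/
def truncLE (U : ℕ) (F : ArithmeticFunction ℝ) : ArithmeticFunction ℝ :=
  ⟨fun n => if n ≤ U then F n else 0, by simp⟩

theorem truncLE_apply (U : ℕ) (F : ArithmeticFunction ℝ) (n : ℕ) :
    truncLE U F n = if n ≤ U then F n else 0 := rfl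

theorem sub_truncLE_apply (U : ℕ) (F : ArithmeticFunction ℝ) (n : ℕ) :
    (F - truncLE U F) n = if n ≤ U then 0 else F n := by
  have h := congrArg (fun G : ArithmeticFunction ℝ => G n) (sub_add_cancel F (truncLE U F))
  simp only [ArithmeticFunction.add_apply, truncLE_apply] at h
  split_ifs at h ⊢ <;> linarith

/-- Vaughan's identity. -/
theorem vonMangoldt_eq_vaughan (U : ℕ) :
    Λ = truncLE U Λ + truncLE U (μ : ArithmeticFunction ℝ) * ArithmeticFunction.log -
      (truncLE U (μ : ArithmeticFunction ℝ) * truncLE U Λ) * (ζ : ArithmeticFunction ℝ) +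
      ((μ : ArithmeticFunction ℝ) - truncLE U (μ : ArithmeticFunction ℝ)) *
        (ζ : ArithmeticFunction ℝ) * (Λ - truncLE U Λ) := by
  have h1 : (μ : ArithmeticFunction ℝ) * (ζ : ArithmeticFunction ℝ) = 1 :=
    ArithmeticFunction.coe_moebius_mul_coe_zeta
  have h2 := ArithmeticFunction.vonMangoldt_mul_zeta
  rw [← h2]
  -- Once `log` is written as `Λ * ζ`, the two sides differ by `(Λ - truncLE U Λ) * (1 - μ * ζ)`.
  linear_combination (truncLE U Λ - Λ) * h1

theorem abs_moebius_real_le_one (n : ℕ) : |(μ : ArithmeticFunction ℝ) n| ≤ 1 := by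
  rw [ArithmeticFunction.intCoe_apply]
  exact_mod_cast ArithmeticFunction.abs_moebius_le_one

/-- The bilinear (type I and type II) information needed for sums over primes. -/
theorem norm_arithSum_vonMangoldt_le {A B U X J : ℕ} {w : ℕ → ℂ} {E ℓ : ℝ} (hw : ∀ n, ‖w n‖ ≤ 1)
    (hBX : B ≤ X) (hUX : U ^ 2 ≤ X) (hE : 0 ≤ E) (hℓ : 1 ≤ ℓ) (hlog : Real.log X ≤ ℓ)
    (hdiv : ∀ n, n ≤ X → (n.divisors.card : ℝ) ≤ ℓ)
    (hharm : ∑ k ∈ Finset.Ioc 0 X, 1 / (k : ℝ) ≤ ℓ) (hJ : (J : ℝ) ≤ ℓ) (hXJ : X ≤ U * 2 ^ J)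
    (hI : ∀ k, 0 < k → k ≤ U ^ 2 → ∀ B', B' ≤ B →
      ‖∑ n ∈ Finset.Ioc (A / k) (B' / k), w (k * n)‖ ≤ E / k)
    (hII : ∀ M N, U ≤ M → U ≤ N → ∀ α β : ℕ → ℂ, (∀ n, ‖α n‖ ≤ 1) → (∀ n, ‖β n‖ ≤ 1) →
      ‖bilinearSum (Finset.Ioc M (2 * M)) (Finset.Ioc N (2 * N)) A B α β w‖ ≤ E) :
    ‖arithSum Λ A B w‖ ≤ U * ℓ + 4 * (ℓ ^ 4 * E) := by
  have hℓ0 : 0 < ℓ := by linarith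
  have hU2 : U ≤ U ^ 2 := Nat.le_self_pow (by norm_num) U
  have hlogn : ∀ n, n ≤ X → Real.log n ≤ ℓ := by
    intro n hn
    rcases Nat.eq_zero_or_pos n with rfl | h0
    · simpa using hℓ0.le
    · exact (Real.log_le_log (by exact_mod_cast h0) (by exact_mod_cast hn)).trans hlog
  have hΛ : ∀ n, n ≤ X → |Λ n| ≤ ℓ := fun n hn => by
    rw [abs_of_nonneg ArithmeticFunction.vonMangoldt_nonneg]
    exact ArithmeticFunction.vonMangoldt_le_log.trans (hlogn n hn)
  have hharm' : ∀ Y, Y ≤ X → ∀ K : ℝ, 0 ≤ K → ∑ k ∈ Finset.Ioc 0 Y, K / (k : ℝ) ≤ K * ℓ := by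
    intro Y hY K hK
    have : ∑ k ∈ Finset.Ioc 0 Y, K / (k : ℝ) = K * ∑ k ∈ Finset.Ioc 0 Y, 1 / (k : ℝ) := by
      rw [Finset.mul_sum]; exact Finset.sum_congr rfl fun k _ => by ring
    rw [this]
    refine mul_le_mul_of_nonneg_left (le_trans ?_ hharm) hK
    exact Finset.sum_le_sum_of_subset_of_nonneg (Finset.Ioc_subset_Ioc_right hY)
      fun k _ _ => by positivity
  have b1 : ‖arithSum (truncLE U Λ) A B w‖ ≤ U * ℓ := by
    rw [arithSum]
    refine (norm_sum_le _ _).trans ?_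
    rw [← Finset.sum_filter_of_ne (p := fun n => n ≤ U)]
    · have : ∀ n ∈ (Finset.Ioc A B).filter (fun n => n ≤ U),
          ‖((truncLE U Λ n : ℝ) : ℂ) * w n‖ ≤ ℓ := by
        intro n hn
        rw [Finset.mem_filter] at hn
        rw [norm_mul, truncLE_apply, if_pos hn.2, Complex.norm_real, Real.norm_eq_abs]
        exact (mul_le_of_le_one_right (abs_nonneg _) (hw n)).trans
          (hΛ n (hn.2.trans (hU2.trans hUX)))
      refine (Finset.sum_le_sum this).trans ?_
      rw [Finset.sum_const, nsmul_eq_mul]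
      refine mul_le_mul_of_nonneg_right ?_ hℓ0.le
      have hsub : (Finset.Ioc A B).filter (fun n => n ≤ U) ⊆ Finset.Ioc 0 U := by
        intro n hn
        rw [Finset.mem_filter, Finset.mem_Ioc] at hn
        exact Finset.mem_Ioc.2 ⟨by omega, hn.2⟩
      have := Finset.card_le_card hsub
      rw [Nat.card_Ioc] at this
      exact_mod_cast this
    · intro n _ hne
      by_contra hcon
      exact hne (by rw [truncLE_apply, if_neg hcon]; simp)
  -- The weight `log m` is removed by summation by parts, which is why `hI` is required for every
  -- endpoint `B' ≤ B`.
  have b2 : ‖arithSum (truncLE U (μ : ArithmeticFunction ℝ) * ArithmeticFunction.log) A B w‖ ≤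
      2 * ℓ * E * ℓ := by
    refine (norm_arithSum_mul_le (U := U) (c := fun _ => 1) (b := fun d => 2 * (E / d) * ℓ) _ _
      (fun d _ _ => ?_) (fun d hd => ?_) (fun _ _ _ => zero_le_one)
      (fun d _ _ => by positivity) fun d hd hdU => ?_).trans ?_
    · rw [truncLE_apply]
      split_ifs
      · exact abs_moebius_real_le_one d
      · simp
    · rw [truncLE_apply, if_neg (by omega)]
    · have : ∑ m ∈ Finset.Ioc (A / d) (B / d), ((ArithmeticFunction.log m : ℝ) : ℂ) * w (d * m) =
          ∑ m ∈ Finset.Ioc (A / d) (B / d), w (d * m) * ((Real.log m : ℝ) : ℂ) :=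
        Finset.sum_congr rfl fun m _ => by rw [ArithmeticFunction.log_apply, mul_comm]
      rw [this]
      refine norm_sum_mul_le_of_monotone (by positivity) (fun b' h1 h2 => ?_) hℓ0.le
        (fun n h1 h2 => ?_) (fun n h1 h2 => ?_)
      · have h3 : d * b' ≤ B := by
          have := (Nat.le_div_iff_mul_le hd).1 h2
          rwa [mul_comm]
        have := hI d hd (hdU.trans hU2) (d * b') h3
        rwa [Nat.mul_div_cancel_left b' hd] at this
      · exact Real.log_le_log (by exact_mod_cast (Nat.zero_le _).trans_lt h1) (by push_cast; linarith)
      · exact ⟨Real.log_natCast_nonneg n, hlogn n ((h2.trans (Nat.div_le_self _ _)).trans hBX)⟩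
    · have : ∑ d ∈ Finset.Ioc 0 U, 1 * (2 * (E / (d : ℝ)) * ℓ) =
          ∑ d ∈ Finset.Ioc 0 U, (2 * E * ℓ) / (d : ℝ) :=
        Finset.sum_congr rfl fun d _ => by ring
      rw [this]
      refine (hharm' U (hU2.trans hUX) _ (by positivity)).trans (le_of_eq (by ring))
  have b3 : ‖arithSum ((truncLE U (μ : ArithmeticFunction ℝ) * truncLE U Λ) *
      (ζ : ArithmeticFunction ℝ)) A B w‖ ≤ ℓ * E * ℓ := by
    refine (norm_arithSum_mul_le (U := U ^ 2) (c := fun _ => ℓ) (b := fun d => E / d) _ _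
      (fun d hd hdB => ?_) (fun d hd => ?_) (fun _ _ _ => hℓ0.le)
      (fun d _ _ => by positivity) fun d hd hdU => ?_).trans ?_
    · rw [ArithmeticFunction.mul_apply]
      refine (Finset.abs_sum_le_sum_abs _ _).trans ?_
      -- The convolution of the two truncations is dominated termwise by `ζ * Λ = log`, so its
      -- coefficients are at most `ℓ`.
      have h1 : ∀ x ∈ d.divisorsAntidiagonal,
          |truncLE U (μ : ArithmeticFunction ℝ) x.1 * truncLE U Λ x.2| ≤
            (ζ : ArithmeticFunction ℝ) x.1 * Λ x.2 := by
        intro x hx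
        have hx1 : x.1 ≠ 0 := by
          have := (Nat.mem_divisorsAntidiagonal.1 hx)
          intro h0
          rw [h0, zero_mul] at this
          omega
        rw [abs_mul, ArithmeticFunction.natCoe_apply, ArithmeticFunction.zeta_apply_ne hx1,
          Nat.cast_one]
        refine mul_le_mul ?_ ?_ (abs_nonneg _) zero_le_one
        · rw [truncLE_apply]
          split_ifs
          · exact abs_moebius_real_le_one _
          · simp
        · rw [truncLE_apply]
          split_ifs
          · rw [abs_of_nonneg ArithmeticFunction.vonMangoldt_nonneg]
          · simp
      refine (Finset.sum_le_sum h1).trans ?_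
      rw [← ArithmeticFunction.mul_apply, ArithmeticFunction.zeta_mul_vonMangoldt,
        ArithmeticFunction.log_apply]
      exact hlogn d (hdB.trans hBX)
    · rw [ArithmeticFunction.mul_apply]
      refine Finset.sum_eq_zero fun x hx => ?_
      have h1 := (Nat.mem_divisorsAntidiagonal.1 hx).1
      rw [truncLE_apply, truncLE_apply]
      by_cases h2 : x.1 ≤ U
      · have h3 : ¬ x.2 ≤ U := by
          intro h3
          have := Nat.mul_le_mul h2 h3
          rw [h1] at this
          nlinarith
        rw [if_neg h3, mul_zero]
      · rw [if_neg h2, zero_mul]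
    · have : ∑ m ∈ Finset.Ioc (A / d) (B / d), (((ζ : ArithmeticFunction ℝ) m : ℝ) : ℂ) * w (d * m) =
          ∑ m ∈ Finset.Ioc (A / d) (B / d), w (d * m) := by
        refine Finset.sum_congr rfl fun m hm => ?_
        rw [Finset.mem_Ioc] at hm
        rw [ArithmeticFunction.natCoe_apply, ArithmeticFunction.zeta_apply_ne
          ((Nat.zero_le _).trans_lt hm.1).ne']
        simp
      rw [this]
      exact hI d hd hdU B le_rfl
    · have : ∑ d ∈ Finset.Ioc 0 (U ^ 2), ℓ * (E / (d : ℝ)) =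
          ∑ d ∈ Finset.Ioc 0 (U ^ 2), (ℓ * E) / (d : ℝ) :=
        Finset.sum_congr rfl fun d _ => by ring
      rw [this]
      exact hharm' (U ^ 2) hUX _ (by positivity)
  -- The factor `(μ - truncLE U μ) * ζ` vanishes up to `U`, as divisors of `d` do not exceed `d`,
  -- and it is bounded by the number of divisors.
  have b4 : ‖arithSum (((μ : ArithmeticFunction ℝ) - truncLE U (μ : ArithmeticFunction ℝ)) *
        (ζ : ArithmeticFunction ℝ) * (Λ - truncLE U Λ)) A B w‖ ≤ ℓ * ℓ * (J ^ 2 * E) := by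
    refine norm_arithSum_mul_le_of_bilinear (U := U) _ _ hℓ0 hℓ0 (fun d hd => ?_) (fun d hd => ?_)
      (fun d hd hdB => ?_) (fun d hd hdB => ?_) (hBX.trans hXJ) hII
    · rw [ArithmeticFunction.mul_apply]
      refine Finset.sum_eq_zero fun x hx => ?_
      have h1 := Nat.mem_divisorsAntidiagonal.1 hx
      have h2 : x.1 ≤ d := Nat.le_of_dvd (Nat.pos_of_ne_zero h1.2) ⟨x.2, h1.1.symm⟩
      rw [sub_truncLE_apply, if_pos (h2.trans hd), zero_mul]
    · rw [sub_truncLE_apply, if_pos hd]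
    · rw [ArithmeticFunction.mul_apply]
      refine (Finset.abs_sum_le_sum_abs _ _).trans ?_
      have h1 : ∀ x ∈ d.divisorsAntidiagonal,
          |((μ : ArithmeticFunction ℝ) - truncLE U (μ : ArithmeticFunction ℝ)) x.1 *
            (ζ : ArithmeticFunction ℝ) x.2| ≤ 1 := by
        intro x _
        rw [abs_mul]
        refine mul_le_one₀ ?_ (abs_nonneg _) ?_
        · rw [sub_truncLE_apply]
          split_ifs
          · simp
          · exact abs_moebius_real_le_one _
        · rw [ArithmeticFunction.natCoe_apply, ArithmeticFunction.zeta_apply]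
          split_ifs <;> simp
      refine (Finset.sum_le_sum h1).trans ?_
      rw [Finset.sum_const, nsmul_eq_mul, mul_one, ← Nat.map_div_right_divisors, Finset.card_map]
      exact hdiv d (hdB.trans hBX)
    · rw [sub_truncLE_apply]
      split_ifs
      · simpa using hℓ0.le
      · exact hΛ d (hdB.trans hBX)
  rw [vonMangoldt_eq_vaughan U, arithSum_add, arithSum_sub, arithSum_add]
  have n1 := norm_add_le (arithSum (truncLE U Λ) A B w +
    arithSum (truncLE U (μ : ArithmeticFunction ℝ) * ArithmeticFunction.log) A B w -
    arithSum ((truncLE U (μ : ArithmeticFunction ℝ) * truncLE U Λ) *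
      (ζ : ArithmeticFunction ℝ)) A B w) (arithSum (((μ : ArithmeticFunction ℝ) -
        truncLE U (μ : ArithmeticFunction ℝ)) * (ζ : ArithmeticFunction ℝ) *
          (Λ - truncLE U Λ)) A B w)
  have n2 := norm_sub_le (arithSum (truncLE U Λ) A B w +
    arithSum (truncLE U (μ : ArithmeticFunction ℝ) * ArithmeticFunction.log) A B w)
    (arithSum ((truncLE U (μ : ArithmeticFunction ℝ) * truncLE U Λ) *
      (ζ : ArithmeticFunction ℝ)) A B w)
  have n3 := norm_add_le (arithSum (truncLE U Λ) A B w)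
    (arithSum (truncLE U (μ : ArithmeticFunction ℝ) * ArithmeticFunction.log) A B w)
  have q1 : ℓ ^ 2 * E ≤ ℓ ^ 4 * E :=
    mul_le_mul_of_nonneg_right (pow_le_pow_right₀ hℓ (by norm_num)) hE
  have q2 : ℓ * ℓ * (J ^ 2 * E) ≤ ℓ ^ 4 * E := by
    have : (J : ℝ) ^ 2 ≤ ℓ ^ 2 := pow_le_pow_left₀ (Nat.cast_nonneg _) hJ 2
    calc ℓ * ℓ * (J ^ 2 * E) ≤ ℓ * ℓ * (ℓ ^ 2 * E) := by gcongr
      _ = ℓ ^ 4 * E := by ring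
  linarith

end

/-! ### From primes to products of two primes. -/

section
open scoped ArithmeticFunction.Moebius ArithmeticFunction.vonMangoldt ArithmeticFunction.zeta

/-- The indicator function of the primes. -/
def primeInd : ArithmeticFunction ℝ :=
  ⟨fun n => if n.Prime then 1 else 0, by simp [Nat.not_prime_zero]⟩

theorem primeInd_apply (n : ℕ) : primeInd n = if n.Prime then 1 else 0 := rfl

theorem primeInd_nonneg (n : ℕ) : 0 ≤ primeInd n := by
  rw [primeInd_apply]; split_ifs <;> norm_num

theorem primeInd_le_one (n : ℕ) : primeInd n ≤ 1 := by
  rw [primeInd_apply]; split_ifs <;> norm_num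

theorem abs_truncLE_primeInd_le (U n : ℕ) : |truncLE U primeInd n| ≤ 1 := by
  rw [truncLE_apply]
  split_ifs
  · rw [abs_of_nonneg (primeInd_nonneg n)]; exact primeInd_le_one n
  · simp

theorem abs_sub_truncLE_primeInd_le (U n : ℕ) : |(primeInd - truncLE U primeInd) n| ≤ 1 := by
  rw [sub_truncLE_apply]
  split_ifs
  · simp
  · rw [abs_of_nonneg (primeInd_nonneg n)]; exact primeInd_le_one n

/-- The difference consists of proper prime powers, so it is at most `ψ(X) - θ(X)`. -/
theorem norm_sum_vonMangoldt_sub_prime_le {A B X : ℕ} {w : ℕ → ℂ} (hw : ∀ n, ‖w n‖ ≤ 1)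
    (hBX : B ≤ X) (hX : 1 ≤ X) :
    ‖arithSum Λ A B w - ∑ n ∈ Finset.Ioc A B, (primeInd n : ℂ) * Real.log n * w n‖ ≤
      2 * √X * Real.log X := by
  rw [arithSum, ← Finset.sum_sub_distrib]
  have h0 : ∀ n, (Λ n : ℝ) - primeInd n * Real.log n = if n.Prime then 0 else Λ n := by
    intro n
    rw [primeInd_apply]
    split_ifs with h
    · rw [ArithmeticFunction.vonMangoldt_apply_prime h]; ring
    · ring
  have h1 : ∀ n ∈ Finset.Ioc A B, ‖(Λ n : ℂ) * w n - (primeInd n : ℂ) * Real.log n * w n‖ ≤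
      if n.Prime then 0 else Λ n := by
    intro n _
    have e : (Λ n : ℂ) * w n - (primeInd n : ℂ) * Real.log n * w n =
        (((Λ n : ℝ) - primeInd n * Real.log n : ℝ) : ℂ) * w n := by push_cast; ring
    rw [e, h0, norm_mul, Complex.norm_real, Real.norm_of_nonneg]
    · refine mul_le_of_le_one_right ?_ (hw n)
      split_ifs
      · exact le_rfl
      · exact ArithmeticFunction.vonMangoldt_nonneg
    · split_ifs
      · exact le_rfl
      · exact ArithmeticFunction.vonMangoldt_nonneg
  refine (norm_sum_le _ _).trans ((Finset.sum_le_sum h1).trans ?_)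
  refine le_trans ?_ (Chebyshev.psi_sub_theta_le (x := X) (by exact_mod_cast hX))
  rw [Chebyshev.psi_sub_theta_eq_sum_not_prime, Nat.floor_natCast, Finset.sum_filter]
  refine (Finset.sum_le_sum_of_subset_of_nonneg
    (Finset.Ioc_subset_Ioc (Nat.zero_le A) hBX) fun n _ _ => ?_).trans
    (Finset.sum_le_sum fun n _ => ?_)
  · split_ifs
    · exact le_rfl
    · exact ArithmeticFunction.vonMangoldt_nonneg
  · split_ifs <;> exact le_rfl

/-- The weight `log` on primes is undone by the decreasing factor `1 / log n`. Replacing `n` by `max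
n 2` keeps that factor defined, decreasing and below 2, since `log 2 > 1/2`. -/
theorem norm_arithSum_primeInd_le {A B X : ℕ} {w : ℕ → ℂ} {S : ℝ} (hw : ∀ n, ‖w n‖ ≤ 1)
    (hBX : B ≤ X) (hX : 1 ≤ X) (hS0 : 0 ≤ S)
    (hS : ∀ b, A ≤ b → b ≤ B → ‖arithSum Λ A b w‖ ≤ S) :
    ‖arithSum primeInd A B w‖ ≤ 2 * (S + 2 * √X * Real.log X) := by
  have hlog : 0 ≤ Real.log X := Real.log_natCast_nonneg X
  have hlog2 : 1 / 2 < Real.log 2 := by have := Real.log_two_gt_d9; norm_num at this ⊢; linarith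
  have hmax : ∀ n : ℕ, Real.log 2 ≤ Real.log (max n 2 : ℕ) := fun n =>
    Real.log_le_log (by norm_num) (by exact_mod_cast le_max_right n 2)
  have heq : arithSum primeInd A B w = ∑ n ∈ Finset.Ioc A B,
      ((primeInd n : ℂ) * Real.log n * w n) * ((1 / Real.log (max n 2 : ℕ) : ℝ) : ℂ) := by
    refine Finset.sum_congr rfl fun n _ => ?_
    by_cases hp : n.Prime
    · rw [max_eq_left hp.two_le]
      have : (Real.log n : ℂ) ≠ 0 := by
        have := Real.log_pos (x := n) (by exact_mod_cast hp.one_lt)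
        exact_mod_cast this.ne'
      rw [Complex.ofReal_div, Complex.ofReal_one]
      field_simp
    · rw [primeInd_apply, if_neg hp]; simp
  rw [heq, mul_comm (2 : ℝ)]
  refine norm_sum_mul_le_of_antitone (by positivity) (fun b h1 h2 => ?_) (by norm_num)
    (fun n _ _ => ?_) (fun n _ _ => ?_)
  · have h3 := norm_sum_vonMangoldt_sub_prime_le (A := A) hw (h2.trans hBX) hX
    have h4 := norm_sub_norm_le (∑ n ∈ Finset.Ioc A b, (primeInd n : ℂ) * Real.log n * w n)
      (arithSum Λ A b w)
    rw [norm_sub_rev] at h4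
    linarith [hS b h1 h2]
  · refine div_le_div_of_nonneg_left zero_le_one (by linarith [hmax n]) (Real.log_le_log ?_ ?_)
    · exact_mod_cast (by omega : 0 < max n 2)
    · exact_mod_cast (by omega : max n 2 ≤ max (n + 1) 2)
  · have := hmax n
    refine ⟨by have : 0 < Real.log (max n 2 : ℕ) := by linarith
               positivity, ?_⟩
    rw [div_le_iff₀ (by linarith)]; linarith

/-- Sums over products of two primes are controlled by type I and type II sums. -/
theorem norm_arithSum_primeInd_mul_primeInd_le {A B U X J : ℕ} {a : ℕ → ℂ} {E ℓ : ℝ}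
    (ha : ∀ n, ‖a n‖ ≤ 1) (hBX : B ≤ X) (hU : 1 ≤ U) (hUX : U ^ 2 ≤ X) (hℓ : 1 ≤ ℓ)
    (hlog : Real.log X ≤ ℓ) (hdiv : ∀ n, n ≤ X → (n.divisors.card : ℝ) ≤ ℓ)
    (hharm : ∑ k ∈ Finset.Ioc 0 X, 1 / (k : ℝ) ≤ ℓ) (hJ : (J : ℝ) ≤ ℓ) (hXJ : X ≤ U * 2 ^ J)
    (hEX : (U : ℝ) ^ 2 * √X ≤ E)
    (hI : ∀ k, 0 < k → k ≤ U ^ 3 → ∀ B', B' ≤ B →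
      ‖∑ n ∈ Finset.Ioc (A / k) (B' / k), a (k * n)‖ ≤ E / k)
    (hII : ∀ p, 0 < p → p ≤ U → ∀ M N, U ≤ N → N ≤ M → M * N * p ≤ B → ∀ B', B' ≤ B →
      ∀ α β : ℕ → ℂ, (∀ n, ‖α n‖ ≤ 1) → (∀ n, ‖β n‖ ≤ 1) →
      ‖bilinearSum (Finset.Ioc M (2 * M)) (Finset.Ioc N (2 * N)) (A / p) (B' / p) α β
        (fun k => a (p * k))‖ ≤ E / p) :
    ‖arithSum (primeInd * primeInd) A B a‖ ≤ 30 * (ℓ ^ 5 * E) := by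
  have hX1 : 1 ≤ X := (Nat.one_le_pow _ _ hU).trans hUX
  have hX1' : (1 : ℝ) ≤ X := by exact_mod_cast hX1
  have hsX : 1 ≤ √(X : ℝ) := Real.one_le_sqrt.2 hX1'
  have hU1 : (1 : ℝ) ≤ U := by exact_mod_cast hU
  have hE1 : (1 : ℝ) ≤ E := by
    refine le_trans ?_ hEX
    nlinarith [one_le_pow₀ hU1 (n := 2)]
  have hE : 0 ≤ E := by linarith
  have hℓ0 : 0 < ℓ := by linarith
  have hU2 : U ≤ U ^ 2 := Nat.le_self_pow (by norm_num) U
  -- The restrictions `N ≤ M` and `M * N * p ≤ B` in `hII` cost nothing: the form is symmetric in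
  -- its variables, and it is empty when `M * N * p > B`.
  have hII' : ∀ p, 0 < p → p ≤ U → ∀ M N, U ≤ M → U ≤ N → ∀ B', B' ≤ B →
      ∀ α β : ℕ → ℂ, (∀ n, ‖α n‖ ≤ 1) → (∀ n, ‖β n‖ ≤ 1) →
      ‖bilinearSum (Finset.Ioc M (2 * M)) (Finset.Ioc N (2 * N)) (A / p) (B' / p) α β
        (fun k => a (p * k))‖ ≤ E / p := by
    intro p hp hpU M N hM hN B' hB' α β hα hβ
    by_cases hMN : M * N * p ≤ B
    · rcases le_total N M with h | h
      · exact hII p hp hpU M N hN h hMN B' hB' α β hα hβ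
      · rw [bilinearSum_comm]
        exact hII p hp hpU N M hM h (by rwa [mul_comm N M]) B' hB' β α hβ hα
    · have : bilinearSum (Finset.Ioc M (2 * M)) (Finset.Ioc N (2 * N)) (A / p) (B' / p) α β
          (fun k => a (p * k)) = 0 := by
        refine Finset.sum_eq_zero fun m hm => Finset.sum_eq_zero fun n hn => if_neg ?_
        rw [Finset.mem_Ioc] at hm hn
        rintro ⟨_, h⟩
        rw [Nat.le_div_iff_mul_le hp] at h
        have : M * N ≤ m * n := Nat.mul_le_mul hm.1.le hn.1.le
        have := Nat.mul_le_mul_right p this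
        omega
      rw [this, norm_zero]
      positivity
  -- Inclusion–exclusion on which prime factor is at most `U`.
  have hdecomp : primeInd * primeInd =
      (primeInd - truncLE U primeInd) * (primeInd - truncLE U primeInd) +
        truncLE U primeInd * primeInd + truncLE U primeInd * primeInd -
        truncLE U primeInd * truncLE U primeInd := by ring
  have c1 : ‖arithSum ((primeInd - truncLE U primeInd) * (primeInd - truncLE U primeInd)) A B a‖ ≤
      1 * 1 * (J ^ 2 * E) := by
    refine norm_arithSum_mul_le_of_bilinear (U := U) _ _ one_pos one_pos (fun d hd => ?_)
      (fun d hd => ?_) (fun d _ _ => abs_sub_truncLE_primeInd_le U d)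
      (fun d _ _ => abs_sub_truncLE_primeInd_le U d) (hBX.trans hXJ)
      (fun M N hM hN α β hα hβ => ?_)
    · rw [sub_truncLE_apply, if_pos hd]
    · rw [sub_truncLE_apply, if_pos hd]
    · have := hII' 1 one_pos hU M N hM hN B le_rfl α β hα hβ
      simpa using this
  have c2 : ‖arithSum (truncLE U primeInd * truncLE U primeInd) A B a‖ ≤ U * U := by
    refine (norm_arithSum_mul_le (U := U) (c := fun _ => 1) (b := fun _ => U) _ _
      (fun d _ _ => abs_truncLE_primeInd_le U d) (fun d hd => ?_) (fun _ _ _ => zero_le_one)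
      (fun _ _ _ => by positivity) fun d _ _ => ?_).trans (le_of_eq (by simp))
    · rw [truncLE_apply, if_neg (by omega)]
    · rw [← Finset.sum_filter_of_ne (p := fun n => n ≤ U)]
      · refine (norm_sum_le _ _).trans ?_
        refine (Finset.sum_le_sum (g := fun _ => 1) fun n _ => ?_).trans ?_
        · rw [norm_mul, Complex.norm_real, Real.norm_eq_abs]
          exact mul_le_one₀ (abs_truncLE_primeInd_le U n) (norm_nonneg _) (ha _)
        · rw [Finset.sum_const, nsmul_eq_mul, mul_one, Nat.cast_le]
          have hsub : (Finset.Ioc (A / d) (B / d)).filter (fun n => n ≤ U) ⊆ Finset.Ioc 0 U := by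
            intro n hn
            rw [Finset.mem_filter, Finset.mem_Ioc] at hn
            exact Finset.mem_Ioc.2 ⟨(Nat.zero_le _).trans_lt hn.1.1, hn.2⟩
          have := Finset.card_le_card hsub
          rwa [Nat.card_Ioc, Nat.sub_zero] at this
      · intro n _ hne
        by_contra hcon
        exact hne (by rw [truncLE_apply, if_neg hcon]; simp)
  -- For each small prime `p`, Vaughan's identity is applied to `n ↦ a (p * n)` on `(A / p, B / p]`.
  -- Its moduli `k ≤ U ^ 2` become moduli `p * k ≤ U ^ 3` for `a`.
  have c3 : ‖arithSum (truncLE U primeInd * primeInd) A B a‖ ≤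
      ∑ d ∈ Finset.Ioc 0 U, 1 * (2 * ((U * ℓ + 4 * (ℓ ^ 4 * (E / d))) + 2 * √X * ℓ)) := by
    refine norm_arithSum_mul_le (U := U) (c := fun _ => 1)
      (b := fun d => 2 * ((U * ℓ + 4 * (ℓ ^ 4 * (E / d))) + 2 * √X * ℓ)) _ _
      (fun d _ _ => abs_truncLE_primeInd_le U d) (fun d hd => ?_) (fun _ _ _ => zero_le_one)
      (fun _ _ _ => by positivity) fun p hp hpU => ?_
    · rw [truncLE_apply, if_neg (by omega)]
    · have hw : ∀ n, ‖a (p * n)‖ ≤ 1 := fun n => ha _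
      have hdivX : B / p ≤ X := (Nat.div_le_self _ _).trans hBX
      have hmul : ∀ b, b ≤ B / p → p * b ≤ B := fun b hb => by
        rw [mul_comm]; exact (Nat.le_div_iff_mul_le hp).1 hb
      refine (norm_arithSum_primeInd_le (S := U * ℓ + 4 * (ℓ ^ 4 * (E / p))) hw hdivX hX1
        (by positivity) fun b h1 h2 => ?_).trans ?_
      · refine norm_arithSum_vonMangoldt_le hw (h2.trans hdivX) hUX (by positivity) hℓ hlog hdiv
          hharm hJ hXJ (fun k hk hkU B' hB' => ?_) (fun M N hM hN α β hα hβ => ?_)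
        · have := hI (p * k) (Nat.mul_pos hp hk)
            (by calc p * k ≤ U * U ^ 2 := Nat.mul_le_mul hpU hkU
                  _ = U ^ 3 := by ring) (p * B') (hmul B' (hB'.trans h2))
          rw [Nat.mul_div_mul_left _ _ hp, ← Nat.div_div_eq_div_mul] at this
          simp only [mul_assoc] at this
          rw [div_div]
          exact_mod_cast this
        · have := hII' p hp hpU M N hM hN (p * b) (hmul b h2) α β hα hβ
          rwa [Nat.mul_div_cancel_left b hp] at this
      · have : 2 * √(X : ℝ) * Real.log X ≤ 2 * √(X : ℝ) * ℓ := by gcongr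
        linarith
  have c3' : ∑ d ∈ Finset.Ioc 0 U, 1 * (2 * ((U * ℓ + 4 * (ℓ ^ 4 * (E / d))) + 2 * √X * ℓ)) ≤
      2 * ℓ * (U * U) + 4 * ℓ * (U * √X) + 8 * (ℓ ^ 5 * E) := by
    have e : ∀ d ∈ Finset.Ioc 0 U,
        1 * (2 * ((U * ℓ + 4 * (ℓ ^ 4 * (E / d))) + 2 * √(X : ℝ) * ℓ)) =
        (2 * U * ℓ + 4 * √X * ℓ) + (8 * ℓ ^ 4 * E) * (1 / (d : ℝ)) := fun d _ => by ring
    rw [Finset.sum_congr rfl e, Finset.sum_add_distrib, ← Finset.mul_sum, Finset.sum_const,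
      nsmul_eq_mul, Nat.card_Ioc, Nat.sub_zero]
    have : ∑ k ∈ Finset.Ioc 0 U, 1 / (k : ℝ) ≤ ℓ := le_trans
      (Finset.sum_le_sum_of_subset_of_nonneg (Finset.Ioc_subset_Ioc_right (hU2.trans hUX))
        fun k _ _ => by positivity) hharm
    have := mul_le_mul_of_nonneg_left this (by positivity : 0 ≤ 8 * ℓ ^ 4 * E)
    linarith
  rw [hdecomp, arithSum_sub, arithSum_add, arithSum_add]
  set a1 := arithSum ((primeInd - truncLE U primeInd) * (primeInd - truncLE U primeInd)) A B a
  set a2 := arithSum (truncLE U primeInd * primeInd) A B a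
  set a3 := arithSum (truncLE U primeInd * truncLE U primeInd) A B a
  have n1 := norm_sub_le (a1 + a2 + a2) a3
  have n2 := norm_add_le (a1 + a2) a2
  have n3 := norm_add_le a1 a2
  have q1 : (J : ℝ) ^ 2 * E ≤ ℓ ^ 5 * E := by
    have h1 : (J : ℝ) ^ 2 ≤ ℓ ^ 2 := pow_le_pow_left₀ (Nat.cast_nonneg _) hJ 2
    have h2 : ℓ ^ 2 ≤ ℓ ^ 5 := pow_le_pow_right₀ hℓ (by norm_num)
    exact mul_le_mul_of_nonneg_right (h1.trans h2) hE
  have hℓ5 : ℓ ≤ ℓ ^ 5 := le_self_pow₀ hℓ (by norm_num)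
  have q2 : (U : ℝ) * U ≤ E := by
    refine le_trans ?_ hEX
    nlinarith [one_le_pow₀ hU1 (n := 2)]
  have q3 : (U : ℝ) * √X ≤ E := le_trans
    (mul_le_mul_of_nonneg_right (le_self_pow₀ hU1 two_ne_zero) (Real.sqrt_nonneg _)) hEX
  have q4 : ℓ * ((U : ℝ) * U) ≤ ℓ ^ 5 * E := by gcongr
  have q5 : ℓ * ((U : ℝ) * √X) ≤ ℓ ^ 5 * E := by gcongr
  have q6 : (U : ℝ) * U ≤ ℓ * ((U : ℝ) * U) := le_mul_of_one_le_left (by positivity) hℓ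
  linarith
end

/-! ### The linear phase and rational approximation of `β`. -/

theorem norm_sum_addChar_linear_le {α δ : ℝ} (hδ : 0 < δ) (h : ∀ z : ℤ, δ ≤ |α - z|) (a b : ℕ) :
    ‖∑ n ∈ Finset.Ioc a b, addChar (α * n)‖ ≤ 2 / δ := by
  refine norm_sum_addChar_le_of_monotone_diff (k := ⌊α⌋) hδ (fun n _ _ => ?_) fun n _ _ => ?_
  · push_cast; exact le_of_eq (by ring)
  · have h1 := h ⌊α⌋
    have h2 := h (⌊α⌋ + 1)
    rw [abs_of_nonneg (by linarith [Int.floor_le α])] at h1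
    push_cast at h2 ⊢
    rw [abs_of_nonpos (by linarith [Int.lt_floor_add_one α])] at h2
    constructor <;> linarith

/-- As `r` does not divide `k`, the fraction `k b / r` is at least `1 / r` from every integer, and
replacing `b / r` by `β` moves it by at most `|k| / r² ≤ 1 / (2r)`. -/
theorem le_abs_mul_sub_of_approx {β : ℝ} {b : ℤ} {r : ℕ} (hr : 0 < r)
    (hb : IsCoprime b (r : ℤ)) (hβ : |β - b / r| ≤ 1 / (r : ℝ) ^ 2) {k : ℤ} (hk : k ≠ 0)
    (hkr : 2 * |k| ≤ r) (z : ℤ) : 1 / (2 * (r : ℝ)) ≤ |k * β - z| := by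
  have hr' : (0 : ℝ) < r := by exact_mod_cast hr
  have h1 : k * b - z * r ≠ 0 := by
    intro h0
    have h2 : (r : ℤ) ∣ b * k := ⟨z, by linarith⟩
    have h3 : (r : ℤ) ∣ k := hb.symm.dvd_of_dvd_mul_left h2
    have h4 := Int.le_of_dvd (abs_pos.2 hk) ((dvd_abs _ _).2 h3)
    have := abs_pos.2 hk
    omega
  have h2 : (1 : ℝ) ≤ |(k : ℝ) * b - z * r| := by
    have := Int.one_le_abs h1
    exact_mod_cast this
  have h3 : (1 : ℝ) / r ≤ |(k : ℝ) * (b / r) - z| := by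
    have : (k : ℝ) * (b / r) - z = ((k : ℝ) * b - z * r) / r := by field_simp
    rw [this, abs_div, abs_of_pos hr']
    exact div_le_div_of_nonneg_right h2 hr'.le
  have h4 : |(k : ℝ) * β - k * (b / r)| ≤ 1 / (2 * r) := by
    rw [← mul_sub, abs_mul]
    have h5 : |(k : ℝ)| ≤ r / 2 := by
      have : (2 : ℝ) * |(k : ℝ)| ≤ r := by exact_mod_cast hkr
      linarith
    calc |(k : ℝ)| * |β - b / r| ≤ (r / 2) * (1 / (r : ℝ) ^ 2) :=
          mul_le_mul h5 hβ (abs_nonneg _) (by positivity)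
      _ = 1 / (2 * r) := by field_simp
  have h5 : (1 : ℝ) / r = 1 / (2 * r) + 1 / (2 * r) := by field_simp; norm_num
  have h6 := abs_sub_abs_le_abs_sub ((k : ℝ) * (b / r) - z) ((k : ℝ) * (b / r) - k * β)
  have h7 : (k : ℝ) * (b / r) - z - ((k : ℝ) * (b / r) - k * β) = k * β - z := by ring
  rw [h7, abs_sub_comm ((k : ℝ) * (b / r)) (k * β)] at h6
  linarith

/-- Within a block of diameter `r / 2` the values `β x` are `1 / (2r)`-separated modulo 1, so boxes
of that width in `[-τ, τ]` hold at most one each. -/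
theorem card_near_integer_block_le {β τ : ℝ} {b : ℤ} {r : ℕ} (hr : 0 < r)
    (hb : IsCoprime b (r : ℤ)) (hβ : |β - b / r| ≤ 1 / (r : ℝ) ^ 2) (hτ : 0 ≤ τ) {s : Finset ℕ}
    (hs : ∀ x ∈ s, ∀ y ∈ s, 2 * |(x : ℤ) - y| ≤ r) (hsτ : ∀ x ∈ s, |β * x - round (β * x)| ≤ τ) :
    (s.card : ℝ) ≤ 4 * r * τ + 1 := by
  have hr' : (0 : ℝ) < r := by exact_mod_cast hr
  set y : ℕ → ℝ := fun x => β * x - round (β * x) with hy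
  set f : ℕ → ℕ := fun x => ⌊2 * r * (y x + τ)⌋₊ with hf
  have hpos : ∀ x ∈ s, 0 ≤ y x + τ := fun x hx => by
    have := (abs_le.1 (hsτ x hx)).1
    simp only [hy]; linarith
  have hmaps : ∀ x ∈ s, f x ∈ Finset.range (⌊4 * r * τ⌋₊ + 1) := by
    intro x hx
    refine Finset.mem_range.2 (Nat.lt_succ_of_le (Nat.floor_le_floor ?_))
    have : y x ≤ τ := (abs_le.1 (hsτ x hx)).2
    nlinarith
  have hinj : Set.InjOn f s := by
    intro x hx x' hx' hxx
    by_contra hne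
    have h1 := le_abs_mul_sub_of_approx hr hb hβ (k := (x : ℤ) - x')
      (by intro h; apply hne; omega) (hs x hx x' hx') (round (β * x) - round (β * x'))
    have h2 : (((x : ℤ) - x' : ℤ) : ℝ) * β - ((round (β * x) - round (β * x') : ℤ) : ℝ) =
        y x - y x' := by simp only [hy]; push_cast; ring
    rw [h2] at h1
    have h3 : |2 * r * (y x + τ) - 2 * r * (y x' + τ)| < 1 := by
      have a1 := Nat.floor_le (mul_nonneg (by positivity : (0 : ℝ) ≤ 2 * r) (hpos x hx))
      have a2 := Nat.lt_floor_add_one (2 * r * (y x + τ))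
      have a3 := Nat.floor_le (mul_nonneg (by positivity : (0 : ℝ) ≤ 2 * r) (hpos x' hx'))
      have a4 := Nat.lt_floor_add_one (2 * r * (y x' + τ))
      have a5 : ((f x : ℕ) : ℝ) = f x' := by rw [hxx]
      simp only [hf] at a5
      rw [abs_lt]; constructor <;> linarith
    have h4 : 2 * r * (y x + τ) - 2 * r * (y x' + τ) = 2 * r * (y x - y x') := by ring
    rw [h4, abs_mul, abs_of_pos (by positivity)] at h3
    rw [div_le_iff₀ (by positivity)] at h1
    linarith
  have := Finset.card_le_card_of_injOn f hmaps hinj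
  rw [Finset.card_range] at this
  have h5 : (s.card : ℝ) ≤ (⌊4 * r * τ⌋₊ : ℝ) + 1 := by exact_mod_cast this
  linarith [Nat.floor_le (by positivity : 0 ≤ 4 * r * τ)]

theorem card_near_integer_le {β τ : ℝ} {b : ℤ} {r : ℕ} (hr : 2 ≤ r)
    (hb : IsCoprime b (r : ℤ)) (hβ : |β - b / r| ≤ 1 / (r : ℝ) ^ 2) (hτ : 0 ≤ τ) (Y : ℕ) :
    (((Finset.range Y).filter fun x : ℕ => |β * x - round (β * x)| ≤ τ).card : ℝ) ≤
      (3 * Y / r + 1) * (4 * r * τ + 1) := by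
  set s := (Finset.range Y).filter fun x : ℕ => |β * x - round (β * x)| ≤ τ with hs
  -- Blocks of length `⌊r / 2⌋` satisfy the diameter condition; `r ≥ 2` ensures `r ≤ 3 Q`, whence
  -- the factor 3.
  set Q := r / 2 with hQ
  have hQ0 : 0 < Q := Nat.div_pos hr (by norm_num)
  have hmaps : ∀ x ∈ s, x / Q ∈ Finset.range (Y / Q + 1) := by
    intro x hx
    rw [hs, Finset.mem_filter, Finset.mem_range] at hx
    exact Finset.mem_range.2 (Nat.lt_succ_of_le (Nat.div_le_div_right hx.1.le))
  rw [Finset.card_eq_sum_card_fiberwise hmaps]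
  push_cast
  have hb : ∀ i ∈ Finset.range (Y / Q + 1),
      (((s.filter fun x => x / Q = i).card : ℕ) : ℝ) ≤ 4 * r * τ + 1 := by
    intro i _
    refine card_near_integer_block_le (by omega) hb hβ hτ (fun x hx y hy => ?_) fun x hx => ?_
    · rw [Finset.mem_filter] at hx hy
      have h1 := Nat.div_add_mod x Q
      have h2 := Nat.div_add_mod y Q
      have h3 := Nat.mod_lt x hQ0
      have h4 := Nat.mod_lt y hQ0
      rw [hx.2] at h1
      rw [hy.2] at h2
      have h5 : 2 * Q ≤ r := by omega
      have h6 : |(x : ℤ) - y| ≤ Q := by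
        rw [abs_le]; constructor <;> omega
      omega
    · rw [Finset.mem_filter, hs, Finset.mem_filter] at hx
      exact hx.1.2
  refine (Finset.sum_le_sum hb).trans ?_
  rw [Finset.sum_const, Finset.card_range, nsmul_eq_mul]
  refine mul_le_mul_of_nonneg_right ?_ (by positivity)
  push_cast
  have h1 : ((Y / Q : ℕ) : ℝ) ≤ Y / Q := Nat.cast_div_le
  have h2 : (r : ℝ) / 3 ≤ Q := by
    have : r ≤ 3 * Q := by omega
    have : (r : ℝ) ≤ 3 * Q := by exact_mod_cast this
    linarith
  have hr0 : (0 : ℝ) < r := by exact_mod_cast (by omega : 0 < r)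
  have h3 : (Y : ℝ) / Q ≤ 3 * Y / r := by
    rw [div_le_div_iff₀ (by exact_mod_cast hQ0) hr0]
    nlinarith [(Nat.cast_nonneg Y : (0 : ℝ) ≤ Y)]
  linarith

/-- A single block `H = N` suffices here. The correlation at difference `D` is a geometric sum with
frequency `β p D`: trivially `M` when this is within `τ` of an integer, and at most `2 / τ`
otherwise. The first kind is counted among the multiples of `p` below `p N`. -/
theorem norm_bilinearSum_linear_le {β τ : ℝ} {b : ℤ} {r : ℕ} (hr : 2 ≤ r)
    (hb : IsCoprime b (r : ℤ)) (hβ : |β - b / r| ≤ 1 / (r : ℝ) ^ 2) (hτ : 0 < τ)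
    {p M N A B : ℕ} (hp : 0 < p) (hN : 0 < N) {γ γ' : ℕ → ℂ} (hγ : ∀ n, ‖γ n‖ ≤ 1)
    (hγ' : ∀ n, ‖γ' n‖ ≤ 1) :
    ‖bilinearSum (Finset.Ioc M (2 * M)) (Finset.Ioc N (2 * N)) A B γ γ'
      (fun k => addChar (β * (p * k : ℕ)))‖ ≤
      2 * √(M * (N * (M + 2 * (M * ((3 * (p * N) / r + 1) * (4 * r * τ + 1)) + N * (2 / τ))))) := by
  set near : ℕ → Prop := fun D => |β * (p * D : ℕ) - round (β * (p * D : ℕ))| ≤ τ with hnear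
  classical
  set κ : ℕ → ℝ := fun D => if near D then (M : ℝ) else 2 / τ with hκ
  have hκ0 : ∀ D, 0 ≤ κ D := fun D => by
    simp only [hκ]; split_ifs <;> positivity
  have hmain := norm_bilinearSum_le (M := M) (N := N) (A := A) (B := B) (α := γ) (β := γ')
    (w := fun k => addChar (β * (p * k : ℕ))) (κ := κ) hN hγ hγ'
    (fun n => (norm_addChar _).le) hκ0 ?_
  · have hNN : (N : ℝ) / N = 1 := div_self (by exact_mod_cast hN.ne')
    rw [hNN, one_add_one_eq_two] at hmain
    refine hmain.trans (mul_le_mul_of_nonneg_left (Real.sqrt_le_sqrt ?_) (by norm_num))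
    gcongr
    have h1 : ∑ D ∈ Finset.Ico 1 N, κ D ≤
        ∑ D ∈ Finset.Ico 1 N, ((if near D then (M : ℝ) else 0) + 2 / τ) := by
      refine Finset.sum_le_sum fun D _ => ?_
      simp only [hκ]
      have : 0 ≤ 2 / τ := by positivity
      split_ifs <;> linarith
    refine h1.trans ?_
    rw [Finset.sum_add_distrib, ← Finset.sum_filter, Finset.sum_const, Finset.sum_const,
      nsmul_eq_mul, nsmul_eq_mul, Nat.card_Ico]
    refine add_le_add ?_ ?_
    · rw [mul_comm]
      refine mul_le_mul_of_nonneg_left ?_ (Nat.cast_nonneg _)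
      have h2 := card_near_integer_le hr hb hβ hτ.le (p * N)
      rw [Nat.cast_mul] at h2
      refine le_trans ?_ h2
      rw [Nat.cast_le]
      refine Finset.card_le_card_of_injOn (fun D => p * D) (fun D hD => ?_) ?_
      · rw [Finset.mem_coe, Finset.mem_filter, Finset.mem_Ico] at hD
        rw [Finset.mem_coe, Finset.mem_filter, Finset.mem_range]
        exact ⟨Nat.mul_lt_mul_of_pos_left hD.1.2 hp, hD.2⟩
      · intro x _ y _ hxy
        exact Nat.eq_of_mul_eq_mul_left hp hxy
    · refine mul_le_mul_of_nonneg_right ?_ (by positivity)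
      exact_mod_cast Nat.sub_le N 1
  · intro n₁ _ n₂ _ hlt _ a c ha hac hc _
    have hterm : ∀ m ∈ Finset.Ioc a c, addChar (β * (p * (m * n₁) : ℕ)) *
        (starRingEnd ℂ) (addChar (β * (p * (m * n₂) : ℕ))) =
        addChar ((β * (p * (n₁ - n₂) : ℕ)) * m) := by
      intro m _
      rw [← addChar_neg, ← addChar_add]
      congr 1
      push_cast [Nat.cast_sub hlt.le]
      ring
    rw [Finset.sum_congr rfl hterm]
    simp only [hκ]
    split_ifs with h
    · refine (norm_sum_addChar_le_card _ _).trans ?_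
      rw [Nat.card_Ioc, Nat.cast_le]; omega
    · refine norm_sum_addChar_linear_le hτ (fun z => ?_) a c
      simp only [hnear, not_le] at h
      exact h.le.trans (round_le _ z)

theorem norm_bilinearSum_linear_le_of_scale {β : ℝ} {b : ℤ} {r : ℕ} (hr : 2 ≤ r)
    (hb : IsCoprime b (r : ℤ)) (hβ : |β - b / r| ≤ 1 / (r : ℝ) ^ 2) {p M N A B : ℕ} {T K : ℝ}
    (hK : 1 ≤ K) (hKT : K ^ 7 ≤ T) (hKr : K ^ 3 ≤ r) (hrT : r * K ^ 3 ≤ T) (hp : 0 < p)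
    (hpK : (p : ℝ) ≤ K) (hKN : K ≤ 2 * N) (hNM : N ≤ M) (hMN : (M : ℝ) * N * p ≤ T)
    {γ γ' : ℕ → ℂ} (hγ : ∀ n, ‖γ n‖ ≤ 1) (hγ' : ∀ n, ‖γ' n‖ ≤ 1) :
    ‖bilinearSum (Finset.Ioc M (2 * M)) (Finset.Ioc N (2 * N)) A B γ γ'
      (fun k => addChar (β * (p * k : ℕ)))‖ ≤ 2 * √(54 / K) * (T / p) := by
  have hK0 : 0 < K := by linarith
  have hN0 : (0 : ℝ) < N := by linarith
  have hN : 0 < N := by exact_mod_cast hN0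
  have hp0 : (0 : ℝ) < p := by exact_mod_cast hp
  have hr0 : (0 : ℝ) < r := by exact_mod_cast (by omega : 0 < r)
  have hNM' : (N : ℝ) ≤ M := by exact_mod_cast hNM
  have hM0 : (0 : ℝ) < M := by linarith
  obtain ⟨t, ht⟩ : ∃ t, t = T / p := ⟨_, rfl⟩
  have htT : t * p = T := by rw [ht]; field_simp
  have hMNt : (M : ℝ) * N ≤ t := by rw [ht, le_div_iff₀ hp0]; exact hMN
  have ht0 : 0 < t := lt_of_lt_of_le (by positivity) hMNt
  have hTt : T ≤ t * K := by rw [← htT]; gcongr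
  have hMK : M ≤ 2 * (t / K) := by
    rw [mul_div_assoc', le_div_iff₀ hK0]; nlinarith
  have hKt : K ^ 6 ≤ t := by
    have : K ^ 6 * K ≤ t * K := by linarith [show K ^ 6 * K = K ^ 7 by ring]
    exact le_of_mul_le_mul_right this hK0
  have key : ∃ τ : ℝ, 0 < τ ∧ M * ((3 * (p * N) / r + 1) * (4 * r * τ + 1)) + N * (2 / τ) ≤
      26 * (t / K) := by
    -- The choice of `τ` depends on how many blocks of length about `r` the multiples of `p` fill.
    -- For `p N ≤ r` there are boundedly many, and `τ = N / (r K)` works; otherwise about `p N / r`,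
    -- and `τ = 1 / (p K)` works.
    rcases le_total ((p : ℝ) * N) r with h | h
    · refine ⟨N / (r * K), by positivity, ?_⟩
      have e1 : (N : ℝ) * (2 / (N / (r * K))) = 2 * (r * K) := by field_simp
      have e2 : 4 * r * (N / (r * K)) = 4 * (N / K) := by field_simp
      rw [e1, e2]
      have h1 : 3 * ((p : ℝ) * N) / r + 1 ≤ 4 := by
        have : 3 * ((p : ℝ) * N) / r ≤ 3 := by rw [div_le_iff₀ hr0]; linarith
        linarith
      have h2 : r * K ≤ t / K := by
        rw [le_div_iff₀ hK0]
        have : r * K * K * K ≤ t * K := by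
          refine le_trans (le_of_eq (by ring)) (hrT.trans hTt)
        exact le_of_mul_le_mul_right this hK0
      have h3 : M * (4 * (N / K)) ≤ 4 * (t / K) := by
        have : (M : ℝ) * (4 * (N / K)) = 4 * (M * N / K) := by ring
        rw [this]
        gcongr
      have h4 : M * ((3 * ((p : ℝ) * N) / r + 1) * (4 * (N / K) + 1)) ≤
          M * (4 * (4 * (N / K) + 1)) := by gcongr
      linarith
    · refine ⟨1 / (p * K), by positivity, ?_⟩
      have e1 : (N : ℝ) * (2 / (1 / (p * K))) = 2 * (N * p * K) := by field_simp
      have e2 : 4 * r * (1 / (p * K)) = 4 * r / (p * K) := by field_simp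
      rw [e1, e2]
      have h1 : 3 * ((p : ℝ) * N) / r + 1 ≤ 4 * ((p : ℝ) * N) / r := by
        have : 1 ≤ (p : ℝ) * N / r := by rw [le_div_iff₀ hr0]; linarith
        have e : 3 * ((p : ℝ) * N) / r = 3 * (p * N / r) := by ring
        have e' : 4 * ((p : ℝ) * N) / r = 4 * (p * N / r) := by ring
        rw [e, e']; linarith
      -- Here `N ≤ √t`, from `N ≤ M` and `M N ≤ t`, and `K ^ 3 ≤ √t`.
      have h2 : N * p * K ≤ t / K := by
        rw [le_div_iff₀ hK0]
        have h5 : N * p * K * K ≤ N * K ^ 3 := by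
          have : (N : ℝ) * p * K * K = N * K ^ 2 * p := by ring
          rw [this]
          calc N * K ^ 2 * p ≤ N * K ^ 2 * K := by gcongr
            _ = N * K ^ 3 := by ring
        refine h5.trans (abs_le_of_sq_le_sq' ?_ ht0.le).2
        calc (N * K ^ 3) ^ 2 = N * N * K ^ 6 := by ring
          _ ≤ (M * N) * K ^ 6 := by gcongr
          _ ≤ t * t := by gcongr
          _ = t ^ 2 := by ring
      have h3 : M * (4 * ((p : ℝ) * N) / r * (4 * r / (p * K) + 1)) =
          16 * (M * N / K) + 4 * ((M * N) * p / r) := by field_simp; ring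
      have h4 : (M : ℝ) * N * p / r ≤ t / K := by
        rw [div_le_div_iff₀ hr0 hK0]
        calc (M : ℝ) * N * p * K ≤ T * K := by gcongr
          _ ≤ t * K * K := by gcongr
          _ = t * K ^ 2 := by ring
          _ ≤ t * r := by
            gcongr
            exact (pow_le_pow_right₀ hK (by norm_num)).trans hKr
      have h5 : (M : ℝ) * N / K ≤ t / K := by gcongr
      have h6 : M * ((3 * ((p : ℝ) * N) / r + 1) * (4 * r / (p * K) + 1)) ≤
          M * (4 * ((p : ℝ) * N) / r * (4 * r / (p * K) + 1)) := by gcongr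
      have h7 : 0 < t / K := by positivity
      linarith
  obtain ⟨τ, hτ, hS⟩ := key
  refine (norm_bilinearSum_linear_le hr hb hβ hτ hp hN hγ hγ').trans ?_
  have e : √(54 / K) * t = √(54 / K * t ^ 2) := by
    rw [Real.sqrt_mul' _ (sq_nonneg t), Real.sqrt_sq ht0.le]
  rw [← ht, mul_assoc 2 (√(54 / K)) t, e]
  refine mul_le_mul_of_nonneg_left (Real.sqrt_le_sqrt ?_) zero_le_two
  calc _ = (M * N : ℝ) * (M + 2 * (M * ((3 * (p * N) / r + 1) * (4 * r * τ + 1)) + N * (2 / τ))) := by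
        ring
    _ ≤ t * (2 * (t / K) + 2 * (26 * (t / K))) := by gcongr
    _ = 54 / K * t ^ 2 := by ring

/-- Type I moduli are at most `L ^ 810`, far below `r / 2`, so those sums are at most `4 r`, and `r
L ^ 1000 ≤ T` leaves room for the factor `L ^ 132 k`. Type II, with scale `K = L ^ 270`, saves
essentially `L ^ 135`. The exponent 132 is meant to outweigh a later loss of `L ^ 112`. -/
theorem norm_arithSum_primeInd_linear_le {β T L ℓ : ℝ} {b : ℤ} {r A B U X J : ℕ} (hL : 10 ≤ L)
    (hT : L ^ 2000 ≤ T) (hXT : (X : ℝ) ≤ T) (hTX : T ≤ X + 1) (hBX : B ≤ X)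
    (hU : (U : ℝ) ≤ L ^ 270) (hU' : L ^ 270 ≤ 2 * U) (hr : L ^ 1000 ≤ r) (hrT : r * L ^ 1000 ≤ T)
    (hb : IsCoprime b (r : ℤ)) (hβ : |β - b / r| ≤ 1 / (r : ℝ) ^ 2) (hℓ : 1 ≤ ℓ)
    (hlog : Real.log X ≤ ℓ) (hdiv : ∀ n, n ≤ X → (n.divisors.card : ℝ) ≤ ℓ)
    (hharm : ∑ k ∈ Finset.Ioc 0 X, 1 / (k : ℝ) ≤ ℓ) (hJ : (J : ℝ) ≤ ℓ) (hXJ : X ≤ U * 2 ^ J) :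
    ‖arithSum (primeInd * primeInd) A B (fun n => addChar (β * n))‖ ≤
      30 * (ℓ ^ 5 * (T / L ^ 132)) := by
  have hL1 : 1 ≤ L := by linarith
  have hL0 : 0 < L := by linarith
  have hmono : ∀ {i j : ℕ}, i ≤ j → L ^ i ≤ L ^ j := fun h => pow_le_pow_right₀ hL1 h
  have hT0 : 0 < T := lt_of_lt_of_le (by positivity) hT
  have hL10 : 10 ≤ L ^ 1 := by simpa using hL
  have hr2 : 2 ≤ r := by
    have : (2 : ℝ) ≤ r := by linarith [hmono (show 1 ≤ 1000 by norm_num)]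
    exact_mod_cast this
  have hr0 : (0 : ℝ) < r := by exact_mod_cast (by omega : 0 < r)
  have hsT : L ^ 1000 ≤ √T := by
    refine Real.le_sqrt_of_sq_le ?_
    rw [← pow_mul]; exact hT
  have hsTT : √T * √T = T := Real.mul_self_sqrt hT0.le
  refine norm_arithSum_primeInd_mul_primeInd_le (U := U) (X := X) (J := J)
    (fun n => (norm_addChar _).le) hBX ?_ ?_ hℓ hlog hdiv hharm hJ hXJ ?_ ?_ ?_
  · have : (0 : ℝ) < U := by have : 0 < L ^ 270 := by positivity
                             linarith
    exact_mod_cast this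
  · have : (U : ℝ) ^ 2 ≤ X := by
      have h1 : (U : ℝ) ^ 2 ≤ L ^ 540 := by
        calc (U : ℝ) ^ 2 ≤ (L ^ 270) ^ 2 := by gcongr
          _ = L ^ 540 := by rw [← pow_mul]
      have h2 : L ^ 540 * 10 ≤ L ^ 541 := by
        calc L ^ 540 * 10 ≤ L ^ 540 * L := by gcongr
          _ = L ^ 541 := by ring
      have h3 : L ^ 541 ≤ L ^ 2000 := hmono (by norm_num)
      have h4 : 1 ≤ L ^ 540 := one_le_pow₀ hL1
      linarith
    exact_mod_cast this
  · rw [le_div_iff₀ (by positivity)]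
    calc (U : ℝ) ^ 2 * √X * L ^ 132 ≤ (L ^ 270) ^ 2 * √T * L ^ 132 := by gcongr
      _ = L ^ 672 * √T := by rw [← pow_mul]; ring
      _ ≤ √T * √T := by gcongr; exact (hmono (by norm_num)).trans hsT
      _ = T := hsTT
  · intro k hk hkU B' _
    have hkL : (k : ℝ) ≤ L ^ 810 := by
      have : (k : ℝ) ≤ (U : ℝ) ^ 3 := by exact_mod_cast hkU
      calc (k : ℝ) ≤ (U : ℝ) ^ 3 := this
        _ ≤ (L ^ 270) ^ 3 := by gcongr
        _ = L ^ 810 := by rw [← pow_mul]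
    have hk0 : (0 : ℝ) < k := by exact_mod_cast hk
    have hkr : 2 * k ≤ r := by
      have h1 : L ^ 810 * 10 ≤ L ^ 811 := by
        calc L ^ 810 * 10 ≤ L ^ 810 * L := by gcongr
          _ = L ^ 811 := by ring
      have h2 : L ^ 811 ≤ L ^ 1000 := hmono (by norm_num)
      have : 2 * (k : ℝ) ≤ r := by linarith
      exact_mod_cast this
    have hterm : ∀ n ∈ Finset.Ioc (A / k) (B' / k),
        addChar (β * (k * n : ℕ)) = addChar ((((k : ℤ) : ℝ) * β) * n) := by
      intro n _
      congr 1; push_cast; ring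
    rw [Finset.sum_congr rfl hterm]
    refine (norm_sum_addChar_linear_le (δ := 1 / (2 * r)) (by positivity) (fun z =>
      le_abs_mul_sub_of_approx (by omega) hb hβ (by omega) (by rw [abs_of_nonneg (by omega)]; omega)
        z) _ _).trans ?_
    rw [div_div_eq_mul_div, div_one, div_div, le_div_iff₀ (by positivity)]
    calc 2 * (2 * (r : ℝ)) * (L ^ 132 * k) ≤ 2 * (2 * (r : ℝ)) * (L ^ 132 * L ^ 810) := by gcongr
      _ = 4 * (r * L ^ 942) := by ring
      _ ≤ 10 * (r * L ^ 942) := by gcongr; norm_num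
      _ ≤ L ^ 1 * (r * L ^ 942) := by gcongr
      _ = r * L ^ 943 := by ring
      _ ≤ r * L ^ 1000 := mul_le_mul_of_nonneg_left (hmono (by norm_num)) hr0.le
      _ ≤ T := hrT
  · intro p hp hpU M N hUN hNM hMN B' hB' γ γ' hγ hγ'
    have hUN' : (U : ℝ) ≤ N := by exact_mod_cast hUN
    have hpU' : (p : ℝ) ≤ U := by exact_mod_cast hpU
    have hMN' : (M : ℝ) * N * p ≤ T := by
      have : ((M * N * p : ℕ) : ℝ) ≤ X := by exact_mod_cast hMN.trans hBX
      push_cast at this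
      linarith
    refine (norm_bilinearSum_linear_le_of_scale (K := L ^ 270) hr2 hb hβ (one_le_pow₀ hL1) ?_ ?_ ?_
      hp (by linarith) (by linarith) hNM hMN' hγ hγ').trans ?_
    · rw [← pow_mul]; exact (hmono (by norm_num)).trans hT
    · rw [← pow_mul]; exact (hmono (by norm_num)).trans hr
    · rw [← pow_mul]
      exact (mul_le_mul_of_nonneg_left (hmono (by norm_num)) hr0.le).trans hrT
    · have h1 : 2 * √(54 / L ^ 270) ≤ 1 / L ^ 132 := by
        have : √(54 / L ^ 270) ≤ 1 / L ^ 132 / 2 := by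
          rw [Real.sqrt_le_left (by positivity), div_le_iff₀ (by positivity)]
          have e : (1 / L ^ 132 / 2) ^ 2 * L ^ 270 = L ^ 6 / 4 := by field_simp; norm_num
          rw [e]
          have : (10 : ℝ) ^ 6 ≤ L ^ 6 := by gcongr
          norm_num at this
          linarith
        linarith
      calc 2 * √(54 / L ^ 270) * (T / p) ≤ 1 / L ^ 132 * (T / p) := by gcongr
        _ = T / L ^ 132 / p := by ring

/-! ### Smooth phases: type I and type II by the second derivative test. -/

/-- A phase `f` on `[A, B]` with derivatives `f₁, f₂, f₃`. -/
structure SmoothPhase (f f₁ f₂ f₃ : ℝ → ℝ) (A B : ℝ) : Prop where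
  deriv_one : ∀ y ∈ Set.Icc A B, HasDerivAt f (f₁ y) y
  deriv_two : ∀ y ∈ Set.Icc A B, HasDerivAt f₁ (f₂ y) y
  deriv_three : ∀ y ∈ Set.Icc A B, HasDerivAt f₂ (f₃ y) y

theorem SmoothPhase.neg {f f₁ f₂ f₃ : ℝ → ℝ} {A B : ℝ} (hf : SmoothPhase f f₁ f₂ f₃ A B) :
    SmoothPhase (-f) (-f₁) (-f₂) (-f₃) A B :=
  ⟨fun y hy => (hf.deriv_one y hy).neg, fun y hy => (hf.deriv_two y hy).neg,
    fun y hy => (hf.deriv_three y hy).neg⟩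

/-- The function `g` lies between the positive bounds `l, l'` on `[A, B]`, up to a fixed sign. -/
def SignedBounds (g : ℝ → ℝ) (A B l l' : ℝ) : Prop :=
  (∀ y ∈ Set.Icc A B, l ≤ g y ∧ g y ≤ l') ∨ ∀ y ∈ Set.Icc A B, l ≤ -g y ∧ -g y ≤ l'

theorem norm_sum_addChar_neg (u : ℕ → ℝ) (s : Finset ℕ) :
    ‖∑ n ∈ s, addChar (-u n)‖ = ‖∑ n ∈ s, addChar (u n)‖ := by
  simp only [addChar_neg]
  rw [← map_sum, RCLike.norm_conj]

theorem norm_bilinearSum_conj (S R : Finset ℕ) (A B : ℕ) (α β w : ℕ → ℂ) :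
    ‖bilinearSum S R A B α β (fun n => (starRingEnd ℂ) (w n))‖ =
      ‖bilinearSum S R A B (fun n => (starRingEnd ℂ) (α n)) (fun n => (starRingEnd ℂ) (β n)) w‖ := by
  rw [← RCLike.norm_conj]
  simp only [bilinearSum, map_sum, apply_ite (starRingEnd ℂ), map_mul, map_zero,
    RingHomCompTriple.comp_apply, RingHom.id_apply]

theorem HasDerivAt.comp_const_mul {f : ℝ → ℝ} {f' c x : ℝ} (h : HasDerivAt f f' (c * x)) :
    HasDerivAt (fun z => f (c * z)) (c * f') x := by
  have h1 : HasDerivAt (fun z => c * z) c x := by simpa using (hasDerivAt_id x).const_mul c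
  have := h.comp x h1
  rw [mul_comm] at this
  exact this

/-- The map `y ↦ f(k y)` has second derivative `k² f''(k y)`, of size about `(k s)²`, on a range of
length at most `T / k`; so `k` cancels from the main term. -/
theorem SmoothPhase.norm_sum_dilate_le {f f₁ f₂ f₃ : ℝ → ℝ} {A B : ℕ} {h s T : ℝ}
    (hf : SmoothPhase f f₁ f₂ f₃ (A + 1) B)
    (hb : ∀ y ∈ Set.Icc ((A : ℝ) + 1) B, s ^ 2 ≤ f₂ y ∧ f₂ y ≤ h * s ^ 2) (hs : 0 < s) (hh : 1 ≤ h)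
    (hBT : (B : ℝ) ≤ T) {k B' : ℕ} (hk : 0 < k) (hB' : B' ≤ B) :
    ‖∑ n ∈ Finset.Ioc (A / k) (B' / k), addChar (f ((k * n : ℕ) : ℝ))‖ ≤
      6 * (h * s * T) + 12 / (k * s) + 1 := by
  have hk0 : (0 : ℝ) < k := by exact_mod_cast hk
  have hT0 : 0 ≤ T := (Nat.cast_nonneg B).trans hBT
  rcases lt_or_ge (B' / k) (A / k) with hlt | hle
  · rw [Finset.Ioc_eq_empty (by omega), Finset.sum_empty, norm_zero]; positivity
  have hmain := norm_sum_addChar_le_of_second_diff (u := fun n => f ((k * n : ℕ) : ℝ))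
    (a := A / k) (b := B' / k) (l := (k * s) ^ 2) (l' := h * (k * s) ^ 2) (by positivity)
    (le_mul_of_one_le_left (by positivity) hh) hle ?_
  · refine hmain.trans ?_
    rw [Real.sqrt_sq (by positivity)]
    have h1 : ((B' / k : ℕ) : ℝ) - ((A / k : ℕ) : ℝ) ≤ T / k := by
      have h2 : ((B' / k : ℕ) : ℝ) ≤ B' / k := Nat.cast_div_le
      have h3 : (B' : ℝ) / k ≤ T / k := by
        gcongr
        exact le_trans (by exact_mod_cast hB') hBT
      linarith [(Nat.cast_nonneg (A / k) : (0 : ℝ) ≤ _)]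
    have h2 : 6 * (h * (k * s) ^ 2 * (((B' / k : ℕ) : ℝ) - ((A / k : ℕ) : ℝ)) + 2) / (k * s) ≤
        6 * (h * (k * s) ^ 2 * (T / k) + 2) / (k * s) := by gcongr
    have h3 : 6 * (h * (k * s) ^ 2 * (T / k) + 2) / (k * s) = 6 * (h * s * T) + 12 / (k * s) := by
      field_simp; ring
    linarith
  · intro n hn hn2
    have hlo : ((A : ℝ) + 1) ≤ k * n := by
      have : A + 1 ≤ n * k := (Nat.div_lt_iff_lt_mul hk).1 hn
      rw [mul_comm]; exact_mod_cast this
    have hhi : (k : ℝ) * (n + 2) ≤ B := by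
      have : (n + 2) * k ≤ B' := (Nat.le_div_iff_mul_le hk).1 hn2
      have : (n + 2) * k ≤ B := this.trans hB'
      rw [mul_comm]; exact_mod_cast this
    have hmem : ∀ y ∈ Set.Icc (n : ℝ) (n + 2), (k : ℝ) * y ∈ Set.Icc ((A : ℝ) + 1) B := fun y hy =>
      ⟨hlo.trans (mul_le_mul_of_nonneg_left hy.1 hk0.le),
        (mul_le_mul_of_nonneg_left hy.2 hk0.le).trans hhi⟩
    have := second_diff_mem_of_deriv (g := fun y => f (k * y)) (g' := fun y => k * f₁ (k * y))
      (g'' := fun y => k * (k * f₂ (k * y))) (x := n) (l := (k * s) ^ 2) (l' := h * (k * s) ^ 2)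
      (fun y hy => (hf.deriv_one _ (hmem y hy)).comp_const_mul)
      (fun y hy => ((hf.deriv_two _ (hmem y hy)).comp_const_mul).const_mul (k : ℝ))
      (fun y hy => by
        have := hb _ (hmem y hy)
        have e : (k : ℝ) * (k * f₂ (k * y)) = k ^ 2 * f₂ (k * y) := by ring
        rw [e, mul_pow]
        constructor
        · exact mul_le_mul_of_nonneg_left this.1 (by positivity)
        · refine (mul_le_mul_of_nonneg_left this.2 (by positivity)).trans (le_of_eq (by ring)))
    simpa using this

/-- Multiplied by `y²`, the second derivative of `f(p n₁ y) - f(p n₂ y)` is the difference of `z²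
f''(z)` at `z = p n₁ y` and `z = p n₂ y`. By the mean value theorem it equals `p D y ξ (2f''(ξ) + ξ
f'''(ξ))` with `D = n₁ - n₂`. As `ξ / y` lies between `p N` and `2 p N`, the curvature is between
`q²` and `2 h q²` for `q = p s √(N D)`. -/
theorem SmoothPhase.norm_sum_correlation_le {f f₁ f₂ f₃ : ℝ → ℝ} {A B : ℕ} {h s : ℝ}
    (hf : SmoothPhase f f₁ f₂ f₃ (A + 1) B) (hb : ∀ y ∈ Set.Icc ((A : ℝ) + 1) B,
      s ^ 2 ≤ 2 * f₂ y + y * f₃ y ∧ 2 * f₂ y + y * f₃ y ≤ h * s ^ 2) (hs : 0 < s) (hh : 1 ≤ h)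
    {p N M n₁ n₂ a b : ℕ} (hp : 0 < p) (hN : 0 < N) (h2 : N < n₂) (h12 : n₂ < n₁)
    (h1 : n₁ ≤ 2 * N) (hab : a ≤ b) (hbM : b ≤ a + M)
    (hm : ∀ m, a < m → m ≤ b → A < p * (m * n₂) ∧ p * (m * n₁) ≤ B) :
    ‖∑ m ∈ Finset.Ioc a b, addChar (f ((p * (m * n₁) : ℕ) : ℝ)) *
      (starRingEnd ℂ) (addChar (f ((p * (m * n₂) : ℕ) : ℝ)))‖ ≤
      12 * (M * h * (p * s * √(N * (n₁ - n₂ : ℕ)))) +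
        12 / (p * s * √(N * (n₁ - n₂ : ℕ))) + 1 := by
  obtain ⟨D, hD⟩ : ∃ D, D = n₁ - n₂ := ⟨_, rfl⟩
  have hD0 : 0 < D := by omega
  have hn : n₁ = n₂ + D := by omega
  rw [← hD]
  have hp0 : (0 : ℝ) < p := by exact_mod_cast hp
  have hD0' : (0 : ℝ) < D := by exact_mod_cast hD0
  have hN0 : (0 : ℝ) < N := by exact_mod_cast hN
  have hn2 : (N : ℝ) < n₂ := by exact_mod_cast h2
  have hn1 : (n₁ : ℝ) ≤ 2 * N := by exact_mod_cast h1
  have hnR : (n₁ : ℝ) = n₂ + D := by exact_mod_cast hn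
  set q : ℝ := p * s * √(N * D) with hq
  have hsq : √((N : ℝ) * D) ^ 2 = N * D := Real.sq_sqrt (by positivity)
  have hq0 : 0 < q := by positivity
  have hterm : ∀ m ∈ Finset.Ioc a b, addChar (f ((p * (m * n₁) : ℕ) : ℝ)) *
      (starRingEnd ℂ) (addChar (f ((p * (m * n₂) : ℕ) : ℝ))) =
      addChar (f ((p * (m * n₁) : ℕ) : ℝ) - f ((p * (m * n₂) : ℕ) : ℝ)) := by
    intro m _
    rw [← addChar_neg, ← addChar_add, sub_eq_add_neg]
  rw [Finset.sum_congr rfl hterm]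
  have hmain := norm_sum_addChar_le_of_second_diff
    (u := fun m => f ((p * (m * n₁) : ℕ) : ℝ) - f ((p * (m * n₂) : ℕ) : ℝ))
    (a := a) (b := b) (l := q ^ 2) (l' := 2 * h * q ^ 2) (by positivity)
    (le_mul_of_one_le_left (by positivity) (by linarith)) hab ?_
  · refine hmain.trans ?_
    rw [Real.sqrt_sq hq0.le]
    have h3 : (b : ℝ) - a ≤ M := by
      have : (b : ℝ) ≤ a + M := by exact_mod_cast hbM
      linarith
    have h4 : 6 * (2 * h * q ^ 2 * ((b : ℝ) - a) + 2) / q ≤ 6 * (2 * h * q ^ 2 * M + 2) / q := by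
      gcongr
    have h5 : 6 * (2 * h * q ^ 2 * M + 2) / q = 12 * (M * h * q) + 12 / q := by
      field_simp; ring
    linarith
  · intro m hma hmb
    have hlo : ((A : ℝ) + 1) ≤ p * n₂ * m := by
      have : A + 1 ≤ p * (m * n₂) := (hm m hma (by omega)).1
      have : ((A : ℝ) + 1) ≤ p * (m * n₂) := by exact_mod_cast this
      linarith [mul_comm (m : ℝ) n₂, mul_assoc (p : ℝ) n₂ m]
    have hhi : (p : ℝ) * n₁ * (m + 2) ≤ B := by
      have : p * ((m + 2) * n₁) ≤ B := (hm (m + 2) (by omega) hmb).2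
      have : (p : ℝ) * ((m + 2) * n₁) ≤ B := by exact_mod_cast this
      linarith [mul_comm ((m : ℝ) + 2) n₁, mul_assoc (p : ℝ) n₁ (m + 2)]
    have hm0 : (0 : ℝ) < m := by exact_mod_cast (by omega : 0 < m)
    have hmem : ∀ y ∈ Set.Icc (m : ℝ) (m + 2), ∀ z ∈ Set.Icc ((p : ℝ) * n₂ * y) (p * n₁ * y),
        z ∈ Set.Icc ((A : ℝ) + 1) B := by
      intro y hy z hz
      constructor
      · refine hlo.trans (le_trans ?_ hz.1)
        exact mul_le_mul_of_nonneg_left hy.1 (by positivity)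
      · refine hz.2.trans (le_trans ?_ hhi)
        exact mul_le_mul_of_nonneg_left hy.2 (by positivity)
    have hlt : ∀ y ∈ Set.Icc (m : ℝ) (m + 2), (p : ℝ) * n₂ * y < p * n₁ * y := by
      intro y hy
      have : 0 < y := lt_of_lt_of_le hm0 hy.1
      rw [hnR]
      have : 0 < (p : ℝ) * D * y := by positivity
      linarith [show (p : ℝ) * (n₂ + D) * y = p * n₂ * y + p * D * y by ring]
    have hl : ∀ y ∈ Set.Icc (m : ℝ) (m + 2), (p : ℝ) * n₂ * y ∈ Set.Icc ((A : ℝ) + 1) B :=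
      fun y hy => hmem y hy _ ⟨le_rfl, (hlt y hy).le⟩
    have hr : ∀ y ∈ Set.Icc (m : ℝ) (m + 2), (p : ℝ) * n₁ * y ∈ Set.Icc ((A : ℝ) + 1) B :=
      fun y hy => hmem y hy _ ⟨(hlt y hy).le, le_rfl⟩
    have := second_diff_mem_of_deriv (g := fun y => f (p * n₁ * y) - f (p * n₂ * y))
      (g' := fun y => p * n₁ * f₁ (p * n₁ * y) - p * n₂ * f₁ (p * n₂ * y))
      (g'' := fun y => p * n₁ * (p * n₁ * f₂ (p * n₁ * y)) - p * n₂ * (p * n₂ * f₂ (p * n₂ * y)))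
      (x := m) (l := q ^ 2) (l' := 2 * h * q ^ 2)
      (fun y hy => ((hf.deriv_one _ (hr y hy)).comp_const_mul).sub
        ((hf.deriv_one _ (hl y hy)).comp_const_mul))
      (fun y hy => (((hf.deriv_two _ (hr y hy)).comp_const_mul).const_mul ((p : ℝ) * n₁)).sub
        (((hf.deriv_two _ (hl y hy)).comp_const_mul).const_mul ((p : ℝ) * n₂)))
      (fun y hy => by
        have hy0 : 0 < y := lt_of_lt_of_le hm0 hy.1
        have hQ : ∀ z ∈ Set.Icc ((p : ℝ) * n₂ * y) (p * n₁ * y),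
            HasDerivAt (fun z => z ^ 2 * f₂ z) (z * (2 * f₂ z + z * f₃ z)) z := by
          intro z hz
          have h3 := (hasDerivAt_pow 2 z).mul (hf.deriv_three z (hmem y hy z hz))
          refine HasDerivAt.congr_deriv (f := fun z => z ^ 2 * f₂ z) h3 ?_
          push_cast; ring
        obtain ⟨ξ, hξ, e⟩ := exists_hasDerivAt_eq_slope (fun z => z ^ 2 * f₂ z)
          (fun z => z * (2 * f₂ z + z * f₃ z)) (hlt y hy)
          (fun z hz => (hQ z hz).continuousAt.continuousWithinAt)
          (fun z hz => hQ z ⟨hz.1.le, hz.2.le⟩)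
        have hbξ := hb ξ (hmem y hy ξ ⟨hξ.1.le, hξ.2.le⟩)
        rw [eq_div_iff (by linarith [hlt y hy])] at e
        have e2 : (p : ℝ) * n₁ * y - p * n₂ * y = p * D * y := by rw [hnR]; ring
        rw [e2] at e
        have e3 : (p : ℝ) * n₁ * (p * n₁ * f₂ (p * n₁ * y)) - p * n₂ * (p * n₂ * f₂ (p * n₂ * y)) =
            p * D * (ξ / y) * (2 * f₂ ξ + ξ * f₃ ξ) := by
          refine mul_right_cancel₀ (pow_ne_zero 2 hy0.ne') ?_
          have e5 : p * D * (ξ / y) * (2 * f₂ ξ + ξ * f₃ ξ) * y ^ 2 =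
              ξ * (2 * f₂ ξ + ξ * f₃ ξ) * (p * D * y) := by field_simp
          rw [e5, e]; ring
        have hx1 : (p : ℝ) * N ≤ ξ / y := by
          rw [le_div_iff₀ hy0]
          refine le_trans ?_ hξ.1.le
          gcongr
        have hx2 : ξ / y ≤ p * (2 * N) := by
          rw [div_le_iff₀ hy0]
          refine hξ.2.le.trans ?_
          gcongr
        have e4 : q ^ 2 = p * D * (p * N) * s ^ 2 := by
          rw [hq, mul_pow, hsq]; ring
        rw [e3, e4]
        have hx0 : 0 < ξ / y := lt_of_lt_of_le (by positivity) hx1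
        constructor
        · exact mul_le_mul (mul_le_mul_of_nonneg_left hx1 (by positivity)) hbξ.1 (by positivity)
            (by positivity)
        · calc p * D * (ξ / y) * (2 * f₂ ξ + ξ * f₃ ξ) ≤
              p * D * (p * (2 * N)) * (h * s ^ 2) :=
                mul_le_mul (mul_le_mul_of_nonneg_left hx2 (by positivity)) hbξ.2
                  ((sq_nonneg s).trans hbξ.1) (by positivity)
            _ = 2 * h * (p * D * (p * N) * s ^ 2) := by ring)
    have e1 : ∀ x : ℝ, ∀ n : ℕ, (p : ℝ) * n * x = p * (x * n) := fun x n => by ring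
    simp only [e1] at this
    simpa using this

theorem sum_Ico_inv_sqrt_le (H : ℕ) : ∑ D ∈ Finset.Ico 1 H, 1 / √(D : ℝ) ≤ 2 * √H := by
  have key : ∀ H : ℕ, ∑ D ∈ Finset.Ico 1 (H + 1), 1 / √(D : ℝ) ≤ 2 * √H := by
    intro H
    induction H with
    | zero => simp
    | succ H ih =>
      rw [Finset.sum_Ico_succ_top (by omega)]
      have h0 : 0 < √((H + 1 : ℕ) : ℝ) := Real.sqrt_pos.2 (by positivity)
      have h1 : √((H + 1 : ℕ) : ℝ) ^ 2 = H + 1 := by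
        rw [Real.sq_sqrt (by positivity)]; push_cast; ring
      have h2 : √(H : ℝ) ^ 2 = H := Real.sq_sqrt (Nat.cast_nonneg H)
      have h3 : 1 / √((H + 1 : ℕ) : ℝ) ≤ 2 * √((H + 1 : ℕ) : ℝ) - 2 * √(H : ℝ) := by
        rw [div_le_iff₀ h0]
        nlinarith [sq_nonneg (√((H + 1 : ℕ) : ℝ) - √(H : ℝ))]
      linarith
  exact (Finset.sum_le_sum_of_subset_of_nonneg (Finset.Ico_subset_Ico_right (Nat.le_succ H))
    fun _ _ _ => by positivity).trans (key H)

/-- The four terms under the root are the diagonal and, summed over `D < H`, the three terms of the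
correlation bound: the main term, its reciprocal, and the trailing `+ 1`. -/
theorem SmoothPhase.norm_bilinearSum_le {f f₁ f₂ f₃ : ℝ → ℝ} {A B : ℕ} {h s : ℝ}
    (hf : SmoothPhase f f₁ f₂ f₃ (A + 1) B) (hb : ∀ y ∈ Set.Icc ((A : ℝ) + 1) B,
      s ^ 2 ≤ 2 * f₂ y + y * f₃ y ∧ 2 * f₂ y + y * f₃ y ≤ h * s ^ 2) (hs : 0 < s) (hh : 1 ≤ h)
    {p N M H B' : ℕ} (hp : 0 < p) (hH : 0 < H) (hHN : H ≤ N) (hM : 0 < M) (hB' : B' ≤ B)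
    {γ γ' : ℕ → ℂ} (hγ : ∀ n, ‖γ n‖ ≤ 1) (hγ' : ∀ n, ‖γ' n‖ ≤ 1) :
    ‖bilinearSum (Finset.Ioc M (2 * M)) (Finset.Ioc N (2 * N)) (A / p) (B' / p) γ γ'
      (fun k => addChar (f ((p * k : ℕ) : ℝ)))‖ ≤
      2 * (N * M * √(1 / H + 24 * (h * (p * s * √(N * H))) + 48 / (p * s * √(N * H) * M) + 2 / M)) := by
  have hp0 : (0 : ℝ) < p := by exact_mod_cast hp
  have hH0 : (0 : ℝ) < H := by exact_mod_cast hH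
  have hM0 : (0 : ℝ) < M := by exact_mod_cast hM
  have hHN' : (H : ℝ) ≤ N := by exact_mod_cast hHN
  have hN0 : (0 : ℝ) < N := hH0.trans_le hHN'
  set κ : ℕ → ℝ := fun D =>
    12 * (M * h * (p * s * √(N * (D : ℕ)))) + 12 / (p * s * √(N * (D : ℕ))) + 1 with hκ
  have hκ0 : ∀ D, 0 ≤ κ D := fun D => by simp only [hκ]; positivity
  have hmain := _root_.norm_bilinearSum_le (M := M) (N := N) (A := A / p) (B := B' / p) (α := γ)
    (β := γ') (w := fun k => addChar (f ((p * k : ℕ) : ℝ))) (κ := κ) hH hγ hγ'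
    (fun n => (norm_addChar _).le) hκ0 ?_
  · refine hmain.trans ?_
    set Q : ℝ := p * s * √(N * H) with hQ
    have hQ0 : 0 < Q := by positivity
    have hsum : ∑ D ∈ Finset.Ico 1 H, κ D ≤ H * (12 * (M * h * Q)) + 24 * H / Q + H := by
      simp only [hκ]
      rw [Finset.sum_add_distrib, Finset.sum_add_distrib]
      refine add_le_add (add_le_add ?_ ?_) ?_
      · have : ∀ D ∈ Finset.Ico 1 H, 12 * (M * h * (p * s * √(N * (D : ℕ)))) ≤
            12 * (M * h * Q) := by
          intro D hD
          have : (D : ℝ) ≤ H := by exact_mod_cast (Finset.mem_Ico.1 hD).2.le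
          rw [hQ]
          gcongr
        refine (Finset.sum_le_sum this).trans ?_
        rw [Finset.sum_const, nsmul_eq_mul, Nat.card_Ico]
        refine mul_le_mul_of_nonneg_right ?_ (by positivity)
        exact_mod_cast Nat.sub_le H 1
      · have : ∀ D ∈ Finset.Ico 1 H, 12 / (p * s * √(N * (D : ℕ))) =
            12 / (p * s * √N) * (1 / √(D : ℝ)) := by
          intro D _
          rw [Real.sqrt_mul hN0.le]
          field_simp
        rw [Finset.sum_congr rfl this, ← Finset.mul_sum]
        refine (mul_le_mul_of_nonneg_left (sum_Ico_inv_sqrt_le H) (by positivity)).trans ?_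
        refine le_of_eq ?_
        rw [hQ, Real.sqrt_mul hN0.le]
        have hsH : √(H : ℝ) * √(H : ℝ) = H := Real.mul_self_sqrt hH0.le
        have : 0 < √(H : ℝ) := Real.sqrt_pos.2 hH0
        have : 0 < √(N : ℝ) := Real.sqrt_pos.2 hN0
        rw [div_mul_eq_mul_div, div_eq_div_iff (by positivity) (by positivity)]
        linear_combination (24 * (p * s * √N)) * hsH
      · rw [Finset.sum_const, nsmul_eq_mul, Nat.card_Ico, mul_one]
        exact_mod_cast Nat.sub_le H 1
    have h1 : (N : ℝ) / H + 1 ≤ 2 * (N / H) := by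
      have : 1 ≤ (N : ℝ) / H := by rw [le_div_iff₀ hH0]; linarith
      linarith
    have h2 : √(M * (H * (M + 2 * ∑ D ∈ Finset.Ico 1 H, κ D))) ≤
        (M * H) * √(1 / H + 24 * (h * Q) + 48 / (Q * M) + 2 / M) := by
      rw [← Real.sqrt_sq (by positivity : (0 : ℝ) ≤ M * H), ← Real.sqrt_mul' _ (by positivity)]
      refine Real.sqrt_le_sqrt ?_
      calc M * (H * (M + 2 * ∑ D ∈ Finset.Ico 1 H, κ D)) ≤
          M * (H * (M + 2 * (H * (12 * (M * h * Q)) + 24 * H / Q + H))) := by gcongr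
        _ = (M * H : ℝ) ^ 2 * (1 / H + 24 * (h * Q) + 48 / (Q * M) + 2 / M) := by
          field_simp; ring
    calc (N / H + 1) * √(M * (H * (M + 2 * ∑ D ∈ Finset.Ico 1 H, κ D))) ≤
        2 * (N / H) * ((M * H) * √(1 / H + 24 * (h * Q) + 48 / (Q * M) + 2 / M)) := by gcongr
      _ = _ := by field_simp
  · intro n₁ hn₁ n₂ hn₂ hlt _ a b ha hab hbM hm
    rw [Finset.mem_Ioc] at hn₁ hn₂
    refine hf.norm_sum_correlation_le hb hs hh hp (by omega) hn₂.1 hlt hn₁.2 hab (by omega)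
      fun m h1 h2 => ?_
    have := hm m h1 h2
    rw [Nat.div_lt_iff_lt_mul hp, Nat.le_div_iff_mul_le hp, mul_comm _ p, mul_comm _ p] at this
    exact ⟨this.1, this.2.trans hB'⟩

theorem SmoothPhase.norm_sum_dilate_le_of_signed {f f₁ f₂ f₃ : ℝ → ℝ} {A B : ℕ} {h s T : ℝ}
    (hf : SmoothPhase f f₁ f₂ f₃ (A + 1) B) (hb : SignedBounds f₂ (A + 1) B (s ^ 2) (h * s ^ 2))
    (hs : 0 < s) (hh : 1 ≤ h) (hBT : (B : ℝ) ≤ T) {k B' : ℕ} (hk : 0 < k) (hB' : B' ≤ B) :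
    ‖∑ n ∈ Finset.Ioc (A / k) (B' / k), addChar (f ((k * n : ℕ) : ℝ))‖ ≤
      6 * (h * s * T) + 12 / (k * s) + 1 := by
  rcases hb with hb | hb
  · exact hf.norm_sum_dilate_le hb hs hh hBT hk hB'
  · rw [← norm_sum_addChar_neg]
    exact hf.neg.norm_sum_dilate_le hb hs hh hBT hk hB'

theorem SmoothPhase.norm_bilinearSum_le_of_signed {f f₁ f₂ f₃ : ℝ → ℝ} {A B : ℕ} {h s : ℝ}
    (hf : SmoothPhase f f₁ f₂ f₃ (A + 1) B)
    (hb : SignedBounds (fun y => 2 * f₂ y + y * f₃ y) (A + 1) B (s ^ 2) (h * s ^ 2))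
    (hs : 0 < s) (hh : 1 ≤ h)
    {p N M H B' : ℕ} (hp : 0 < p) (hH : 0 < H) (hHN : H ≤ N) (hM : 0 < M) (hB' : B' ≤ B)
    {γ γ' : ℕ → ℂ} (hγ : ∀ n, ‖γ n‖ ≤ 1) (hγ' : ∀ n, ‖γ' n‖ ≤ 1) :
    ‖bilinearSum (Finset.Ioc M (2 * M)) (Finset.Ioc N (2 * N)) (A / p) (B' / p) γ γ'
      (fun k => addChar (f ((p * k : ℕ) : ℝ)))‖ ≤
      2 * (N * M * √(1 / H + 24 * (h * (p * s * √(N * H))) + 48 / (p * s * √(N * H) * M) + 2 / M)) := by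
  rcases hb with hb | hb
  · exact hf.norm_bilinearSum_le hb hs hh hp hH hHN hM hB' hγ hγ'
  · have h1 : (fun k : ℕ => addChar (f ((p * k : ℕ) : ℝ))) =
        fun k : ℕ => (starRingEnd ℂ) (addChar ((-f) ((p * k : ℕ) : ℝ))) := by
      funext k
      rw [← addChar_neg, Pi.neg_apply, neg_neg]
    rw [h1, norm_bilinearSum_conj]
    refine hf.neg.norm_bilinearSum_le (fun y hy => ?_) hs hh hp hH hHN hM hB'
      (fun n => by rw [RCLike.norm_conj]; exact hγ n) (fun n => by rw [RCLike.norm_conj]; exact hγ' n)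
    have := hb y hy
    simp only [Pi.neg_apply]
    constructor <;> linarith [this.1, this.2]

/-- The block length should be as large as `24 h Q ≤ 24 / L ^ 50` permits, where `Q = p s √(N H)`:
all of `N` if possible, and otherwise `H ≈ 1 / (W² N)`, which makes `L ^ 50 h Q` of order 1. The
term `48 / (Q M)` need not be small when `H = N`; there only its product with `(N M)²`, compared
with `(T / p)²`, is controlled, through `s T ≥ L ^ 44`. -/
theorem exists_block_length {h s T L : ℝ} {p N M : ℕ} (hs : 0 < s) (hh : 1 ≤ h) (hL : 10 ≤ L)
    (hT : L ^ 5000 ≤ T) (hhL : h ≤ L ^ 130) (hsT : L ^ 44 ≤ s * T)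
    (hhs : (h * s) ^ 2 * √T * L ^ 2000 ≤ 1) (hp : 0 < p) (hpL : (p : ℝ) ≤ L ^ 270)
    (hNL : L ^ 270 ≤ 2 * N) (hNM : N ≤ M) (hMN : (M : ℝ) * N * p ≤ T) :
    ∃ H : ℕ, 0 < H ∧ H ≤ N ∧
      1 / H + 24 * (h * (p * s * √(N * H))) + 2 / M ≤ 30 / L ^ 50 ∧
      (N * M : ℝ) ^ 2 * (48 / (p * s * √(N * H) * M)) ≤ 200 / L ^ 44 * (T / p) ^ 2 := by
  have hL1 : 1 ≤ L := by linarith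
  have hL0 : 0 < L := by linarith
  have hmono : ∀ {i j : ℕ}, i ≤ j → L ^ i ≤ L ^ j := fun h => pow_le_pow_right₀ hL1 h
  have hT0 : 0 < T := lt_of_lt_of_le (by positivity) hT
  have hp0 : (0 : ℝ) < p := by exact_mod_cast hp
  have hN0 : (0 : ℝ) < N := by
    have : 0 < L ^ 270 := by positivity
    linarith
  have hNM' : (N : ℝ) ≤ M := by exact_mod_cast hNM
  have hM0 : (0 : ℝ) < M := by linarith
  have hMN' : (N : ℝ) * M ≤ T / p := by rw [le_div_iff₀ hp0]; linarith [mul_comm (N : ℝ) M]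
  have hh0 : 0 < h := by linarith
  have hNinv : 1 / (N : ℝ) ≤ 2 / L ^ 50 := by
    rw [div_le_div_iff₀ hN0 (by positivity)]
    linarith [hmono (show 50 ≤ 270 by norm_num)]
  have hMinv : 2 / (M : ℝ) ≤ 4 / L ^ 50 := by
    have : 1 / (M : ℝ) ≤ 1 / N := one_div_le_one_div_of_le hN0 hNM'
    have e1 : 2 / (M : ℝ) = 2 * (1 / M) := by ring
    have e2 : 4 / L ^ 50 = 2 * (2 / L ^ 50) := by ring
    rw [e1, e2]; linarith
  have e30 : 30 / L ^ 50 = 2 / L ^ 50 + 24 * (1 / L ^ 50) + 4 / L ^ 50 := by ring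
  obtain ⟨W, hW⟩ : ∃ W, W = L ^ 50 * (h * (p * s)) := ⟨_, rfl⟩
  have hW0 : 0 < W := by rw [hW]; positivity
  rcases le_or_gt (W * N) 1 with h1 | h1
  · refine ⟨N, by exact_mod_cast hN0, le_rfl, ?_, ?_⟩
    · rw [Real.sqrt_mul_self hN0.le, e30]
      refine add_le_add (add_le_add hNinv (mul_le_mul_of_nonneg_left ?_ (by norm_num))) hMinv
      rw [le_div_iff₀ (by positivity)]
      rw [hW] at h1
      linarith
    · rw [Real.sqrt_mul_self hN0.le]
      have e : (N * M : ℝ) ^ 2 * (48 / (p * s * N * M)) = 48 * (N * M) / (p * s) := by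
        field_simp
      have e2 : (200 : ℝ) / L ^ 44 * (T / p) ^ 2 = (200 * (T / p)) * (s * T / L ^ 44) / (p * s) := by
        field_simp
      rw [e, e2]
      refine div_le_div_of_nonneg_right ?_ (by positivity)
      have h2 : 1 ≤ s * T / L ^ 44 := by rw [le_div_iff₀ (by positivity)]; linarith
      have h3 : 0 < T / p := by positivity
      nlinarith
  · have hNT : (N : ℝ) ≤ √T := by
      refine Real.le_sqrt_of_sq_le ?_
      have : (1 : ℝ) ≤ p := by exact_mod_cast hp
      calc (N : ℝ) ^ 2 = N * N := by ring
        _ ≤ M * N := by gcongr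
        _ ≤ M * N * p := le_mul_of_one_le_right (by positivity) this
        _ ≤ T := hMN
    -- With `N ≤ √T`, the hypothesis `hhs` forces the block length `y` below to be at least `L ^
    -- 50`, so the diagonal term is small.
    have hy : W ^ 2 * N * L ^ 50 ≤ 1 := by
      calc W ^ 2 * N * L ^ 50 = L ^ 150 * p ^ 2 * ((h * s) ^ 2 * N) := by rw [hW]; ring
        _ ≤ L ^ 150 * (L ^ 270) ^ 2 * ((h * s) ^ 2 * √T) := by gcongr
        _ = (h * s) ^ 2 * √T * L ^ 690 := by ring
        _ ≤ (h * s) ^ 2 * √T * L ^ 2000 :=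
          mul_le_mul_of_nonneg_left (hmono (by norm_num)) (by positivity)
        _ ≤ 1 := hhs
    obtain ⟨y, hyd⟩ : ∃ y, y = 1 / (W ^ 2 * N) := ⟨_, rfl⟩
    have hyL : L ^ 50 ≤ y := by
      rw [hyd, le_div_iff₀ (by positivity)]; linarith
    have hyN : y ≤ N := by
      rw [hyd, div_le_iff₀ (by positivity)]
      nlinarith
    have hy2 : 2 ≤ y := by
      have : L ^ 1 ≤ L ^ 50 := hmono (by norm_num)
      rw [pow_one] at this
      linarith
    have hWy : W ^ 2 * (N * y) = 1 := by rw [hyd]; field_simp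
    have hfl : (⌊y⌋₊ : ℝ) ≤ y := Nat.floor_le (by linarith)
    have hfl2 : y / 2 ≤ ⌊y⌋₊ := by linarith [Nat.lt_floor_add_one y]
    obtain ⟨H, hHd⟩ : ∃ H, H = ⌊y⌋₊ := ⟨_, rfl⟩
    rw [← hHd] at hfl hfl2
    have hH0 : (0 : ℝ) < H := by linarith
    have hsq : √((N : ℝ) * H) ^ 2 = N * H := Real.sq_sqrt (by positivity)
    obtain ⟨Q, hQ⟩ : ∃ Q, Q = p * s * √((N : ℝ) * H) := ⟨_, rfl⟩
    have hQ0 : 0 < Q := by rw [hQ]; positivity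
    have hWQ : (L ^ 50 * (h * Q)) ^ 2 = W ^ 2 * (N * H) := by
      rw [hQ, hW]; linear_combination (L ^ 100 * h ^ 2 * p ^ 2 * s ^ 2) * hsq
    refine ⟨H, by exact_mod_cast hH0, ?_, ?_, ?_⟩
    · have : (H : ℝ) ≤ N := hfl.trans hyN
      exact_mod_cast this
    · rw [e30, ← hQ]
      refine add_le_add (add_le_add ?_ (mul_le_mul_of_nonneg_left ?_ (by norm_num))) hMinv
      · rw [div_le_div_iff₀ hH0 (by positivity)]; linarith
      · rw [le_div_iff₀ (by positivity)]
        have : (L ^ 50 * (h * Q)) ^ 2 ≤ 1 ^ 2 := by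
          rw [hWQ, one_pow, ← hWy]; gcongr
        have := (abs_le_of_sq_le_sq' this zero_le_one).2
        linarith
    · rw [← hQ]
      have h2 : 1 / 2 ≤ L ^ 50 * (h * Q) := by
        have : (1 / 2 : ℝ) ^ 2 ≤ (L ^ 50 * (h * Q)) ^ 2 := by
          have h3 : W ^ 2 * (N * (y / 2)) ≤ W ^ 2 * (N * H) := by gcongr
          rw [hWQ]
          linarith [show W ^ 2 * (N * (y / 2)) = W ^ 2 * (N * y) / 2 by ring]
        exact (abs_le_of_sq_le_sq' this (by positivity)).2
      have h3 : 1 ≤ 2 * L ^ 180 * Q := by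
        have : L ^ 50 * (h * Q) ≤ L ^ 50 * (L ^ 130 * Q) := by gcongr
        linarith [show L ^ 50 * (L ^ 130 * Q) = L ^ 180 * Q by ring]
      have h4 : L ^ 224 ≤ 2 * M := by
        linarith [hmono (show 224 ≤ 270 by norm_num)]
      have h5 : 48 / (Q * M) ≤ 200 / L ^ 44 := by
        rw [div_le_div_iff₀ (by positivity) (by positivity)]
        have : L ^ 44 ≤ 4 * (Q * M) := by
          have h6 : L ^ 44 * L ^ 180 ≤ (4 * (Q * M)) * L ^ 180 := by
            calc L ^ 44 * L ^ 180 = 1 * L ^ 224 := by ring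
              _ ≤ (2 * L ^ 180 * Q) * (2 * M) := by gcongr
              _ = (4 * (Q * M)) * L ^ 180 := by ring
          exact le_of_mul_le_mul_right h6 (by positivity)
        have : 0 < Q * M := by positivity
        linarith
      rw [mul_comm]
      gcongr

/-- In the type I sums `hhs` gives `h s L ^ 1000 ≤ 1`, which pays for moduli up to `L ^ 810`, and `s
T ≥ L ^ 44` handles the reciprocal term. In type II the square of the bound carries `L ^ (-44)`,
enough for `L ^ (-20)` after taking the root. -/
theorem SmoothPhase.norm_arithSum_primeInd_le {f f₁ f₂ f₃ : ℝ → ℝ} {h s T L ℓ : ℝ}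
    {A B U X J : ℕ} (hf : SmoothPhase f f₁ f₂ f₃ (A + 1) B)
    (hf₂ : SignedBounds f₂ (A + 1) B (s ^ 2) (h * s ^ 2))
    (hf₃ : SignedBounds (fun y => 2 * f₂ y + y * f₃ y) (A + 1) B (s ^ 2) (h * s ^ 2)) (hs : 0 < s)
    (hh : 1 ≤ h) (hL : 10 ≤ L) (hT : L ^ 5000 ≤ T) (hhL : h ≤ L ^ 130) (hsT : L ^ 44 ≤ s * T)
    (hhs : (h * s) ^ 2 * √T * L ^ 2000 ≤ 1) (hXT : (X : ℝ) ≤ T) (hTX : T ≤ X + 1) (hBX : B ≤ X)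
    (hU : (U : ℝ) ≤ L ^ 270) (hU' : L ^ 270 ≤ 2 * U) (hℓ : 1 ≤ ℓ)
    (hlog : Real.log X ≤ ℓ) (hdiv : ∀ n, n ≤ X → (n.divisors.card : ℝ) ≤ ℓ)
    (hharm : ∑ k ∈ Finset.Ioc 0 X, 1 / (k : ℝ) ≤ ℓ) (hJ : (J : ℝ) ≤ ℓ) (hXJ : X ≤ U * 2 ^ J) :
    ‖arithSum (primeInd * primeInd) A B (fun n => addChar (f n))‖ ≤
      30 * (ℓ ^ 5 * (T / L ^ 20)) := by
  have hL1 : 1 ≤ L := by linarith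
  have hL0 : 0 < L := by linarith
  have hmono : ∀ {i j : ℕ}, i ≤ j → L ^ i ≤ L ^ j := fun h => pow_le_pow_right₀ hL1 h
  have hT0 : 0 < T := lt_of_lt_of_le (by positivity) hT
  have hh0 : 0 < h := by linarith
  have hsT' : L ^ 2500 ≤ √T := by
    refine Real.le_sqrt_of_sq_le ?_
    rw [← pow_mul]; exact hT
  have hsTT : √T * √T = T := Real.mul_self_sqrt hT0.le
  have hsT1 : 1 ≤ √T := (one_le_pow₀ hL1).trans hsT'
  have hU0 : (0 : ℝ) < U := by
    have : 0 < L ^ 270 := by positivity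
    linarith
  refine norm_arithSum_primeInd_mul_primeInd_le (U := U) (X := X) (J := J)
    (fun n => (norm_addChar _).le) hBX (by exact_mod_cast hU0) ?_ hℓ hlog hdiv hharm hJ hXJ ?_ ?_ ?_
  · have : (U : ℝ) ^ 2 ≤ X := by
      have h1 : (U : ℝ) ^ 2 ≤ L ^ 540 := by
        calc (U : ℝ) ^ 2 ≤ (L ^ 270) ^ 2 := by gcongr
          _ = L ^ 540 := by rw [← pow_mul]
      have h2 : L ^ 540 * 10 ≤ L ^ 541 := by
        calc L ^ 540 * 10 ≤ L ^ 540 * L := by gcongr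
          _ = L ^ 541 := by ring
      have h3 : L ^ 541 ≤ L ^ 5000 := hmono (by norm_num)
      have h4 : 1 ≤ L ^ 540 := one_le_pow₀ hL1
      linarith
    exact_mod_cast this
  · rw [le_div_iff₀ (by positivity)]
    calc (U : ℝ) ^ 2 * √X * L ^ 20 ≤ (L ^ 270) ^ 2 * √T * L ^ 20 := by gcongr
      _ = L ^ 560 * √T := by rw [← pow_mul]; ring
      _ ≤ √T * √T := by gcongr; exact (hmono (by norm_num)).trans hsT'
      _ = T := hsTT
  · intro k hk hkU B' hB'
    have hkL : (k : ℝ) ≤ L ^ 810 := by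
      have : (k : ℝ) ≤ (U : ℝ) ^ 3 := by exact_mod_cast hkU
      calc (k : ℝ) ≤ (U : ℝ) ^ 3 := this
        _ ≤ (L ^ 270) ^ 3 := by gcongr
        _ = L ^ 810 := by rw [← pow_mul]
    have hk0 : (0 : ℝ) < k := by exact_mod_cast hk
    refine (hf.norm_sum_dilate_le_of_signed hf₂ hs hh (le_trans (by exact_mod_cast hBX) hXT) hk hB').trans ?_
    rw [le_div_iff₀ hk0, add_mul, add_mul]
    have hhs' : h * s * L ^ 1000 ≤ 1 := by
      refine (abs_le_of_sq_le_sq' ?_ zero_le_one).2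
      calc (h * s * L ^ 1000) ^ 2 = (h * s) ^ 2 * 1 * L ^ 2000 := by ring
        _ ≤ (h * s) ^ 2 * √T * L ^ 2000 := by gcongr
        _ ≤ 1 ^ 2 := by rw [one_pow]; exact hhs
    have a1 : 6 * (h * s * T) * k ≤ 6 * (T / L ^ 190) := by
      calc 6 * (h * s * T) * k ≤ 6 * (h * s * T) * L ^ 810 := by gcongr
        _ = 6 * (T * (h * s * L ^ 1000) / L ^ 190) := by field_simp
        _ ≤ 6 * (T * 1 / L ^ 190) := by gcongr
        _ = _ := by rw [mul_one]
    have a2 : 12 / (k * s) * k ≤ 12 * (T / L ^ 44) := by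
      have e : 12 / (k * s) * k = 12 / s := by field_simp
      rw [e, mul_div_assoc', div_le_div_iff₀ hs (by positivity)]
      linarith
    have a3 : 1 * (k : ℝ) ≤ T / L ^ 44 := by
      rw [le_div_iff₀ (by positivity)]
      calc 1 * (k : ℝ) * L ^ 44 ≤ 1 * L ^ 810 * L ^ 44 := by gcongr
        _ = L ^ 854 := by ring
        _ ≤ L ^ 5000 := hmono (by norm_num)
        _ ≤ T := hT
    have a4 : T / L ^ 190 ≤ T / L ^ 44 :=
      div_le_div_of_nonneg_left hT0.le (by positivity) (hmono (by norm_num))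
    have a5 : 100 * (T / L ^ 44) ≤ T / L ^ 20 := by
      have e : T / L ^ 20 = L ^ 24 * (T / L ^ 44) := by field_simp
      rw [e]
      refine mul_le_mul_of_nonneg_right ?_ (by positivity)
      calc (100 : ℝ) = 10 ^ 2 := by norm_num
        _ ≤ L ^ 2 := by gcongr
        _ ≤ L ^ 24 := hmono (by norm_num)
    have a6 : 0 < T / L ^ 44 := by positivity
    linarith
  · intro p hp hpU M N hUN hNM hMN B' hB' γ γ' hγ hγ'
    have hUN' : (U : ℝ) ≤ N := by exact_mod_cast hUN
    have hNM' : (N : ℝ) ≤ M := by exact_mod_cast hNM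
    have hM0 : (0 : ℝ) < M := by linarith
    have hN0 : (0 : ℝ) < N := by linarith
    have hp0 : (0 : ℝ) < p := by exact_mod_cast hp
    have hpU' : (p : ℝ) ≤ U := by exact_mod_cast hpU
    have hMN' : (M : ℝ) * N * p ≤ T := by
      have : ((M * N * p : ℕ) : ℝ) ≤ X := by exact_mod_cast hMN.trans hBX
      push_cast at this
      linarith
    obtain ⟨H, hH, hHN, b1, b2⟩ := exists_block_length hs hh hL hT hhL hsT hhs hp
      (hpU'.trans hU) (by linarith) hNM hMN'
    refine (hf.norm_bilinearSum_le_of_signed hf₃ hs hh hp hH hHN (by exact_mod_cast hM0) hB' hγ hγ').trans ?_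
    have hV : (N : ℝ) * M ≤ T / p := by rw [le_div_iff₀ hp0]; linarith [mul_comm (N : ℝ) M]
    obtain ⟨Q, hQ⟩ : ∃ Q, Q = p * s * √((N : ℝ) * H) := ⟨_, rfl⟩
    rw [← hQ] at b1 b2 ⊢
    have hQ0 : 0 ≤ Q := by rw [hQ]; positivity
    set Y : ℝ := 1 / H + 24 * (h * Q) + 48 / (Q * M) + 2 / M with hY
    have hY0 : 0 ≤ Y := by positivity
    refine (abs_le_of_sq_le_sq' ?_ (by positivity)).2
    have e1 : (2 * (N * M * √Y)) ^ 2 = 4 * ((N * M) ^ 2 * Y) := by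
      rw [mul_pow, mul_pow, Real.sq_sqrt hY0]; ring
    have e2 : (T / L ^ 20 / p) ^ 2 = (T / p) ^ 2 / L ^ 40 := by
      rw [div_right_comm, div_pow, ← pow_mul]
    have hZ0 : 0 ≤ 1 / (H : ℝ) + 24 * (h * Q) + 2 / M := by positivity
    have e3 : (N * M : ℝ) ^ 2 * Y ≤ (T / p) ^ 2 * (30 / L ^ 50) + 200 / L ^ 44 * (T / p) ^ 2 := by
      have : (N * M : ℝ) ^ 2 * Y = (N * M) ^ 2 * (1 / H + 24 * (h * Q) + 2 / M) +
          (N * M) ^ 2 * (48 / (Q * M)) := by rw [hY]; ring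
      rw [this]
      refine add_le_add (mul_le_mul ?_ b1 hZ0 (by positivity)) b2
      gcongr
    rw [e1, e2]
    have e4 : 30 / L ^ 50 ≤ 30 / L ^ 44 :=
      div_le_div_of_nonneg_left (by norm_num) (by positivity) (hmono (by norm_num))
    have e5 : 920 / L ^ 44 ≤ 1 / L ^ 40 := by
      rw [div_le_div_iff₀ (by positivity) (by positivity)]
      have : (10 : ℝ) ^ 4 ≤ L ^ 4 := by gcongr
      calc 920 * L ^ 40 ≤ L ^ 4 * L ^ 40 := by gcongr; linarith
        _ = 1 * L ^ 44 := by ring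
    calc 4 * ((N * M : ℝ) ^ 2 * Y) ≤
        4 * ((T / p) ^ 2 * (30 / L ^ 50) + 200 / L ^ 44 * (T / p) ^ 2) := by gcongr
      _ ≤ 4 * ((T / p) ^ 2 * (30 / L ^ 44) + 200 / L ^ 44 * (T / p) ^ 2) := by gcongr
      _ = (T / p) ^ 2 * (920 / L ^ 44) := by ring
      _ ≤ (T / p) ^ 2 * (1 / L ^ 40) := by gcongr
      _ = (T / p) ^ 2 / L ^ 40 := by ring

/-! ### Common parameters, and the fractional linear phase. -/

/-- The parameters `X = ⌊T⌋`, `U ≈ L ^ 270`, and a common bound `ℓ` for the logarithmic factors. -/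
structure SieveScales (T L ℓ : ℝ) (X U J : ℕ) : Prop where
  ten_le : 10 ≤ L
  pow_le : L ^ 5000 ≤ T
  le_T : (X : ℝ) ≤ T
  T_le : T < X + 1
  U_le : (U : ℝ) ≤ L ^ 270
  le_U : L ^ 270 ≤ 2 * U
  one_le : 1 ≤ ℓ
  log_le : Real.log X ≤ ℓ
  div_le : ∀ n, n ≤ X → (n.divisors.card : ℝ) ≤ ℓ
  harm_le : ∑ k ∈ Finset.Ioc 0 X, 1 / (k : ℝ) ≤ ℓ
  J_le : (J : ℝ) ≤ ℓ
  X_le : X ≤ U * 2 ^ J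

theorem SieveScales.norm_arithSum_le {T L ℓ : ℝ} {X U J : ℕ} (hS : SieveScales T L ℓ X U J)
    {f f₁ f₂ f₃ : ℝ → ℝ} {h s : ℝ} {A B : ℕ} (hf : SmoothPhase f f₁ f₂ f₃ (A + 1) B)
    (hf₂ : SignedBounds f₂ (A + 1) B (s ^ 2) (h * s ^ 2))
    (hf₃ : SignedBounds (fun y => 2 * f₂ y + y * f₃ y) (A + 1) B (s ^ 2) (h * s ^ 2)) (hs : 0 < s)
    (hh : 1 ≤ h) (hhL : h ≤ L ^ 130) (hsT : L ^ 44 ≤ s * T)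
    (hhs : (h * s) ^ 2 * √T * L ^ 2000 ≤ 1) (hBX : B ≤ X) :
    ‖arithSum (primeInd * primeInd) A B (fun n => addChar (f n))‖ ≤ 30 * (ℓ ^ 5 * (T / L ^ 20)) :=
  hf.norm_arithSum_primeInd_le hf₂ hf₃ hs hh hS.ten_le hS.pow_le hhL hsT hhs hS.le_T hS.T_le.le hBX
    hS.U_le hS.le_U hS.one_le hS.log_le hS.div_le hS.harm_le hS.J_le hS.X_le

/-- A continuous function whose absolute value stays above `l > 0` has no zero on the interval,
hence constant sign. -/
theorem signedBounds_of_abs {g : ℝ → ℝ} {A B l l' : ℝ} (hl : 0 < l)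
    (hg : ContinuousOn g (Set.Icc A B)) (h : ∀ y ∈ Set.Icc A B, l ≤ |g y| ∧ |g y| ≤ l') :
    SignedBounds g A B l l' := by
  by_cases hpos : ∀ y ∈ Set.Icc A B, 0 ≤ g y
  · left
    intro y hy
    have := h y hy
    rwa [abs_of_nonneg (hpos y hy)] at this
  · right
    push Not at hpos
    obtain ⟨x, hx, hgx⟩ := hpos
    intro y hy
    have hy0 : g y ≤ 0 := by
      by_contra hcon
      push Not at hcon
      obtain ⟨z, hz, hz0⟩ := isPreconnected_Icc.intermediate_value hx hy hg
        (show (0 : ℝ) ∈ Set.Icc (g x) (g y) from ⟨hgx.le, hcon.le⟩)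
      have := (h z hz).1
      rw [hz0, abs_zero] at this
      linarith
    have := h y hy
    rwa [abs_of_nonpos hy0] at this

/-- The phase `β (y - t₀) / (1 + ν (y - t₀))`. -/
noncomputable def mobiusPhase (β ν t₀ y : ℝ) : ℝ := β * ((y - t₀) / (1 + ν * (y - t₀)))

theorem fracLin_mul_eq_mobiusPhase {μ : ℝ} (hμ : μ ≠ 0) (ν β t₀ y : ℝ) :
    fracLin μ ν (y - t₀) * β = mobiusPhase β (ν / μ) t₀ y := by
  rw [fracLin, mobiusPhase, mul_comm β]
  congr 1
  have : μ + ν * (y - t₀) = μ * (1 + ν / μ * (y - t₀)) := by field_simp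
  rw [this, mul_div_mul_left _ _ hμ]

theorem smoothPhase_mobius {β ν t₀ A B : ℝ} (h : ∀ y ∈ Set.Icc A B, 1 + ν * (y - t₀) ≠ 0) :
    SmoothPhase (mobiusPhase β ν t₀) (fun y => β / (1 + ν * (y - t₀)) ^ 2)
      (fun y => -2 * β * ν / (1 + ν * (y - t₀)) ^ 3)
      (fun y => 6 * β * ν ^ 2 / (1 + ν * (y - t₀)) ^ 4) A B := by
  have hs : ∀ y, HasDerivAt (fun y : ℝ => 1 + ν * (y - t₀)) ν y := by
    intro y
    simpa using (((hasDerivAt_id y).sub_const t₀).const_mul ν).const_add 1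
  refine ⟨fun y hy => ?_, fun y hy => ?_, fun y hy => ?_⟩
  · have h1 : HasDerivAt (fun y : ℝ => y - t₀) 1 y := (hasDerivAt_id y).sub_const t₀
    have h2 := (h1.div (hs y) (h y hy)).const_mul β
    refine HasDerivAt.congr_deriv (f := mobiusPhase β ν t₀) h2 ?_
    have := h y hy
    field_simp; ring
  · have h2 := ((hs y).pow 2).inv (pow_ne_zero 2 (h y hy)) |>.const_mul β
    refine HasDerivAt.congr_deriv (f := fun y => β / (1 + ν * (y - t₀)) ^ 2) h2 ?_
    have := h y hy
    simp only [Pi.pow_apply]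
    field_simp; norm_num; ring
  · have h2 := ((hs y).pow 3).inv (pow_ne_zero 3 (h y hy)) |>.const_mul (-2 * β * ν)
    refine HasDerivAt.congr_deriv (f := fun y => -2 * β * ν / (1 + ν * (y - t₀)) ^ 3) h2 ?_
    have := h y hy
    simp only [Pi.pow_apply]
    field_simp; norm_num; ring

/-- Besides the pole, the type II quantity has a zero, where `ν y = 2 - 2 ν t₀`; bounds from below
must avoid its neighbourhood too. -/
theorem mobius_third_eq {β ν t₀ y : ℝ} (h : 1 + ν * (y - t₀) ≠ 0) :
    2 * (-2 * β * ν / (1 + ν * (y - t₀)) ^ 3) + y * (6 * β * ν ^ 2 / (1 + ν * (y - t₀)) ^ 4) =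
      -2 * β * ν * (2 - 2 * ν * t₀ - ν * y) / (1 + ν * (y - t₀)) ^ 4 := by
  field_simp; ring

theorem SieveScales.norm_arithSum_mobius_le {T L ℓ : ℝ} {X U J : ℕ} (hS : SieveScales T L ℓ X U J)
    {β ν t₀ h s : ℝ} {A B : ℕ} (hs : 0 < s)
    (hne : ∀ y ∈ Set.Icc ((A : ℝ) + 1) B, 1 + ν * (y - t₀) ≠ 0)
    (hb₂ : ∀ y ∈ Set.Icc ((A : ℝ) + 1) B, s ^ 2 ≤ 2 * |β| * |ν| / |1 + ν * (y - t₀)| ^ 3 ∧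
      2 * |β| * |ν| / |1 + ν * (y - t₀)| ^ 3 ≤ h * s ^ 2)
    (hb₃ : ∀ y ∈ Set.Icc ((A : ℝ) + 1) B,
      s ^ 2 ≤ 2 * |β| * |ν| * |2 - 2 * ν * t₀ - ν * y| / |1 + ν * (y - t₀)| ^ 4 ∧
      2 * |β| * |ν| * |2 - 2 * ν * t₀ - ν * y| / |1 + ν * (y - t₀)| ^ 4 ≤ h * s ^ 2)
    (hh : 1 ≤ h) (hhL : h ≤ L ^ 130) (hsT : L ^ 44 ≤ s * T)
    (hhs : (h * s) ^ 2 * √T * L ^ 2000 ≤ 1) (hBX : B ≤ X) :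
    ‖arithSum (primeInd * primeInd) A B (fun n => addChar (mobiusPhase β ν t₀ n))‖ ≤
      30 * (ℓ ^ 5 * (T / L ^ 20)) := by
  have hf := smoothPhase_mobius (β := β) hne
  have hc : ContinuousOn (fun y : ℝ => 1 + ν * (y - t₀)) (Set.Icc ((A : ℝ) + 1) B) := by fun_prop
  refine hS.norm_arithSum_le hf (signedBounds_of_abs (by positivity) ?_ fun y hy => ?_)
    (signedBounds_of_abs (by positivity) ?_ fun y hy => ?_) hs hh hhL hsT hhs hBX
  · exact fun y hy => (hf.deriv_three y hy).continuousAt.continuousWithinAt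
  · have := hb₂ y hy
    rw [abs_div, abs_mul, abs_mul, abs_pow]
    simpa using this
  · refine ContinuousOn.add (ContinuousOn.mul continuousOn_const
      fun y hy => (hf.deriv_three y hy).continuousAt.continuousWithinAt) ?_
    exact continuousOn_id.mul (continuousOn_const.div (hc.pow 4) fun y hy => pow_ne_zero 4 (hne y hy))
  · have := hb₃ y hy
    simp only [mobius_third_eq (β := β) (hne y hy)]
    rw [abs_div, abs_mul, abs_mul, abs_mul, abs_pow]
    simpa using this

theorem SieveScales.norm_arithSum_mobius_le_of_flat {T L ℓ : ℝ} {X U J : ℕ}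
    (hS : SieveScales T L ℓ X U J) {β ν t₀ : ℝ} {A B : ℕ} (hβ : 0 < β) (hβL : β ≤ L ^ 10)
    (ht₀ : t₀ ∈ Set.Icc 0 T) (hν : |ν| * T ≤ 1 / 8) (hνβ : L ^ 88 ≤ β * |ν| * T ^ 2) (hBX : B ≤ X) :
    ‖arithSum (primeInd * primeInd) A B (fun n => addChar (mobiusPhase β ν t₀ n))‖ ≤
      30 * (ℓ ^ 5 * (T / L ^ 20)) := by
  have hL1 : 1 ≤ L := by linarith [hS.ten_le]
  have hL0 : 0 < L := by linarith
  have hT0 : 0 < T := lt_of_lt_of_le (by positivity) hS.pow_le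
  have hν0 : 0 < |ν| := by
    rw [abs_pos]; rintro rfl
    have : 0 < L ^ 88 := by positivity
    simp at hνβ; linarith
  have hβν : 0 < β * |ν| := by positivity
  have hsq : √(β * |ν|) ^ 2 = β * |ν| := Real.sq_sqrt hβν.le
  have hBT : (B : ℝ) ≤ T := le_trans (by exact_mod_cast hBX) hS.le_T
  have hA0 : (0 : ℝ) ≤ A := Nat.cast_nonneg A
  have hbd : ∀ x : ℝ, |x| ≤ T → |ν * x| ≤ 1 / 8 := fun x hx => by
    rw [abs_mul]
    exact (mul_le_mul_of_nonneg_left hx hν0.le).trans hν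
  have hy : ∀ y ∈ Set.Icc ((A : ℝ) + 1) B,
      7 / 8 ≤ |1 + ν * (y - t₀)| ∧ |1 + ν * (y - t₀)| ≤ 9 / 8 ∧
      13 / 8 ≤ |2 - 2 * ν * t₀ - ν * y| ∧ |2 - 2 * ν * t₀ - ν * y| ≤ 19 / 8 := by
    intro y hy
    have h1 := abs_le.1 (hbd (y - t₀) (abs_le.2 ⟨by linarith [hy.1, ht₀.2], by linarith [hy.2, ht₀.1]⟩))
    have h2 := abs_le.1 (hbd t₀ (abs_le.2 ⟨by linarith [ht₀.1], ht₀.2⟩))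
    have h3 := abs_le.1 (hbd y (abs_le.2 ⟨by linarith [hy.1], by linarith [hy.2]⟩))
    rw [abs_of_pos (by linarith [h1.1] : 0 < 1 + ν * (y - t₀)),
      abs_of_pos (by linarith [h2.2, h3.2] : 0 < 2 - 2 * ν * t₀ - ν * y)]
    refine ⟨?_, ?_, ?_, ?_⟩ <;> linarith [h1.1, h1.2, h2.1, h2.2, h3.1, h3.2]
  -- All factors other than `β |ν|` lie between fixed constants, and the resulting ratios lie
  -- between 1 and 10.
  refine hS.norm_arithSum_mobius_le (s := √(β * |ν|)) (h := 10) (Real.sqrt_pos.2 hβν)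
    (fun y hy' => ?_) (fun y hy' => ?_) (fun y hy' => ?_) (by norm_num) ?_ ?_ ?_ hBX
  · have := (hy y hy').1
    intro h0
    rw [h0, abs_zero] at this
    linarith
  · obtain ⟨h1, h2, _, _⟩ := hy y hy'
    rw [hsq, abs_of_pos hβ, le_div_iff₀ (by positivity), div_le_iff₀ (by positivity)]
    have q1 : |1 + ν * (y - t₀)| ^ 3 ≤ (9 / 8) ^ 3 := by gcongr
    have q2 : (7 / 8 : ℝ) ^ 3 ≤ |1 + ν * (y - t₀)| ^ 3 := by gcongr
    norm_num at q1 q2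
    constructor <;> nlinarith
  · obtain ⟨h1, h2, h3, h4⟩ := hy y hy'
    rw [hsq, abs_of_pos hβ, le_div_iff₀ (by positivity), div_le_iff₀ (by positivity)]
    have q1 : |1 + ν * (y - t₀)| ^ 4 ≤ (9 / 8) ^ 4 := by gcongr
    have q2 : (7 / 8 : ℝ) ^ 4 ≤ |1 + ν * (y - t₀)| ^ 4 := by gcongr
    norm_num at q1 q2
    constructor <;> nlinarith
  · calc (10 : ℝ) ≤ L := hS.ten_le
      _ ≤ L ^ 130 := le_self_pow₀ hL1 (by norm_num)
  · refine (abs_le_of_sq_le_sq' ?_ (by positivity)).2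
    rw [mul_pow, hsq, ← pow_mul]
    exact hνβ
  · have hsT' : L ^ 2500 ≤ √T := by
      refine Real.le_sqrt_of_sq_le ?_
      rw [← pow_mul]; exact hS.pow_le
    have hsTT : √T * √T = T := Real.mul_self_sqrt hT0.le
    rw [mul_pow, hsq]
    have h2 : |ν| * √T * L ^ 2500 ≤ 1 / 8 := by
      refine le_trans ?_ hν
      rw [mul_assoc]
      refine mul_le_mul_of_nonneg_left ?_ hν0.le
      calc √T * L ^ 2500 ≤ √T * √T := by gcongr
        _ = T := hsTT
    have h3 : (10 : ℝ) ^ 2 ≤ L ^ 2 := by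
      have := hS.ten_le
      gcongr
    calc 10 ^ 2 * (β * |ν|) * √T * L ^ 2000 ≤ L ^ 2 * (L ^ 10 * |ν|) * √T * L ^ 2000 := by gcongr
      _ = |ν| * √T * L ^ 2012 := by ring
      _ ≤ |ν| * √T * L ^ 2500 :=
        mul_le_mul_of_nonneg_left (pow_le_pow_right₀ hL1 (by norm_num)) (by positivity)
      _ ≤ 1 := by linarith

/-- Here `β |ν|` is `1 / T` up to powers of `L`. At relative distance `L ^ (-18)` from the pole and
the zero, the derivative expressions lie between `1 / (L ^ 36 T)` and `L ^ 87 / T`, whose ratio is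
`h = L ^ 123`. -/
theorem SieveScales.norm_arithSum_mobius_le_of_steep {T L ℓ : ℝ} {X U J : ℕ}
    (hS : SieveScales T L ℓ X U J) {β ν t₀ : ℝ} {A B : ℕ} (hβ : 1 ≤ β * L ^ 10) (hβL : β ≤ L ^ 10)
    (ht₀ : t₀ ∈ Set.Icc 0 T) (hν : 1 / 8 ≤ |ν| * T) (hνL : |ν| * T ≤ 4 * L)
    (hy₁ : ∀ y ∈ Set.Icc ((A : ℝ) + 1) B, 1 / L ^ 18 ≤ |1 + ν * (y - t₀)|)
    (hy₂ : ∀ y ∈ Set.Icc ((A : ℝ) + 1) B, 1 / L ^ 18 ≤ |2 - 2 * ν * t₀ - ν * y|) (hBX : B ≤ X) :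
    ‖arithSum (primeInd * primeInd) A B (fun n => addChar (mobiusPhase β ν t₀ n))‖ ≤
      30 * (ℓ ^ 5 * (T / L ^ 20)) := by
  have hL10 := hS.ten_le
  have hL1 : 1 ≤ L := by linarith
  have hL0 : 0 < L := by linarith
  have hmono : ∀ {i j : ℕ}, i ≤ j → L ^ i ≤ L ^ j := fun h => pow_le_pow_right₀ hL1 h
  have hT0 : 0 < T := lt_of_lt_of_le (by positivity) hS.pow_le
  have hβ0 : 0 < β := by
    by_contra hcon
    have : 0 < L ^ 10 := by positivity
    nlinarith
  have hBT : (B : ℝ) ≤ T := le_trans (by exact_mod_cast hBX) hS.le_T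
  have hA0 : (0 : ℝ) ≤ A := Nat.cast_nonneg A
  have hν0 : 0 ≤ |ν| := abs_nonneg ν
  have hbd : ∀ x : ℝ, |x| ≤ T → |ν * x| ≤ 4 * L := fun x hx => by
    rw [abs_mul]
    exact (mul_le_mul_of_nonneg_left hx hν0).trans hνL
  have hy : ∀ y ∈ Set.Icc ((A : ℝ) + 1) B, |1 + ν * (y - t₀)| ≤ 5 * L ∧
      |2 - 2 * ν * t₀ - ν * y| ≤ 2 * L ^ 2 := by
    intro y hy
    have h1 := abs_le.1 (hbd (y - t₀) (abs_le.2 ⟨by linarith [hy.1, ht₀.2], by linarith [hy.2, ht₀.1]⟩))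
    have h2 := abs_le.1 (hbd t₀ (abs_le.2 ⟨by linarith [ht₀.1], ht₀.2⟩))
    have h3 := abs_le.1 (hbd y (abs_le.2 ⟨by linarith [hy.1], by linarith [hy.2]⟩))
    constructor <;> rw [abs_le] <;> constructor <;> nlinarith [h1.1, h1.2, h2.1, h2.2, h3.1, h3.2]
  have hs0 : 0 < 1 / (L ^ 36 * T) := by positivity
  have hsq : √(1 / (L ^ 36 * T)) ^ 2 = 1 / (L ^ 36 * T) := Real.sq_sqrt hs0.le
  have hsT' : L ^ 2500 ≤ √T := by
    refine Real.le_sqrt_of_sq_le ?_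
    rw [← pow_mul]; exact hS.pow_le
  have hsTT : √T * √T = T := Real.mul_self_sqrt hT0.le
  have hκ : 0 < 1 / L ^ 18 := by positivity
  have c1 : 1 / (8 * L ^ 10 * T) ≤ β * |ν| := by
    rw [div_le_iff₀ (by positivity)]
    calc (1 : ℝ) = 8 * (1 * (1 / 8)) := by norm_num
      _ ≤ 8 * ((β * L ^ 10) * (|ν| * T)) := by gcongr
      _ = β * |ν| * (8 * L ^ 10 * T) := by ring
  have c2 : β * |ν| ≤ 4 * L ^ 11 / T := by
    rw [le_div_iff₀ hT0]
    calc β * |ν| * T = β * (|ν| * T) := by ring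
      _ ≤ L ^ 10 * (4 * L) := by gcongr
      _ = 4 * L ^ 11 := by ring
  have hL4 : (10 : ℝ) ^ 1 ≤ L ^ 1 := by simpa using hL10
  refine hS.norm_arithSum_mobius_le (s := √(1 / (L ^ 36 * T))) (h := L ^ 123)
    (Real.sqrt_pos.2 hs0) (fun y hy' => ?_) (fun y hy' => ?_) (fun y hy' => ?_) (one_le_pow₀ hL1)
    (hmono (by norm_num)) ?_ ?_ hBX
  · have := hy₁ y hy'
    intro h0
    rw [h0, abs_zero] at this
    linarith
  · obtain ⟨h2, _⟩ := hy y hy'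
    have h1 := hy₁ y hy'
    have hpos := hκ.trans_le h1
    rw [hsq, abs_of_pos hβ0]
    constructor
    · calc 1 / (L ^ 36 * T) ≤ 2 * (1 / (8 * L ^ 10 * T)) / (L ^ 2) ^ 3 := by
            rw [mul_div_assoc', div_div, div_le_div_iff₀ (by positivity) (by positivity)]
            calc 1 * (8 * L ^ 10 * T * (L ^ 2) ^ 3) = 8 * (L ^ 16 * T) := by ring
              _ ≤ 2 * L ^ 1 * (L ^ 16 * T) := by gcongr; linarith
              _ = 2 * 1 * (L ^ 17 * T) := by ring
              _ ≤ 2 * 1 * (L ^ 36 * T) := by gcongr; norm_num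
        _ ≤ 2 * (β * |ν|) / (L ^ 2) ^ 3 := by gcongr
        _ ≤ 2 * (β * |ν|) / |1 + ν * (y - t₀)| ^ 3 := by gcongr; nlinarith
        _ = _ := by ring
    · calc 2 * β * |ν| / |1 + ν * (y - t₀)| ^ 3 = 2 * (β * |ν|) / |1 + ν * (y - t₀)| ^ 3 := by ring
        _ ≤ 2 * (4 * L ^ 11 / T) / (1 / L ^ 18) ^ 3 := by gcongr
        _ = 8 * L ^ 65 / T := by field_simp; norm_num
        _ ≤ L ^ 1 * L ^ 65 / T := by gcongr; linarith
        _ = L ^ 66 / T := by ring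
        _ ≤ L ^ 87 / T := by gcongr; norm_num
        _ = L ^ 123 * (1 / (L ^ 36 * T)) := by field_simp
  · obtain ⟨h2, h4⟩ := hy y hy'
    have h1 := hy₁ y hy'
    have h3 := hy₂ y hy'
    have hpos := hκ.trans_le h1
    rw [hsq, abs_of_pos hβ0]
    constructor
    · calc 1 / (L ^ 36 * T) = 1 / (L ^ 36 * T) := rfl
        _ ≤ 2 * (1 / (8 * L ^ 10 * T)) * (1 / L ^ 18) / L ^ 7 := by
            have e : 2 * (1 / (8 * L ^ 10 * T)) * (1 / L ^ 18) / L ^ 7 = L / (4 * (L ^ 36 * T)) := by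
              field_simp; norm_num
            rw [e, div_le_div_iff₀ (by positivity) (by positivity)]
            have : 0 < L ^ 36 * T := by positivity
            nlinarith
        _ ≤ 2 * (β * |ν|) * |2 - 2 * ν * t₀ - ν * y| / |1 + ν * (y - t₀)| ^ 4 := by
            have h5 : |1 + ν * (y - t₀)| ^ 4 ≤ L ^ 7 := by
              calc |1 + ν * (y - t₀)| ^ 4 ≤ (5 * L) ^ 4 := by gcongr
                _ = 625 * L ^ 4 := by ring
                _ ≤ 10 ^ 3 * L ^ 4 := by gcongr; norm_num
                _ ≤ L ^ 3 * L ^ 4 := by gcongr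
                _ = L ^ 7 := by ring
            gcongr
        _ = _ := by ring
    · calc 2 * β * |ν| * |2 - 2 * ν * t₀ - ν * y| / |1 + ν * (y - t₀)| ^ 4 =
          2 * (β * |ν|) * |2 - 2 * ν * t₀ - ν * y| / |1 + ν * (y - t₀)| ^ 4 := by ring
        _ ≤ 2 * (4 * L ^ 11 / T) * (2 * L ^ 2) / (1 / L ^ 18) ^ 4 := by gcongr
        _ = 16 * L ^ 85 / T := by field_simp; norm_num
        _ ≤ L ^ 2 * L ^ 85 / T := by gcongr; nlinarith
        _ = L ^ 87 / T := by ring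
        _ = L ^ 123 * (1 / (L ^ 36 * T)) := by field_simp
  · refine (abs_le_of_sq_le_sq' ?_ (by positivity)).2
    rw [mul_pow, hsq, ← pow_mul]
    have e : 1 / (L ^ 36 * T) * T ^ 2 = T / L ^ 36 := by field_simp
    rw [e, le_div_iff₀ (by positivity), ← pow_add]
    exact (hmono (by norm_num)).trans hS.pow_le
  · rw [mul_pow, hsq, ← pow_mul]
    have e : L ^ (123 * 2) * (1 / (L ^ 36 * T)) * √T * L ^ 2000 = L ^ 2210 * √T / T := by
      field_simp
    rw [e, div_le_one hT0]
    calc L ^ 2210 * √T ≤ √T * √T := by gcongr; exact (hmono (by norm_num)).trans hsT'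
      _ = T := hsTT

/-! ### The divisor bound and the choice of parameters. -/

/-- By multiplicativity it suffices to compare `e + 1` with `p ^ (e ε)`. For `p ≥ 2 ^ (1 / ε)` the
inequality holds outright, from `e + 1 ≤ 2 ^ e`; each of the finitely many smaller primes costs a
factor `K`. -/
theorem card_divisors_le_rpow {ε : ℝ} (hε : 0 < ε) :
    ∃ C : ℝ, 0 < C ∧ ∀ n : ℕ, n ≠ 0 → (n.divisors.card : ℝ) ≤ C * (n : ℝ) ^ ε := by
  have hlog2 : 0 < Real.log 2 := Real.log_pos (by norm_num)
  set K : ℝ := 1 + 1 / (ε * Real.log 2) with hK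
  have hK1 : 1 ≤ K := by rw [hK]; linarith [show 0 < 1 / (ε * Real.log 2) by positivity]
  set P : ℕ := ⌈(2 : ℝ) ^ (1 / ε)⌉₊ with hP
  refine ⟨K ^ P, by positivity, fun n hn => ?_⟩
  have hlocal : ∀ p ∈ n.primeFactors, ((n.factorization p + 1 : ℕ) : ℝ) ≤
      (if p < P then K else 1) * ((p : ℝ) ^ n.factorization p) ^ ε := by
    intro p hp
    have hp2 : (2 : ℝ) ≤ p := by exact_mod_cast (Nat.prime_of_mem_primeFactors hp).two_le
    set e := n.factorization p
    have h1 : ((2 : ℝ) ^ e) ^ ε ≤ ((p : ℝ) ^ e) ^ ε := by gcongr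
    push_cast
    split_ifs with h
    · have h2 : ((2 : ℝ) ^ e) ^ ε = Real.exp (e * (ε * Real.log 2)) := by
        rw [← Real.rpow_natCast, ← Real.rpow_mul (by norm_num), Real.rpow_def_of_pos (by norm_num)]
        congr 1; ring
      have h3 := Real.add_one_le_exp (e * (ε * Real.log 2))
      have h4 : (e : ℝ) + 1 ≤ K * (e * (ε * Real.log 2) + 1) := by
        rw [hK]
        have e1 : (1 + 1 / (ε * Real.log 2)) * (e * (ε * Real.log 2) + 1) =
            e * (ε * Real.log 2) + 1 + e + 1 / (ε * Real.log 2) := by field_simp; ring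
        rw [e1]
        have : 0 ≤ e * (ε * Real.log 2) := by positivity
        have : 0 < 1 / (ε * Real.log 2) := by positivity
        linarith
      refine h4.trans (mul_le_mul_of_nonneg_left ?_ (by linarith))
      rw [h2] at h1
      linarith
    · rw [one_mul]
      have h2 : (2 : ℝ) ≤ (p : ℝ) ^ ε := by
        have h3 : (2 : ℝ) ^ (1 / ε) ≤ p := (Nat.le_ceil _).trans (by exact_mod_cast not_lt.1 h)
        calc (2 : ℝ) = ((2 : ℝ) ^ (1 / ε)) ^ ε := by
              rw [← Real.rpow_mul (by norm_num), one_div_mul_cancel hε.ne', Real.rpow_one]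
          _ ≤ (p : ℝ) ^ ε := by gcongr
      have h3 : ((p : ℝ) ^ e) ^ ε = ((p : ℝ) ^ ε) ^ e := by
        rw [← Real.rpow_natCast, ← Real.rpow_natCast, ← Real.rpow_mul (by linarith),
          ← Real.rpow_mul (by linarith), mul_comm]
      rw [h3]
      have h4 : ((e + 1 : ℕ) : ℝ) ≤ (2 : ℝ) ^ e := by exact_mod_cast Nat.lt_two_pow_self
      push_cast at h4
      exact h4.trans (by gcongr)
  rw [Nat.card_divisors hn, Nat.cast_prod]
  refine (Finset.prod_le_prod (fun _ _ => Nat.cast_nonneg _) hlocal).trans ?_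
  rw [Finset.prod_mul_distrib]
  have h1 : ∏ p ∈ n.primeFactors, ((p : ℝ) ^ n.factorization p) ^ ε = (n : ℝ) ^ ε := by
    rw [Real.finsetProd_rpow _ _ fun p _ => by positivity]
    congr 1
    have := Nat.prod_factorization_pow_eq_self hn
    rw [Finsupp.prod, Nat.support_factorization] at this
    exact_mod_cast this
  rw [h1]
  refine mul_le_mul_of_nonneg_right ?_ (by positivity)
  rw [Finset.prod_ite, Finset.prod_const, Finset.prod_const_one, mul_one]
  refine pow_le_pow_right₀ hK1 ?_
  have hsub : n.primeFactors.filter (fun p => p < P) ⊆ Finset.range P := fun p hp =>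
    Finset.mem_range.2 (Finset.mem_filter.1 hp).2
  simpa using Finset.card_le_card hsub

/-- For large `T` the power `ℓ = T ^ (η / 10)` dominates the logarithm, the harmonic sum, the number
of dyadic scales and the divisor function. The relation `ℓ ^ 10 = T ^ η` lets every `ℓ ^ 5` be
absorbed in a single factor `L`, and `η ≤ 1 / 5000` gives `L ^ 5000 ≤ T`. -/
theorem exists_sieveScales {η : ℝ} (hη : 0 < η) (hη' : η ≤ 1 / 5000) :
    ∃ T₀ : ℝ, 1 ≤ T₀ ∧ ∀ T, T₀ ≤ T → ∃ (ℓ : ℝ) (X U J : ℕ),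
      SieveScales T (T ^ η) ℓ X U J ∧ 1000 ≤ ℓ ∧ ℓ ^ 10 = T ^ η := by
  -- Half of the exponent `η / 10` of `ℓ` is for the divisor bound, the other half absorbs its
  -- constant `C`.
  obtain ⟨C, hC0, hC⟩ := card_divisors_le_rpow (show 0 < η / 20 by positivity)
  have ev1 : ∀ᶠ T : ℝ in Filter.atTop, 2 * Real.log T + 2 ≤ T ^ (η / 10) := by
    have h1 := (isLittleO_log_rpow_atTop (show 0 < η / 10 by positivity)).bound
      (show (0 : ℝ) < 1 / 4 by norm_num)
    have h2 := (tendsto_rpow_atTop (show 0 < η / 10 by positivity)).eventually_ge_atTop 4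
    filter_upwards [h1, h2, Filter.eventually_ge_atTop 1] with T a1 a2 a3
    rw [Real.norm_of_nonneg (Real.log_nonneg a3), Real.norm_of_nonneg (by positivity)] at a1
    linarith
  have ev2 := (tendsto_rpow_atTop (show 0 < η / 10 by positivity)).eventually_ge_atTop 1000
  have ev3 := (tendsto_rpow_atTop (show 0 < η / 20 by positivity)).eventually_ge_atTop C
  obtain ⟨T₀, hT₀⟩ := Filter.eventually_atTop.1 (ev1.and (ev2.and ev3))
  refine ⟨max T₀ 1, le_max_right _ _, fun T hT => ?_⟩
  obtain ⟨a1, a2, a3⟩ := hT₀ T ((le_max_left _ _).trans hT)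
  have hT1 : 1 ≤ T := (le_max_right _ _).trans hT
  have hT0 : 0 < T := by linarith
  set ℓ : ℝ := T ^ (η / 10) with hℓ
  have hℓL : ℓ ^ 10 = T ^ η := by
    rw [hℓ, ← Real.rpow_natCast, ← Real.rpow_mul hT0.le]
    congr 1; push_cast; ring
  have hlogT : 0 ≤ Real.log T := Real.log_nonneg hT1
  have hL10 : 10 ≤ T ^ η := by
    rw [← hℓL]
    have : ℓ ≤ ℓ ^ 10 := le_self_pow₀ (by linarith) (by norm_num)
    linarith
  have hL1 : 1 ≤ T ^ η := by linarith
  set X := ⌊T⌋₊ with hX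
  have hXT : (X : ℝ) ≤ T := Nat.floor_le hT0.le
  have hX1 : 1 ≤ X := Nat.le_floor (by simpa using hT1)
  have hX0 : (0 : ℝ) < X := by exact_mod_cast hX1
  have hlogX : Real.log X ≤ Real.log T := Real.log_le_log hX0 hXT
  set U := ⌊(T ^ η) ^ 270⌋₊ with hU
  have hK : 2 ≤ (T ^ η) ^ 270 := by
    have : T ^ η ≤ (T ^ η) ^ 270 := le_self_pow₀ hL1 (by norm_num)
    linarith
  refine ⟨ℓ, X, U, Nat.log 2 X + 1, ⟨hL10, ?_, hXT, Nat.lt_floor_add_one T,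
    Nat.floor_le (by linarith), ?_, by linarith, by linarith, ?_, ?_, ?_, ?_⟩, a2, hℓL⟩
  · rw [← Real.rpow_natCast, ← Real.rpow_mul hT0.le]
    calc T ^ (η * (5000 : ℕ)) ≤ T ^ (1 : ℝ) :=
          Real.rpow_le_rpow_of_exponent_le hT1 (by push_cast; linarith)
      _ = T := Real.rpow_one T
  · linarith [Nat.lt_floor_add_one ((T ^ η) ^ 270)]
  · intro n hn
    rcases Nat.eq_zero_or_pos n with rfl | hn0
    · simp only [Nat.divisors_zero, Finset.card_empty, Nat.cast_zero]; linarith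
    · have hnT : (n : ℝ) ≤ T := le_trans (by exact_mod_cast hn) hXT
      calc (n.divisors.card : ℝ) ≤ C * (n : ℝ) ^ (η / 20) := hC n (by omega)
        _ ≤ T ^ (η / 20) * T ^ (η / 20) := by gcongr
        _ = ℓ := by rw [hℓ, ← Real.rpow_add hT0]; congr 1; ring
  · have h1 := harmonic_le_one_add_log X
    rw [harmonic_eq_sum_Icc] at h1
    push_cast at h1
    have h2 : ∑ k ∈ Finset.Ioc 0 X, 1 / (k : ℝ) = ∑ k ∈ Finset.Icc 1 X, (k : ℝ)⁻¹ := by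
      refine Finset.sum_congr rfl fun k _ => by rw [one_div]
    rw [h2]; linarith
  · push_cast
    have h1 : (2 : ℝ) ^ Nat.log 2 X ≤ X := by
      exact_mod_cast Nat.pow_log_le_self 2 (by omega)
    have h2 := Real.log_le_log (by positivity) h1
    rw [Real.log_pow] at h2
    have h3 : 1 / 2 < Real.log 2 := by have := Real.log_two_gt_d9; norm_num at this ⊢; linarith
    have h4 : (0 : ℝ) ≤ Nat.log 2 X := Nat.cast_nonneg _
    nlinarith
  · have h1 := (Nat.lt_pow_succ_log_self (b := 2) (by norm_num) X).le
    have h2 : 1 ≤ U := by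
      rw [hU]; exact Nat.le_floor (by push_cast; linarith)
    exact h1.trans (Nat.le_mul_of_pos_left _ h2)

/-! ### Sums over order-connected sets, and excision of bad points. -/

open scoped Classical in
/-- The sum of `(1_P * 1_P)(n) a(n)` over positive integers `n ≤ X` in `S`. -/
noncomputable def semiprimeSumOn (X : ℕ) (S : Set ℝ) (a : ℕ → ℂ) : ℂ :=
  ∑ n ∈ (Finset.Ioc 0 X).filter fun n : ℕ => (n : ℝ) ∈ S, ((primeInd * primeInd) n : ℂ) * a n

/-- Pairs are grouped by their product `n`; the number of ordered prime pairs with product `n` is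
`(primeInd * primeInd) n`. -/
theorem finsum_primePairs_eq {I : Set ℝ} {T : ℝ} {X : ℕ} (hI : I ⊆ Set.Icc 0 T) (hX : T < X + 1)
    (g : ℝ → ℂ) :
    ∑ᶠ x ∈ primePairs I, g ((x.1 : ℝ) * (x.2 : ℝ)) = semiprimeSumOn X I fun n => g n := by
  classical
  rw [finsum_mem_eq_finite_toFinset_sum _ (primePairs_finite hI), semiprimeSumOn]
  have hmaps : ∀ x ∈ (primePairs_finite hI).toFinset,
      x.1 * x.2 ∈ (Finset.Ioc 0 X).filter fun n : ℕ => (n : ℝ) ∈ I := by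
    intro x hx
    obtain ⟨hp, hq, hm⟩ := (Set.Finite.mem_toFinset _).1 hx
    rw [Finset.mem_filter, Finset.mem_Ioc]
    refine ⟨⟨Nat.mul_pos hp.pos hq.pos, ?_⟩, by push_cast; exact hm⟩
    have h1 : ((x.1 * x.2 : ℕ) : ℝ) < X + 1 := by
      push_cast; exact (hI hm).2.trans_lt hX
    have : x.1 * x.2 < X + 1 := by exact_mod_cast h1
    omega
  rw [← Finset.sum_fiberwise_of_maps_to hmaps]
  refine Finset.sum_congr (by congr) fun n hn => ?_
  rw [Finset.mem_filter, Finset.mem_Ioc] at hn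
  have hset : (primePairs_finite hI).toFinset.filter (fun x => x.1 * x.2 = n) =
      n.divisorsAntidiagonal.filter fun x => x.1.Prime ∧ x.2.Prime := by
    ext x
    rw [Finset.mem_filter, Finset.mem_filter, Set.Finite.mem_toFinset,
      Nat.mem_divisorsAntidiagonal]
    constructor
    · rintro ⟨⟨hp, hq, _⟩, h⟩
      exact ⟨⟨h, by omega⟩, hp, hq⟩
    · rintro ⟨⟨h, _⟩, hp, hq⟩
      refine ⟨⟨hp, hq, ?_⟩, h⟩
      have : (x.1 : ℝ) * x.2 = n := by exact_mod_cast h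
      rw [this]; exact hn.2
  have hcount : (((primeInd * primeInd) n : ℝ) : ℂ) =
      ((n.divisorsAntidiagonal.filter fun x => x.1.Prime ∧ x.2.Prime).card : ℂ) := by
    rw [ArithmeticFunction.mul_apply, Finset.card_filter]
    push_cast
    refine Finset.sum_congr rfl fun x _ => ?_
    rw [primeInd_apply, primeInd_apply]
    by_cases h1 : x.1.Prime <;> by_cases h2 : x.2.Prime <;> simp [h1, h2]
  rw [hset, hcount]
  rw [Finset.sum_congr rfl (g := fun _ => g n), Finset.sum_const, nsmul_eq_mul]
  intro x hx
  rw [Finset.mem_filter, Nat.mem_divisorsAntidiagonal] at hx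
  rw [← hx.1.1]; push_cast; rfl

theorem norm_primeInd_mul_primeInd_le (n : ℕ) :
    ‖((primeInd * primeInd) n : ℂ)‖ ≤ n.divisors.card := by
  rw [Complex.norm_real, ArithmeticFunction.mul_apply]
  refine (norm_sum_le _ _).trans ?_
  refine (Finset.sum_le_sum (g := fun _ => (1 : ℝ)) fun x _ => ?_).trans ?_
  · rw [norm_mul, Real.norm_of_nonneg (primeInd_nonneg _), Real.norm_of_nonneg (primeInd_nonneg _)]
    exact mul_le_one₀ (primeInd_le_one _) (primeInd_nonneg _) (primeInd_le_one _)
  · rw [Finset.sum_const, nsmul_eq_mul, mul_one, ← Nat.map_div_right_divisors, Finset.card_map]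

theorem norm_semiprimeSumOn_le_card {X : ℕ} {S : Set ℝ} {a : ℕ → ℂ} {ℓ : ℝ}
    (ha : ∀ n, ‖a n‖ ≤ 1) (hℓ : ∀ n, n ≤ X → (n.divisors.card : ℝ) ≤ ℓ) {s : Finset ℕ}
    (hs : ∀ n, 0 < n → n ≤ X → (n : ℝ) ∈ S → n ∈ s) :
    ‖semiprimeSumOn X S a‖ ≤ s.card * ℓ := by
  classical
  have hℓ0 : 0 ≤ ℓ := (Nat.cast_nonneg _).trans (hℓ 0 (Nat.zero_le X))
  rw [semiprimeSumOn]
  refine (norm_sum_le _ _).trans ((Finset.sum_le_sum (g := fun _ => ℓ) fun n hn => ?_).trans ?_)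
  · rw [Finset.mem_filter, Finset.mem_Ioc] at hn
    rw [norm_mul]
    exact (mul_le_of_le_one_right (norm_nonneg _) (ha n)).trans
      ((norm_primeInd_mul_primeInd_le n).trans (hℓ n hn.1.2))
  · rw [Finset.sum_const, nsmul_eq_mul]
    refine mul_le_mul_of_nonneg_right ?_ hℓ0
    rw [Nat.cast_le]
    refine Finset.card_le_card fun n hn => ?_
    rw [Finset.mem_filter, Finset.mem_Ioc] at hn
    exact hs n hn.1.1 hn.1.2 hn.2

/-- The integers of an order-connected set in `(0, X]` are consecutive. The whole real interval from
the first to the last of them also lies in the set, so derivative bounds known on the set apply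
there. -/
theorem exists_semiprimeSumOn_eq_arithSum (X : ℕ) {S : Set ℝ} (hS : S.OrdConnected) :
    ∃ A B : ℕ, B ≤ X ∧ (∀ y ∈ Set.Icc ((A : ℝ) + 1) B, y ∈ S) ∧
      ∀ a, semiprimeSumOn X S a = arithSum (primeInd * primeInd) A B a := by
  classical
  obtain ⟨s, hs⟩ : ∃ s, s = (Finset.Ioc 0 X).filter fun n : ℕ => (n : ℝ) ∈ S := ⟨_, rfl⟩
  have hmem : ∀ n, n ∈ s ↔ (0 < n ∧ n ≤ X) ∧ (n : ℝ) ∈ S := fun n => by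
    rw [hs, Finset.mem_filter, Finset.mem_Ioc]
  have hsum : ∀ a, semiprimeSumOn X S a = ∑ n ∈ s, ((primeInd * primeInd) n : ℂ) * a n := by
    intro a
    rw [semiprimeSumOn]
    refine Finset.sum_congr ?_ fun _ _ => rfl
    ext n
    rw [hmem, Finset.mem_filter, Finset.mem_Ioc]
  rcases s.eq_empty_or_nonempty with h | h
  · refine ⟨0, 0, Nat.zero_le X, fun y hy => ?_, fun a => ?_⟩
    · have := hy.1.trans hy.2
      norm_num at this
    · rw [hsum, h, arithSum]; simp
  · have hmin := (hmem _).1 (s.min'_mem h)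
    have hmax := (hmem _).1 (s.max'_mem h)
    have hcast : ((s.min' h - 1 : ℕ) : ℝ) + 1 = s.min' h := by
      have : s.min' h - 1 + 1 = s.min' h := by omega
      exact_mod_cast this
    refine ⟨s.min' h - 1, s.max' h, hmax.1.2, fun y hy => ?_, fun a => ?_⟩
    · rw [hcast] at hy
      exact hS.out hmin.2 hmax.2 hy
    · rw [hsum, arithSum]
      refine Finset.sum_congr ?_ fun _ _ => rfl
      ext n
      rw [Finset.mem_Ioc]
      constructor
      · intro hn
        have h1 := s.min'_le n hn
        have h2 := s.le_max' n hn
        omega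
      · rintro ⟨h1, h2⟩
        refine (hmem n).2 ⟨⟨by omega, by omega⟩, hS.out hmin.2 hmax.2 ⟨?_, ?_⟩⟩
        · exact_mod_cast (by omega : s.min' h ≤ n)
        · exact_mod_cast h2

/-- The integers where the affine function is below `κ` in absolute value number at most `2 κ / |d|
+ 1`, each weighted by at most its divisor count. The rest splits by sign, which preserves
order-connectedness. -/
theorem norm_semiprimeSumOn_le_split {X : ℕ} {S : Set ℝ} {a : ℕ → ℂ} {ℓ κ c d : ℝ}
    (ha : ∀ n, ‖a n‖ ≤ 1) (hℓ : ∀ n, n ≤ X → (n.divisors.card : ℝ) ≤ ℓ) (hκ : 0 < κ) (hd : d ≠ 0) :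
    ‖semiprimeSumOn X S a‖ ≤ ‖semiprimeSumOn X (S ∩ {y | κ ≤ c + d * y}) a‖ +
      ‖semiprimeSumOn X (S ∩ {y | c + d * y ≤ -κ}) a‖ + (2 * κ / |d| + 1) * ℓ := by
  classical
  have hℓ0 : 0 ≤ ℓ := (Nat.cast_nonneg _).trans (hℓ 0 (Nat.zero_le X))
  have hsplit : semiprimeSumOn X S a = semiprimeSumOn X (S ∩ {y | κ ≤ c + d * y}) a +
      semiprimeSumOn X (S ∩ {y | c + d * y ≤ -κ}) a +
      semiprimeSumOn X (S ∩ {y | |c + d * y| < κ}) a := by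
    simp only [semiprimeSumOn, Finset.sum_filter]
    rw [← Finset.sum_add_distrib, ← Finset.sum_add_distrib]
    refine Finset.sum_congr rfl fun n _ => ?_
    by_cases hS : (n : ℝ) ∈ S
    · simp only [hS, Set.mem_inter_iff, Set.mem_ofPred_eq, true_and, if_true]
      rcases le_or_gt κ (c + d * n) with h1 | h1
      · rw [if_pos h1, if_neg (by linarith), if_neg (by rw [abs_lt]; rintro ⟨_, h⟩; linarith)]; ring
      · rcases le_or_gt (c + d * n) (-κ) with h2 | h2
        · rw [if_neg (by linarith), if_pos h2, if_neg (by rw [abs_lt]; rintro ⟨h, _⟩; linarith)]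
          ring
        · rw [if_neg (by linarith), if_neg (by linarith), if_pos (abs_lt.2 ⟨h2, h1⟩)]; ring
    · simp [hS]
  have hbad : ‖semiprimeSumOn X (S ∩ {y | |c + d * y| < κ}) a‖ ≤ (2 * κ / |d| + 1) * ℓ := by
    obtain ⟨e, he, hed⟩ : ∃ e : ℝ, |e| = 1 ∧ e * d = |d| := by
      rcases hd.lt_or_gt with h | h
      · exact ⟨-1, by norm_num, by rw [abs_of_neg h]; ring⟩
      · exact ⟨1, by norm_num, by rw [abs_of_pos h]; ring⟩
    have hcard := card_le_of_separated (θ := fun n => e * (c + d * n)) (a := 0) (b := X)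
      (l := |d|) (x := -κ) (y := κ) (abs_pos.2 hd) (by linarith) (fun n m _ _ _ => by
        rw [← hed]; exact le_of_eq (by ring))
    refine (norm_semiprimeSumOn_le_card ha hℓ (s := (Finset.Ioc 0 X).filter
      fun n : ℕ => -κ ≤ e * (c + d * n) ∧ e * (c + d * n) ≤ κ) fun n h1 h2 h3 => ?_).trans ?_
    · rw [Finset.mem_filter, Finset.mem_Ioc]
      refine ⟨⟨h1, h2⟩, ?_⟩
      have h4 : |e * (c + d * n)| < κ := by rw [abs_mul, he, one_mul]; exact h3.2
      exact ⟨(abs_lt.1 h4).1.le, (abs_lt.1 h4).2.le⟩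
    · refine mul_le_mul_of_nonneg_right (hcard.trans (le_of_eq ?_)) hℓ0
      ring
  rw [hsplit]
  exact (norm_add_le _ _).trans (add_le_add (norm_add_le _ _) hbad)

theorem ordConnected_le_affine (κ c d : ℝ) : {y : ℝ | κ ≤ c + d * y}.OrdConnected := by
  refine ⟨fun x hx y hy z hz => ?_⟩
  simp only [Set.mem_ofPred_eq] at *
  rcases le_total 0 d with h | h
  · nlinarith [hz.1]
  · nlinarith [hz.2]

theorem ordConnected_affine_le (κ c d : ℝ) : {y : ℝ | c + d * y ≤ -κ}.OrdConnected := by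
  have : {y : ℝ | c + d * y ≤ -κ} = {y : ℝ | κ ≤ -c + -d * y} := by
    ext y; simp only [Set.mem_ofPred_eq]; constructor <;> intro h <;> linarith
  rw [this]; exact ordConnected_le_affine κ (-c) (-d)

/-! ### Large curvature. -/

theorem norm_addChar_sub_le (x y : ℝ) : ‖addChar x - addChar y‖ ≤ 7 * |x - y| := by
  have h1 : addChar x - addChar y = addChar y * (addChar (x - y) - 1) := by
    rw [mul_sub, ← addChar_add, mul_one]; congr 2; ring
  have h2 : addChar (x - y) = Complex.exp (Complex.I * (2 * Real.pi * (x - y) : ℝ)) := by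
    rw [addChar]; congr 1; push_cast; ring
  rw [h1, norm_mul, norm_addChar, one_mul, h2]
  refine (Real.norm_exp_I_mul_ofReal_sub_one_le).trans ?_
  rw [Real.norm_eq_abs, abs_mul, abs_of_pos (by positivity : 0 < 2 * Real.pi)]
  exact mul_le_mul_of_nonneg_right (by linarith [Real.pi_lt_d2]) (abs_nonneg _)

/-- The set is cut at the pole and each part again at the zero of the type II quantity, leaving four
order-connected pieces. Because `|ν| ≥ 1 / (8T)`, the discarded neighbourhoods contain `O(T / L ^
17)` integers. -/
theorem SieveScales.norm_semiprimeSumOn_mobius_le_of_steep {T L ℓ : ℝ} {X U J : ℕ}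
    (hS : SieveScales T L ℓ X U J) (hℓ : 1000 ≤ ℓ) (hℓL : ℓ ^ 10 = L) {β ν t₀ : ℝ} {I : Set ℝ}
    (hI : I.OrdConnected) (hβ : 1 ≤ β * L ^ 10) (hβL : β ≤ L ^ 10)
    (ht₀ : t₀ ∈ Set.Icc 0 T) (hν : 1 / 8 ≤ |ν| * T) (hνL : |ν| * T ≤ 4 * L) :
    ‖semiprimeSumOn X I fun n => addChar (mobiusPhase β ν t₀ n)‖ ≤ T / L ^ 16 := by
  have hL10 := hS.ten_le
  have hL1 : 1 ≤ L := by linarith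
  have hL0 : 0 < L := by linarith
  have hT0 : 0 < T := lt_of_lt_of_le (by positivity) hS.pow_le
  have hν0 : ν ≠ 0 := by rintro rfl; norm_num at hν
  have hκ : 0 < 1 / L ^ 18 := by positivity
  set a : ℕ → ℂ := fun n => addChar (mobiusPhase β ν t₀ n) with ha
  have ha1 : ∀ n, ‖a n‖ ≤ 1 := fun n => (norm_addChar _).le
  have hpiece : ∀ S : Set ℝ, S.OrdConnected → (∀ y ∈ S, 1 / L ^ 18 ≤ |1 + ν * (y - t₀)|) →
      (∀ y ∈ S, 1 / L ^ 18 ≤ |2 - 2 * ν * t₀ - ν * y|) →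
      ‖semiprimeSumOn X S a‖ ≤ 30 * (ℓ ^ 5 * (T / L ^ 20)) := by
    intro S hSc h1 h2
    obtain ⟨A, B, hBX, hAB, hsum⟩ := exists_semiprimeSumOn_eq_arithSum X hSc
    rw [hsum]
    exact hS.norm_arithSum_mobius_le_of_steep hβ hβL ht₀ hν hνL (fun y hy => h1 y (hAB y hy))
      (fun y hy => h2 y (hAB y hy)) hBX
  have hhalf : ∀ S : Set ℝ, S.OrdConnected → (∀ y ∈ S, 1 / L ^ 18 ≤ |1 + ν * (y - t₀)|) →
      ‖semiprimeSumOn X S a‖ ≤ 60 * (ℓ ^ 5 * (T / L ^ 20)) +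
        (2 * (1 / L ^ 18) / |ν| + 1) * ℓ := by
    intro S hSc h1
    have h := norm_semiprimeSumOn_le_split (S := S) ha1 hS.div_le hκ (c := 2 - 2 * ν * t₀)
      (neg_ne_zero.2 hν0)
    rw [abs_neg] at h
    have e1 := hpiece (S ∩ {y | 1 / L ^ 18 ≤ 2 - 2 * ν * t₀ + -ν * y})
      (hSc.inter (ordConnected_le_affine _ _ _)) (fun y hy => h1 y hy.1) (fun y hy => by
        refine le_trans ?_ (le_abs_self _)
        have := hy.2
        simp only [Set.mem_ofPred_eq] at this
        linarith)
    have e2 := hpiece (S ∩ {y | 2 - 2 * ν * t₀ + -ν * y ≤ -(1 / L ^ 18)})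
      (hSc.inter (ordConnected_affine_le _ _ _)) (fun y hy => h1 y hy.1) (fun y hy => by
        refine le_trans ?_ (neg_le_abs _)
        have := hy.2
        simp only [Set.mem_ofPred_eq] at this
        linarith)
    linarith
  have h := norm_semiprimeSumOn_le_split (S := I) ha1 hS.div_le hκ (c := 1 - ν * t₀) hν0
  have e1 := hhalf (I ∩ {y | 1 / L ^ 18 ≤ 1 - ν * t₀ + ν * y})
    (hI.inter (ordConnected_le_affine _ _ _)) (fun y hy => by
      refine le_trans ?_ (le_abs_self _)
      have := hy.2
      simp only [Set.mem_ofPred_eq] at this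
      linarith)
  have e2 := hhalf (I ∩ {y | 1 - ν * t₀ + ν * y ≤ -(1 / L ^ 18)})
    (hI.inter (ordConnected_affine_le _ _ _)) (fun y hy => by
      refine le_trans ?_ (neg_le_abs _)
      have := hy.2
      simp only [Set.mem_ofPred_eq] at this
      linarith)
  set u : ℝ := T / L ^ 17 with hu
  have hu1 : 1 ≤ u := by
    rw [hu, one_le_div (by positivity)]
    exact (pow_le_pow_right₀ hL1 (by norm_num)).trans hS.pow_le
  have hLu : T / L ^ 16 = L * u := by rw [hu]; field_simp
  have hu20 : T / L ^ 20 ≤ u := by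
    rw [hu]; exact div_le_div_of_nonneg_left hT0.le (by positivity)
      (pow_le_pow_right₀ hL1 (by norm_num))
  have hκu : 2 * (1 / L ^ 18) / |ν| ≤ 16 * u := by
    have hν1 : 0 < |ν| := abs_pos.2 hν0
    rw [div_le_iff₀ hν1, hu]
    have h1 : 1 / L ^ 18 ≤ 1 / L ^ 17 := one_div_le_one_div_of_le (by positivity)
      (pow_le_pow_right₀ hL1 (by norm_num))
    have h2 : 16 * (T / L ^ 17) * |ν| = 16 * (|ν| * T) * (1 / L ^ 17) := by ring
    rw [h2]
    have : 0 < 1 / L ^ 17 := by positivity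
    nlinarith
  have hℓ5 : 1000 * ℓ ^ 5 ≤ L := by
    rw [← hℓL, show ℓ ^ 10 = ℓ ^ 5 * ℓ ^ 5 by ring]
    have : (1000 : ℝ) ≤ ℓ ^ 5 := hℓ.trans (le_self_pow₀ (by linarith) (by norm_num))
    gcongr
  have hℓ1 : ℓ ≤ ℓ ^ 5 := le_self_pow₀ (by linarith) (by norm_num)
  have hb1 : ℓ ^ 5 * (T / L ^ 20) ≤ ℓ ^ 5 * u := mul_le_mul_of_nonneg_left hu20 (by positivity)
  have hb2 : (2 * (1 / L ^ 18) / |ν| + 1) * ℓ ≤ 17 * u * ℓ ^ 5 :=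
    mul_le_mul (by linarith) hℓ1 (by linarith) (by linarith)
  have hb3 : 1000 * ℓ ^ 5 * u ≤ L * u := mul_le_mul_of_nonneg_right hℓ5 (by linarith)
  have hb4 : 0 ≤ ℓ ^ 5 * u := by positivity
  rw [hLu]
  linarith

theorem SieveScales.norm_semiprimeSumOn_mobius_le_of_large {T L ℓ : ℝ} {X U J : ℕ}
    (hS : SieveScales T L ℓ X U J) (hℓ : 1000 ≤ ℓ) (hℓL : ℓ ^ 10 = L) {β ν t₀ : ℝ} {I : Set ℝ}
    (hI : I.OrdConnected) (hβ : 1 ≤ β * L ^ 10) (hβL : β ≤ L ^ 10)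
    (ht₀ : t₀ ∈ Set.Icc 0 T) (hν : L ^ 99 ≤ |ν| * T ^ 2) (hνL : |ν| * T ≤ 4 * L) :
    ‖semiprimeSumOn X I fun n => addChar (mobiusPhase β ν t₀ n)‖ ≤ T / L ^ 16 := by
  rcases le_total (1 / 8) (|ν| * T) with h | h
  · exact hS.norm_semiprimeSumOn_mobius_le_of_steep hℓ hℓL hI hβ hβL ht₀ h hνL
  have hL10 := hS.ten_le
  have hL0 : 0 < L := by linarith
  have hT0 : 0 < T := lt_of_lt_of_le (by positivity) hS.pow_le
  have hβ0 : 0 < β := by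
    by_contra hcon
    have : 0 < L ^ 10 := by positivity
    nlinarith
  obtain ⟨A, B, hBX, -, hsum⟩ := exists_semiprimeSumOn_eq_arithSum X hI
  rw [hsum]
  refine (hS.norm_arithSum_mobius_le_of_flat hβ0 hβL ht₀ h ?_ hBX).trans ?_
  · have h1 : β * L ^ 99 ≤ β * |ν| * T ^ 2 := by rw [mul_assoc]; gcongr
    have h2 : β * L ^ 99 = β * L ^ 10 * L ^ 89 := by ring
    have h3 : L ^ 88 ≤ L ^ 89 := pow_le_pow_right₀ (by linarith) (by norm_num)
    have h4 : L ^ 89 ≤ β * L ^ 10 * L ^ 89 := le_mul_of_one_le_left (by positivity) hβ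
    linarith
  · have hℓ5 : 30 * ℓ ^ 5 ≤ L := by
      rw [← hℓL, show ℓ ^ 10 = ℓ ^ 5 * ℓ ^ 5 by ring]
      have : (1000 : ℝ) ≤ ℓ ^ 5 := hℓ.trans (le_self_pow₀ (by linarith) (by norm_num))
      have : 0 < ℓ ^ 5 := by positivity
      gcongr; linarith
    calc 30 * (ℓ ^ 5 * (T / L ^ 20)) = 30 * ℓ ^ 5 * (T / L ^ 20) := by ring
      _ ≤ L * (T / L ^ 20) := by gcongr
      _ = T / L ^ 19 := by field_simp
      _ ≤ T / L ^ 16 := div_le_div_of_nonneg_left hT0.le (by positivity)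
        (pow_le_pow_right₀ (by linarith) (by norm_num))

/-! ### Small curvature: comparison with the linear phase. -/

/-- With `s = ν (y - t₀)` and `s' = ν (y + 1 - t₀)`, the increment of the phase over a unit step is
exactly `β / ((1 + s)(1 + s'))`, which is within `O(β x)` of `β`. -/
theorem abs_mobiusPhase_add_one_sub_le {β ν t₀ y x : ℝ} (hβ : 0 ≤ β) (hx : x ≤ 1 / 8)
    (h₀ : |ν * (y - t₀)| ≤ x) (h₁ : |ν * (y + 1 - t₀)| ≤ x) :
    |(mobiusPhase β ν t₀ (y + 1) - β * (y + 1)) - (mobiusPhase β ν t₀ y - β * y)| ≤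
      3 * (β * x) := by
  obtain ⟨s, hs⟩ : ∃ s, s = ν * (y - t₀) := ⟨_, rfl⟩
  obtain ⟨s', hs'⟩ : ∃ s', s' = ν * (y + 1 - t₀) := ⟨_, rfl⟩
  rw [← hs] at h₀
  rw [← hs'] at h₁
  have hx0 : 0 ≤ x := (abs_nonneg _).trans h₀
  rw [abs_le] at h₀ h₁
  have hpos : 0 < 1 + s := by linarith
  have hpos' : 0 < 1 + s' := by linarith
  have e : (mobiusPhase β ν t₀ (y + 1) - β * (y + 1)) - (mobiusPhase β ν t₀ y - β * y) =
      β * ((1 - (1 + s) * (1 + s')) / ((1 + s) * (1 + s'))) := by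
    rw [mobiusPhase, mobiusPhase, ← hs, ← hs']
    field_simp
    rw [hs, hs']; ring
  have hden : 3 / 4 ≤ (1 + s) * (1 + s') := by nlinarith
  have hnum : |1 - (1 + s) * (1 + s')| ≤ 9 / 4 * x := by
    rw [abs_le]; constructor <;> nlinarith
  rw [e, abs_mul, abs_of_nonneg hβ, abs_div, abs_of_pos (show 0 < (1 + s) * (1 + s') by linarith)]
  have : |1 - (1 + s) * (1 + s')| / ((1 + s) * (1 + s')) ≤ 3 * x := by
    rw [div_le_iff₀ (by linarith)]
    nlinarith
  calc _ ≤ β * (3 * x) := by gcongr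
    _ = _ := by ring

/-- Writing the phase as `β n + φ(n)`, the factor `e(φ(n))` changes by `O(L ^ 112 / T)` per step, so
its total variation is `O(L ^ 112)`. Summation by parts loses this against the `L ^ 132` saved for
`β n`. -/
theorem SieveScales.norm_semiprimeSumOn_mobius_le_of_small {T L ℓ : ℝ} {X U J : ℕ}
    (hS : SieveScales T L ℓ X U J) (hℓ : 1000 ≤ ℓ) (hℓL : ℓ ^ 10 = L) {β ν t₀ : ℝ} {I : Set ℝ}
    (hI : I.OrdConnected) (hβ : 0 ≤ β) (hβL : β ≤ L ^ 10)
    (ht₀ : t₀ ∈ Set.Icc 0 T) (hν : |ν| * T ^ 2 ≤ 2 * L ^ 102) {r : ℕ} {b : ℤ}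
    (hr : L ^ 1000 ≤ r) (hrT : r * L ^ 1000 ≤ T) (hb : IsCoprime b (r : ℤ))
    (hβb : |β - b / r| ≤ 1 / (r : ℝ) ^ 2) :
    ‖semiprimeSumOn X I fun n => addChar (mobiusPhase β ν t₀ n)‖ ≤ T / L ^ 16 := by
  have hL10 := hS.ten_le
  have hL1 : 1 ≤ L := by linarith
  have hL0 : 0 < L := by linarith
  have hmono : ∀ {i j : ℕ}, i ≤ j → L ^ i ≤ L ^ j := fun h => pow_le_pow_right₀ hL1 h
  have hT0 : 0 < T := lt_of_lt_of_le (by positivity) hS.pow_le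
  obtain ⟨A, B, hBX, -, hsum⟩ := exists_semiprimeSumOn_eq_arithSum X hI
  rw [hsum]
  rcases le_or_gt B A with hAB | hAB
  · rw [arithSum, Finset.Ioc_eq_empty (by omega), Finset.sum_empty, norm_zero]; positivity
  have hBT : (B : ℝ) ≤ T := le_trans (by exact_mod_cast hBX) hS.le_T
  set φ : ℝ → ℝ := fun y => mobiusPhase β ν t₀ y - β * y with hφ
  set c : ℕ → ℂ := fun n => ((primeInd * primeInd) n : ℂ) * addChar (β * n) with hc
  set w : ℕ → ℂ := fun n => addChar (φ n) with hw
  have hcw : arithSum (primeInd * primeInd) A B (fun n => addChar (mobiusPhase β ν t₀ n)) =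
      ∑ n ∈ Finset.Ioc A B, c n * w n := by
    rw [arithSum]
    refine Finset.sum_congr rfl fun n _ => ?_
    rw [hc, hw]
    simp only
    rw [mul_assoc, ← addChar_add]
    congr 2
    rw [hφ]; ring
  have hpartial : ∀ b', A ≤ b' → b' ≤ B →
      ‖∑ n ∈ Finset.Ioc A b', c n‖ ≤ 30 * (ℓ ^ 5 * (T / L ^ 132)) := fun b' _ hb' =>
    norm_arithSum_primeInd_linear_le hL10 ((hmono (by norm_num)).trans hS.pow_le) hS.le_T hS.T_le.le
      (hb'.trans hBX) hS.U_le hS.le_U hr hrT hb hβb hS.one_le hS.log_le hS.div_le hS.harm_le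
      hS.J_le hS.X_le
  have hνT : |ν| * T ≤ 2 * L ^ 102 / T := by
    rw [le_div_iff₀ hT0]; calc _ = |ν| * T ^ 2 := by ring
      _ ≤ _ := hν
  have hx : 2 * L ^ 102 / T ≤ 1 / 8 := by
    rw [div_le_iff₀ hT0]
    have h1 : L ^ 102 * L ^ 2 ≤ L ^ 5000 := by rw [← pow_add]; exact hmono (by norm_num)
    have h2 := hS.pow_le
    have h3 : L ^ 102 * 16 ≤ L ^ 102 * L ^ 2 := by
      have : (16 : ℝ) ≤ L ^ 2 := by nlinarith
      gcongr
    linarith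
  have hbd : ∀ n : ℕ, n ≤ B → |ν * ((n : ℝ) - t₀)| ≤ 2 * L ^ 102 / T := by
    intro n hn
    rw [abs_mul]
    refine le_trans (mul_le_mul_of_nonneg_left ?_ (abs_nonneg ν)) hνT
    have h1 : (n : ℝ) ≤ B := by exact_mod_cast hn
    have h2 : (0 : ℝ) ≤ n := Nat.cast_nonneg n
    rw [abs_le]
    constructor <;> linarith [ht₀.1, ht₀.2]
  have hstep : ∀ n ∈ Finset.Ico (A + 1) B, ‖w (n + 1) - w n‖ ≤ 42 * L ^ 112 / T := by
    intro n hn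
    rw [Finset.mem_Ico] at hn
    refine (norm_addChar_sub_le _ _).trans ?_
    have h1 := abs_mobiusPhase_add_one_sub_le hβ hx (hbd n (by omega))
      (by have := hbd (n + 1) (by omega); push_cast at this; exact this)
    have h2 : 3 * (β * (2 * L ^ 102 / T)) ≤ 3 * (L ^ 10 * (2 * L ^ 102 / T)) := by gcongr
    have h3 : 7 * (3 * (L ^ 10 * (2 * L ^ 102 / T))) = 42 * L ^ 112 / T := by ring
    rw [hφ]
    push_cast
    linarith
  have hvar : ‖w B‖ + ∑ n ∈ Finset.Ico (A + 1) B, ‖w (n + 1) - w n‖ ≤ 43 * L ^ 112 := by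
    have h1 := Finset.sum_le_sum hstep
    rw [Finset.sum_const, nsmul_eq_mul, Nat.card_Ico] at h1
    have h2 : ((B - (A + 1) : ℕ) : ℝ) ≤ T := le_trans (by exact_mod_cast Nat.sub_le _ _) hBT
    have h3 : ((B - (A + 1) : ℕ) : ℝ) * (42 * L ^ 112 / T) ≤ T * (42 * L ^ 112 / T) := by gcongr
    rw [mul_div_cancel₀ _ hT0.ne'] at h3
    have h4 : ‖w B‖ = 1 := norm_addChar _
    have h5 : 1 ≤ L ^ 112 := one_le_pow₀ hL1
    linarith
  rw [hcw]
  refine (norm_sum_mul_le_of_partial hAB hpartial).trans ?_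
  have hℓ5 : ℓ ^ 5 ≤ L := by
    rw [← hℓL]; exact pow_le_pow_right₀ (by linarith) (by norm_num)
  calc _ ≤ 30 * (ℓ ^ 5 * (T / L ^ 132)) * (43 * L ^ 112) := by gcongr
    _ ≤ 30 * (L * (T / L ^ 132)) * (43 * L ^ 112) := by gcongr
    _ = 1290 * (T / L ^ 19) := by field_simp; norm_num
    _ ≤ L ^ 3 * (T / L ^ 19) := by
      by_cases h : 1290 ≤ L ^ 3
      · gcongr
      · exfalso
        have h1 : (1000 : ℝ) ≤ ℓ ^ 10 := hℓ.trans (le_self_pow₀ (by linarith) (by norm_num))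
        rw [hℓL] at h1
        nlinarith [pow_le_pow_left₀ (by norm_num) h1 3]
    _ = T / L ^ 16 := by field_simp

/-! ### Assembly. -/

theorem SieveScales.norm_semiprimeSum_le {T L ℓ : ℝ} {X U J : ℕ}
    (hS : SieveScales T L ℓ X U J) (hℓ : 1000 ≤ ℓ) (hℓL : ℓ ^ 10 = L) {R μ ν β t₀ : ℝ} {I : Set ℝ}
    (hR : 1 / L ^ 10 ≤ R) (hR' : R ≤ L ^ 10) (hI : I.OrdConnected) (hIT : I ⊆ Set.Icc 0 T)
    (hIL : T / L < volume.real I) (hμ : |μ - 1| ≤ 2 * (L / T)) (hβ : β = 1 / R)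
    (hν : |ν| ≤ 2 * (L / T))
    (hcase : L ^ 100 * (volume.real I) ^ (-2 : ℤ) < |ν| ∨ ∃ (r : ℕ) (b : ℤ), L ^ 1000 ≤ (r : ℝ) ∧
      (r : ℝ) ≤ volume.real I * (1 / L ^ 1000) ∧ IsCoprime b (r : ℤ) ∧
      |β - (b : ℝ) / (r : ℝ)| ≤ L ^ 1000 / ((r : ℝ) * volume.real I))
    (ht₀ : t₀ ∈ Set.Icc 0 T) :
    ‖semiprimeSum I μ ν β t₀‖ ≤ volume.real I / L ^ 15 := by
  have hL10 := hS.ten_le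
  have hL1 : 1 ≤ L := by linarith
  have hL0 : 0 < L := by linarith
  have hmono : ∀ {i j : ℕ}, i ≤ j → L ^ i ≤ L ^ j := fun h => pow_le_pow_right₀ hL1 h
  have hT0 : 0 < T := lt_of_lt_of_le (by positivity) hS.pow_le
  have hLT : L / T ≤ 1 / 4 := by
    rw [div_le_iff₀ hT0]
    have h1 : L ^ 2 ≤ L ^ 5000 := hmono (by norm_num)
    have h2 := hS.pow_le
    nlinarith
  obtain ⟨V, hV⟩ : ∃ V, V = volume.real I := ⟨_, rfl⟩
  rw [← hV] at hIL hcase ⊢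
  have hV0 : 0 < V := lt_trans (by positivity) hIL
  have hVT : V ≤ T := by
    have h1 := measureReal_mono (μ := volume) hIT measure_Icc_lt_top.ne
    rw [Real.volume_real_Icc_of_le hT0.le] at h1
    linarith
  have hμ1 := abs_le.1 hμ
  have hμ0 : 0 < μ := by linarith
  have hμ2 : 1 / 2 ≤ μ := by linarith
  have hμ3 : μ ≤ 2 := by linarith
  have hνμ : |ν / μ| = |ν| / μ := by rw [abs_div, abs_of_pos hμ0]
  have hνle : |ν / μ| ≤ 2 * |ν| := by
    rw [hνμ, div_le_iff₀ hμ0]; nlinarith [abs_nonneg ν]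
  have hleν : |ν| ≤ 2 * |ν / μ| := by
    have h1 : |ν| = μ * |ν / μ| := by rw [hνμ]; field_simp
    have := abs_nonneg (ν / μ)
    nlinarith
  have hR0 : 0 < R := lt_of_lt_of_le (by positivity) hR
  have hβ0 : 0 < β := by rw [hβ]; positivity
  have hβ1 : 1 ≤ β * L ^ 10 := by
    rw [hβ, div_mul_eq_mul_div, one_mul, one_le_div hR0]; exact hR'
  have hβL : β ≤ L ^ 10 := by
    rw [hβ, div_le_iff₀ hR0]
    rw [div_le_iff₀ (by positivity)] at hR
    linarith
  have hsum : semiprimeSum I μ ν β t₀ =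
      semiprimeSumOn X I fun n => addChar (mobiusPhase β (ν / μ) t₀ n) := by
    rw [semiprimeSum, ← finsum_primePairs_eq hIT hS.T_le fun y => addChar (mobiusPhase β (ν / μ) t₀ y)]
    refine finsum_mem_congr rfl fun x _ => ?_
    rw [fracLin_mul_eq_mobiusPhase hμ0.ne']
  suffices h : ‖semiprimeSum I μ ν β t₀‖ ≤ T / L ^ 16 by
    refine h.trans ?_
    rw [div_lt_iff₀ hL0] at hIL
    rw [div_le_div_iff₀ (by positivity) (by positivity)]
    calc T * L ^ 15 ≤ V * L * L ^ 15 := by gcongr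
      _ = V * L ^ 16 := by ring
  rw [hsum]
  -- The split is on the size of `|ν|` itself: hypothesis 2 alone does not bound `|ν|`, and the
  -- comparison with a linear phase needs it small.
  by_cases hlarge : L ^ 100 * V ^ (-2 : ℤ) < |ν|
  · refine hS.norm_semiprimeSumOn_mobius_le_of_large hℓ hℓL hI hβ1 hβL ht₀ ?_ ?_
    · rw [zpow_neg, show V ^ (2 : ℤ) = V ^ 2 from zpow_natCast V 2, ← div_eq_mul_inv,
        div_lt_iff₀ (by positivity)] at hlarge
      have h1 : |ν| * V ^ 2 ≤ |ν| * T ^ 2 := by gcongr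
      have h2 : |ν| * T ^ 2 ≤ 2 * |ν / μ| * T ^ 2 := by gcongr
      have h3 : L ^ 100 = L * L ^ 99 := by ring
      have h4 : 10 * L ^ 99 ≤ L * L ^ 99 := by gcongr
      nlinarith [show 0 < L ^ 99 by positivity]
    · calc |ν / μ| * T ≤ 2 * |ν| * T := by gcongr
        _ ≤ 2 * (2 * (L / T)) * T := by gcongr
        _ = 4 * L := by field_simp; norm_num
  · obtain ⟨r, b, hr, hrV, hb, hβb⟩ := hcase.resolve_left hlarge
    have hrV' : r * L ^ 1000 ≤ V := by
      rwa [mul_one_div, le_div_iff₀ (by positivity)] at hrV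
    have hr0 : (0 : ℝ) < r := lt_of_lt_of_le (by positivity) hr
    refine hS.norm_semiprimeSumOn_mobius_le_of_small hℓ hℓL hI hβ0.le hβL ht₀ ?_ hr
      (hrV'.trans hVT) hb (hβb.trans ?_)
    · rw [not_lt, zpow_neg, show V ^ (2 : ℤ) = V ^ 2 from zpow_natCast V 2, ← div_eq_mul_inv,
        le_div_iff₀ (by positivity)] at hlarge
      rw [div_lt_iff₀ hL0] at hIL
      calc |ν / μ| * T ^ 2 ≤ 2 * |ν| * (V * L) ^ 2 := by gcongr
        _ = 2 * (|ν| * V ^ 2) * L ^ 2 := by ring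
        _ ≤ 2 * L ^ 100 * L ^ 2 := by gcongr
        _ = 2 * L ^ 102 := by ring
    -- The given quality of approximation is at least `1 / r²`, because `r L ^ 1000 ≤ |I|`.
    · rw [div_le_div_iff₀ (by positivity) (by positivity)]
      calc L ^ 1000 * (r : ℝ) ^ 2 = r * (r * L ^ 1000) := by ring
        _ ≤ r * V := by gcongr
        _ = 1 * (r * V) := by ring

theorem norm_semiprimeSum_le_sq {T : ℝ} (hT : 1 ≤ T) {I : Set ℝ} (hI : I ⊆ Set.Icc 0 T)
    (μ ν β t₀ : ℝ) : ‖semiprimeSum I μ ν β t₀‖ ≤ T ^ 2 := by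
  have hXT : (⌊T⌋₊ : ℝ) ≤ T := Nat.floor_le (by linarith)
  rw [semiprimeSum, finsum_primePairs_eq hI (Nat.lt_floor_add_one T)
    fun y => addChar (fracLin μ ν (y - t₀) * β)]
  refine (norm_semiprimeSumOn_le_card (ℓ := T) (s := Finset.Ioc 0 ⌊T⌋₊)
    (fun n => (norm_addChar _).le) (fun n hn => ?_) fun n h1 h2 _ => Finset.mem_Ioc.2 ⟨h1, h2⟩).trans
    ?_
  · refine le_trans ?_ hXT
    exact_mod_cast n.card_divisors_le_self.trans hn
  · rw [Nat.card_Ioc, Nat.sub_zero, sq]; gcongr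

theorem proposition7p3 :
    ∃ ε₀ : ℝ, 0 < ε₀ ∧
      ∀ A₅ δ : ℝ, 0 < A₅ → 0 < δ → δ < 1 / 100 → A₅ * δ ≤ ε₀ →
        ∃ C : ℝ, 0 < C ∧
          ∀ (T R μ ν β t₀ : ℝ) (I : Set ℝ),
            0 < T →
            T ^ (-10 * A₅ * δ) ≤ R → R ≤ T ^ (10 * A₅ * δ) →
            I.OrdConnected → I ⊆ Set.Icc 0 T → T ^ (1 - A₅ * δ) < volume.real I →
            |μ - 1| ≤ 2 * T ^ (-1 + A₅ * δ) →
            β = 1 / R →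
            |ν| ≤ 2 * T ^ (-1 + A₅ * δ) →
            (T ^ (100 * A₅ * δ) * (volume.real I) ^ (-2 : ℤ) < |ν| ∨
              ∃ (r : ℕ) (b : ℤ),
                T ^ (1000 * A₅ * δ) ≤ (r : ℝ) ∧
                (r : ℝ) ≤ volume.real I * T ^ (-1000 * A₅ * δ) ∧
                IsCoprime b (r : ℤ) ∧
                |β - (b : ℝ) / (r : ℝ)| ≤ T ^ (1000 * A₅ * δ) / ((r : ℝ) * volume.real I)) →
            t₀ ∈ Set.Icc 0 T →
            ‖semiprimeSum I μ ν β t₀‖ ≤ C * (volume.real I * T ^ (-15 * A₅ * δ)) := by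
  refine ⟨1 / 5000, by norm_num, fun A₅ δ hA hδ _ hη' => ?_⟩
  have hη : 0 < A₅ * δ := mul_pos hA hδ
  obtain ⟨T₀, hT₀, hscales⟩ := exists_sieveScales hη hη'
  have hT₀0 : 0 < T₀ := by linarith
  -- The second entry serves `T < T₀`, where the sum is trivially at most `T²` and `|I| ≥ 1`; the
  -- constant 1 serves `T ≥ T₀`.
  refine ⟨max 1 (T₀ ^ 2 * T₀ ^ (15 * A₅ * δ)), by positivity,
    fun T R μ ν β t₀ I hT hR hR' hI hIT hIL hμ hβ hν hcase ht₀ => ?_⟩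
  have hnonneg : 0 ≤ volume.real I * T ^ (-15 * A₅ * δ) := by positivity
  have h15 : 0 < 15 * A₅ * δ := by positivity
  -- For `T < 1` the range allowed for `R` is empty.
  have hT1 : 1 ≤ T := by
    by_contra! hcon
    have h1 : (1 : ℝ) < T ^ (-10 * A₅ * δ) :=
      Real.one_lt_rpow_of_pos_of_lt_one_of_neg hT hcon (by linarith)
    have h2 : T ^ (10 * A₅ * δ) < 1 := Real.rpow_lt_one hT.le hcon (by linarith)
    linarith
  rcases lt_or_ge T T₀ with hTT₀ | hTT₀
  · have hI1 : 1 ≤ volume.real I :=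
      (Real.one_le_rpow hT1 (by linarith)).trans hIL.le
    have hneg : -15 * A₅ * δ = -(15 * A₅ * δ) := by ring
    have h1 : 1 ≤ T₀ ^ (15 * A₅ * δ) * T ^ (-15 * A₅ * δ) := by
      rw [hneg, Real.rpow_neg hT.le, ← div_eq_mul_inv, one_le_div (by positivity)]
      exact Real.rpow_le_rpow hT.le hTT₀.le h15.le
    calc ‖semiprimeSum I μ ν β t₀‖ ≤ T ^ 2 := norm_semiprimeSum_le_sq hT1 hIT μ ν β t₀
      _ ≤ T₀ ^ 2 * 1 * 1 := by rw [mul_one, mul_one]; gcongr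
      _ ≤ T₀ ^ 2 * (T₀ ^ (15 * A₅ * δ) * T ^ (-15 * A₅ * δ)) * volume.real I := by gcongr
      _ = T₀ ^ 2 * T₀ ^ (15 * A₅ * δ) * (volume.real I * T ^ (-15 * A₅ * δ)) := by ring
      _ ≤ _ := mul_le_mul_of_nonneg_right (le_max_right _ _) hnonneg
  · obtain ⟨ℓ, X, U, J, hS, hℓ, hℓL⟩ := hscales T hTT₀
    have hpow : ∀ k : ℕ, T ^ ((k : ℝ) * A₅ * δ) = (T ^ (A₅ * δ)) ^ k := fun k => by
      rw [← Real.rpow_mul_natCast hT.le]; congr 1; ring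
    have hpow' : ∀ k : ℕ, T ^ (-(k : ℝ) * A₅ * δ) = 1 / (T ^ (A₅ * δ)) ^ k := fun k => by
      rw [← hpow k, one_div, ← Real.rpow_neg hT.le]; congr 1; ring
    have p10 := hpow 10
    have p100 := hpow 100
    have p1000 := hpow 1000
    have m10 := hpow' 10
    have m15 := hpow' 15
    have m1000 := hpow' 1000
    simp only [Nat.cast_ofNat] at p10 p100 p1000 m10 m15 m1000
    have q1 : T ^ (1 - A₅ * δ) = T / T ^ (A₅ * δ) := by
      rw [Real.rpow_sub hT, Real.rpow_one]
    have q2 : T ^ (-1 + A₅ * δ) = T ^ (A₅ * δ) / T := by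
      rw [Real.rpow_add hT, Real.rpow_neg_one]; ring
    rw [m10] at hR
    rw [p10] at hR'
    rw [q1] at hIL
    rw [q2] at hμ hν
    rw [p100, p1000, m1000] at hcase
    have := hS.norm_semiprimeSum_le hℓ hℓL hR hR' hI hIT hIL hμ hβ hν hcase ht₀
    rw [div_eq_mul_one_div, ← m15] at this
    exact this.trans (le_mul_of_one_le_left hnonneg (le_max_left _ _))
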